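/- **Theorem 1.4 (estimate of the square function).** Let $G$ be a locally compact group, $m$ a Borel measure on $G$ and $d$ a metric on $G$ (not assumed to induce the topology of $G$). For $h\in G$ write $B(h,r)=\{g\in G: d(g,h)\le r\}$, and suppose that the balls are measurable and that balls and compact sets have finite measure. Let $r_0>0$, $\epsilon\in(0,1]$, and assume: * (annular decay) there is $K>0$ such that for all $h\in G$, $r\in(r_0,\infty)$ and $s\in(0,r]$, $$m(B(h,r+s))-m(B(h,r))\le K\Big(\frac sr\Big)^{\epsilon}m(B(h,r));$$ * (geometric doubling) there is a positive integer $D_0$ such that every ball $B(h,r)$ with $r\in(0,4r_0]$ is covered by at most $D_0$ balls of radius $r/2$. Fix $0<c_0<C_0<\infty$ and $\delta>1$ with $18C_0\delta^{-1}\le c_0$. Let $z_\alpha^k\in G$ ($k\in\mathbb Z$, $\alpha\in I_k$) satisfy $d(z_\alpha^k,z_\beta^k)\ge c_0\delta^k$ for $\alpha\ne\beta$ and $\min_\alpha d(x,z_\alpha^k)<C_0\delta^k$ for all $x\in G$, $k\in\mathbb Z$. Let $Q_\alpha^k\subseteq G$ ($k\in\mathbb Z$, $\alpha\in I_k$) be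 an associated system of dyadic cubes, that is, measurable sets with: (a) $\bigcup_\alpha Q_\alpha^k=G$ for all $k$; (b) if $k\le l$ then $Q_\alpha^k\subseteq Q_\beta^l$ or $Q_\alpha^k\cap Q_\beta^l=\emptyset$; (c) for each $(k,\alpha)$ and $n>k$ there is a unique $\beta$ with $Q_\alpha^k\subseteq Q_\beta^n$; (d) $B(z_\alpha^k,\tfrac{c_0}{3}\delta^k)\subseteq Q_\alpha^k\subseteq B(z_\alpha^k,2C_0\delta^k)$. For locally integrable $f:G\to\mathbb C$ put $$A'_rf(h)=\frac1{m(B(h,r))}\int_{B(h,r)}f\,dm,\qquad \mathbb E_kf=\sum_{\alpha\in I_k}\Big(\frac1{m(Q_\alpha^k)}\int_{Q_\alpha^k}f\,dm\Big)\mathbf 1_{Q_\alpha^k},$$ $$S(f)=\Big(\sum_{n>n_{r_0}}|A'_{\delta^n}f-\mathbb E_nf|^2\Big)^{1/2},$$ where $n_{r_0}$ is the unique integer with $\delta^{n_{r_0}}<r_0\le\delta^{n_{r_0}+1}$. (Averages over sets of measure zero are read as $0$; this affects $S(f)$ only on a null set.) For a real-valued $g\in L^1_{loc}(G,m)$ let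 $$M^\sharp g(x)=\sup_{(k,\alpha):\,x\in Q_\alpha^k}\ \inf_{c}\ \frac1{m(Q_\alpha^k)}\int_{Q_\alpha^k}|g-c|\,dm,\qquad \|g\|_{BMO}=\|M^\sharp g\|_{L^\infty(G,m)}.$$ Then: (i) for every $p\in(1,\infty)$ there is a constant $c_p>0$ such that $\|S(f)\|_{L^p(G,m)}\le c_p\|f\|_{L^p(G,m)}$ for every $f\in L^p(G,m)$; (ii) there is a constant $c>0$ such that for every $f\in L^1(G,m)$ and every $\gamma>0$, $$m\big(\{g\in G:S(f)(g)>\gamma\}\big)\le\frac c\gamma\|f\|_{L^1(G,m)},$$ and, for every compactly supported $f\in L^\infty(G,m)$, the function $S(f)$ is finite almost everywhere and locally integrable, with $\|S(f)\|_{BMO}\le c\|f\|_{L^\infty(G,m)}$. -/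

import Mathlib

open MeasureTheory Set
open scoped ENNReal NNReal

noncomputable section

/-- `d` is a metric on the set `G` (with no compatibility imposed with any topology on `G`). -/
structure IsMetric {G : Type*} (d : G → G → ℝ) : Prop where
  eq_zero_iff : ∀ x y, d x y = 0 ↔ x = y
  symm : ∀ x y, d x y = d y x
  triangle : ∀ x y z, d x z ≤ d x y + d y z

/-- The closed ball `B(h, r) = {g : d(g, h) ≤ r}`. -/
def dBall {G : Type*} (d : G → G → ℝ) (h : G) (r : ℝ) : Set G := {g | d g h ≤ r}

/-- The `(ε, r₀)`-annular decay property of `(G, d, m)`. It is used only for measures which are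
finite on balls, so that `m.real` is the measure itself. -/
def AnnularDecay {G : Type*} [MeasurableSpace G] (d : G → G → ℝ) (m : Measure G)
    (ε r₀ : ℝ) : Prop :=
  ∃ K : ℝ, 0 < K ∧ ∀ h : G, ∀ r : ℝ, r₀ < r → ∀ s : ℝ, 0 < s → s ≤ r →
    m.real (dBall d h (r + s)) - m.real (dBall d h r)
      ≤ K * (s / r) ^ ε * m.real (dBall d h r)

/-- Geometric doubling up to scale `R`: every ball of radius `r ∈ (0, R]` is covered by at most
`D₀` balls of radius `r / 2`. -/
def GeomDoubling {G : Type*} (d : G → G → ℝ) (D₀ : ℕ) (R : ℝ) : Prop :=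
  ∀ r : ℝ, 0 < r → r ≤ R → ∀ h : G,
    ∃ t : Finset G, t.card ≤ D₀ ∧ dBall d h r ⊆ ⋃ x ∈ t, dBall d x (r / 2)

/-- A system of dyadic cubes `Q k α` (`k ∈ ℤ`, `α ∈ I k`) with centres `z k α` and with parameters
`c₀, C₀, δ`. Cubes of generation `k` have size comparable to `δ ^ k`, where `δ > 1`. -/
structure IsDyadicSystem {G : Type*} [MeasurableSpace G] (d : G → G → ℝ) (c₀ C₀ δ : ℝ)
    {I : ℤ → Type*} (z : ∀ k, I k → G) (Q : ∀ k, I k → Set G) : Prop where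
  c₀_pos : 0 < c₀
  c₀_lt : c₀ < C₀
  one_lt : 1 < δ
  small : 18 * C₀ * δ⁻¹ ≤ c₀
  separated : ∀ k (α β : I k), α ≠ β → c₀ * δ ^ k ≤ d (z k α) (z k β)
  dense : ∀ k (x : G), ∃ α : I k, d x (z k α) < C₀ * δ ^ k
  measurableSet : ∀ k (α : I k), MeasurableSet (Q k α)
  iUnion_eq : ∀ k, ⋃ α : I k, Q k α = univ
  nested : ∀ k l, k ≤ l → ∀ (α : I k) (β : I l), Q k α ⊆ Q l β ∨ Q k α ∩ Q l β = ∅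
  existsUnique_ancestor : ∀ k n, k < n → ∀ α : I k, ∃! β : I n, Q k α ⊆ Q n β
  ball_subset : ∀ k (α : I k), dBall d (z k α) (c₀ / 3 * δ ^ k) ⊆ Q k α
  subset_ball : ∀ k (α : I k), Q k α ⊆ dBall d (z k α) (2 * C₀ * δ ^ k)

/-- The ball average `A'_r f (h) = m(B(h, r))⁻¹ ∫_{B(h, r)} f dm`. -/
def ballAvg {G : Type*} [MeasurableSpace G] (d : G → G → ℝ) (m : Measure G) (r : ℝ)
    (f : G → ℂ) (h : G) : ℂ :=
  ⨍ g in dBall d h r, f g ∂m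

/-- The dyadic conditional expectation
`E_k f = ∑_α (m(Q_α^k)⁻¹ ∫_{Q_α^k} f dm) 1_{Q_α^k}`. The cubes of one generation are pairwise
disjoint, so at each point at most one term of the sum is nonzero. -/
def dyadicExp {G : Type*} [MeasurableSpace G] (m : Measure G) {I : ℤ → Type*}
    (Q : ∀ k, I k → Set G) (k : ℤ) (f : G → ℂ) (x : G) : ℂ :=
  ∑' α : I k, (Q k α).indicator (fun _ => ⨍ y in Q k α, f y ∂m) x

/-- The square function `S(f) = (∑_{n > N} |A'_{δ^n} f - E_n f|²)^{1/2}`, with values in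
`[0, ∞]`. -/
def squareFun {G : Type*} [MeasurableSpace G] (d : G → G → ℝ) (m : Measure G) (δ : ℝ)
    {I : ℤ → Type*} (Q : ∀ k, I k → Set G) (N : ℤ) (f : G → ℂ) (x : G) : ℝ≥0∞ :=
  (∑' n : Ioi N, ‖ballAvg d m (δ ^ (n : ℤ)) f x - dyadicExp m Q n f x‖ₑ ^ 2) ^ (1 / 2 : ℝ)

/-- The dyadic sharp maximal function
`M^♯ g (x) = sup_{Q ∋ x} inf_c m(Q)⁻¹ ∫_Q |g - c| dm`, over all dyadic cubes `Q` containing `x`. -/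
def dyadicSharp {G : Type*} [MeasurableSpace G] (m : Measure G) {I : ℤ → Type*}
    (Q : ∀ k, I k → Set G) (g : G → ℝ) (x : G) : ℝ≥0∞ :=
  ⨆ (k : ℤ) (α : I k) (_ : x ∈ Q k α), ⨅ c : ℝ, ⨍⁻ y in Q k α, ‖g y - c‖ₑ ∂m

/-- The dyadic BMO norm `‖g‖_BMO = ‖M^♯ g‖_{L^∞}`. -/
def dyadicBMONorm {G : Type*} [MeasurableSpace G] (m : Measure G) {I : ℤ → Type*}
    (Q : ∀ k, I k → Set G) (g : G → ℝ) : ℝ≥0∞ :=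
  essSup (dyadicSharp m Q g) m

end

/-! Put T_n = A'_{δ^n} - E_n. Above a suitable generation M the relevant balls, including the cores
of the cubes, have radius at least r₀, where annular decay (with s = r) is doubling. The argument
runs over n > M, in the setting of `CubeGrid`; the finitely many scales N < n ≤ M are bounded one at
a time (`exists_squareOn_finset_rpow_le`, `enorm_avgDiff_le_of_le`). The metric is unrelated to the
topology, so joint measurability of d and countability of the cubes come from countable nets, which
geometric doubling refines (`exists_cubeGrid`).

L² (`exists_squareOn_sq_le`): T_n is almost orthogonal to the martingale differences d_k = E_{k-1} f
- E_k f. If k ≤ n, then d_k has mean zero on cubes of generation k, so E_n d_k = 0 and the ball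
average sees only the cubes crossing the sphere of radius δ^n. They lie in an annulus of relative
measure O(δ^{-ε(n-k)}), and Schur's test applies (`exists_avgDiff_meanZero`). If k > n, then d_k is
constant on cubes of generation k - 1, so T_n d_k is controlled by the values of d_k near their
boundaries (`exists_avgDiff_const`), and dyadic cubes have small boundaries (`exists_boundary_le`).
Young's inequality on ℤ sums the resulting geometric decay.

Weak (1,1) (`exists_squareOn_weak`): a Calderón-Zygmund decomposition along stopping cubes. The good
part is handled by L². The bad part has mean zero on the stopping cubes, so away from an exceptional
set only annuli contribute, and the sum over n is a geometric series in L¹ (`exists_bad_part_le`).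
Marcinkiewicz interpolation gives 1 < p < 2.

For p > 2 and for BMO, let H be the square root of the maximal function of |f|². On a cube of
generation k ≥ M, the square function over scales n ≥ k oscillates by O(H)
(`exists_squareOn_le_add`), and over scales M < n ≤ k it has mean square O(H²)
(`exists_setLIntegral_squareOn_sq_le`). With H ≤ ‖f‖_∞ these two facts give the BMO bound
(`exists_oscillation_le`). For p > 2, a discrete chain rule and a summation by parts turn them into
∫ S^p ≤ C ∫ (S + BH)^{p-2} H² (`exists_squareOn_rpow_le_mixed`); S is absorbed (`exists_absorb`),
and H is bounded on L^p because the maximal function is of weak type (1,1). -/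

open Metric (closedBall mem_closedBall)

/-! ### Sequences in ℓ², Schur's test and Young's inequality -/

/-- The `ℓ²` norm of an extended nonnegative sequence. -/
noncomputable def ellTwo (a : ℤ → ℝ≥0∞) : ℝ≥0∞ := (∑' n, a n ^ 2) ^ (1 / 2 : ℝ)

lemma sqrt_sq_ennreal (a : ℝ≥0∞) : (a ^ (1 / 2 : ℝ)) ^ 2 = a := by
  rw [← ENNReal.rpow_natCast, ← ENNReal.rpow_mul]; norm_num

lemma sq_sqrt_ennreal (a : ℝ≥0∞) : (a ^ 2) ^ (1 / 2 : ℝ) = a := by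
  rw [← ENNReal.rpow_natCast, ← ENNReal.rpow_mul]; norm_num

lemma ellTwo_sq (a : ℤ → ℝ≥0∞) : ellTwo a ^ 2 = ∑' n, a n ^ 2 := sqrt_sq_ennreal _

lemma ellTwo_mono {a b : ℤ → ℝ≥0∞} (h : ∀ n, a n ≤ b n) : ellTwo a ≤ ellTwo b :=
  ENNReal.rpow_le_rpow (ENNReal.tsum_le_tsum fun n => pow_le_pow_left' (h n) 2) (by norm_num)

lemma ellTwo_add_le (a b : ℤ → ℝ≥0∞) :
    ellTwo (fun n => a n + b n) ≤ ellTwo a + ellTwo b := by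
  have := ENNReal.lintegral_Lp_add_le (μ := (Measure.count : Measure ℤ)) (p := 2)
    (f := a) (g := b) (measurable_of_countable _).aemeasurable
    (measurable_of_countable _).aemeasurable (by norm_num)
  simpa [lintegral_count, ellTwo] using this

lemma ellTwo_le_tsum (a : ℤ → ℝ≥0∞) : ellTwo a ≤ ∑' n, a n := by
  rw [ellTwo]
  calc (∑' n, a n ^ 2) ^ (1 / 2 : ℝ) ≤ ((∑' n, a n) ^ 2) ^ (1 / 2 : ℝ) := by
        refine ENNReal.rpow_le_rpow ?_ (by norm_num)
        calc ∑' n, a n ^ 2 ≤ ∑' n, a n * (∑' k, a k) := by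
              refine ENNReal.tsum_le_tsum fun n => ?_
              rw [sq]
              exact mul_le_mul_right (ENNReal.le_tsum n) _
          _ = (∑' n, a n) ^ 2 := by rw [ENNReal.tsum_mul_right, sq]
    _ = _ := sq_sqrt_ennreal _

/-- Hölder's inequality with respect to the measure with density `k`. -/
lemma lintegral_mul_rpow_le {Y : Type*} [MeasurableSpace Y] {ν : Measure Y} {k F : Y → ℝ≥0∞}
    (hk : Measurable k) (hF : Measurable F) {p : ℝ} (hp : 1 ≤ p) :
    (∫⁻ y, k y * F y ∂ν) ^ p ≤ (∫⁻ y, k y ∂ν) ^ (p - 1) * ∫⁻ y, k y * F y ^ p ∂ν := by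
  have hp0 : 0 < p := by linarith
  have hip : 1 / p ≤ 1 := by rw [div_le_one hp0]; exact hp
  have hh := ENNReal.lintegral_mul_norm_pow_le (μ := ν) (f := k)
    (g := fun y => k y * F y ^ p) hk.aemeasurable
    (hk.mul (hF.pow_const p)).aemeasurable (p := 1 - 1 / p) (q := 1 / p)
    (by linarith) (by positivity) (by ring)
  have he : ∀ y, k y ^ (1 - 1 / p) * (k y * F y ^ p) ^ (1 / p) = k y * F y := by
    intro y
    rw [ENNReal.mul_rpow_of_nonneg _ _ (by positivity), ← ENNReal.rpow_mul, ← mul_assoc,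
      ← ENNReal.rpow_add_of_nonneg _ _ (by linarith) (by positivity)]
    simp [hp0.ne']
  simp only [he] at hh
  calc (∫⁻ y, k y * F y ∂ν) ^ p
      ≤ ((∫⁻ y, k y ∂ν) ^ (1 - 1 / p) * (∫⁻ y, k y * F y ^ p ∂ν) ^ (1 / p)) ^ p :=
        ENNReal.rpow_le_rpow hh hp0.le
    _ = (∫⁻ y, k y ∂ν) ^ (p - 1) * ∫⁻ y, k y * F y ^ p ∂ν := by
        rw [ENNReal.mul_rpow_of_nonneg _ _ hp0.le, ← ENNReal.rpow_mul, ← ENNReal.rpow_mul]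
        congr 2
        · field_simp
        · rw [one_div_mul_cancel hp0.ne', ENNReal.rpow_one]

/-- **Schur's test** on `Lᵖ`, `1 ≤ p < ∞`. -/
lemma lintegral_kernel_rpow_le {X Y : Type*} [MeasurableSpace X] [MeasurableSpace Y]
    {μ : Measure X} {ν : Measure Y} [SFinite μ] [SFinite ν] {k : X → Y → ℝ≥0∞}
    (hk : Measurable (Function.uncurry k)) {p : ℝ} (hp : 1 ≤ p) {A B : ℝ≥0∞}
    (hA : ∀ x, ∫⁻ y, k x y ∂ν ≤ A) (hB : ∀ y, ∫⁻ x, k x y ∂μ ≤ B)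
    {F : Y → ℝ≥0∞} (hF : Measurable F) :
    ∫⁻ x, (∫⁻ y, k x y * F y ∂ν) ^ p ∂μ ≤ A ^ (p - 1) * B * ∫⁻ y, F y ^ p ∂ν := by
  have hp0 : 0 < p := by linarith
  have hky : ∀ y, Measurable (fun x => k x y) := fun y => hk.comp measurable_prodMk_right
  have h1 : ∀ x, (∫⁻ y, k x y * F y ∂ν) ^ p ≤ A ^ (p - 1) * ∫⁻ y, k x y * F y ^ p ∂ν :=
    fun x => (lintegral_mul_rpow_le (hk.comp measurable_prodMk_left) hF hp).trans
      (mul_le_mul' (ENNReal.rpow_le_rpow (hA x) (by linarith)) le_rfl)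
  calc ∫⁻ x, (∫⁻ y, k x y * F y ∂ν) ^ p ∂μ
      ≤ ∫⁻ x, A ^ (p - 1) * ∫⁻ y, k x y * F y ^ p ∂ν ∂μ := lintegral_mono h1
    _ = A ^ (p - 1) * ∫⁻ x, ∫⁻ y, k x y * F y ^ p ∂ν ∂μ := by
        refine lintegral_const_mul _ ?_
        exact Measurable.lintegral_prod_right' (f := fun z : X × Y => k z.1 z.2 * F z.2 ^ p)
          (hk.mul ((hF.comp measurable_snd).pow_const p))
    _ = A ^ (p - 1) * ∫⁻ y, ∫⁻ x, k x y * F y ^ p ∂μ ∂ν := by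
        congr 1
        exact lintegral_lintegral_swap
          (hk.mul ((hF.comp measurable_snd).pow_const p)).aemeasurable
    _ ≤ A ^ (p - 1) * ∫⁻ y, B * F y ^ p ∂ν := by
        gcongr with y
        rw [lintegral_mul_const _ (hky y)]
        gcongr
        exact hB y
    _ = _ := by rw [lintegral_const_mul _ (hF.pow_const p), mul_assoc]

lemma tsum_natAbs_le (α : ℕ → ℝ≥0∞) : ∑' j : ℤ, α j.natAbs ≤ 2 * ∑' j, α j := by
  have h := tsum_of_nat_of_neg_add_one (f := fun j : ℤ => α j.natAbs)
    ENNReal.summable ENNReal.summable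
  rw [h, two_mul]
  refine add_le_add (le_of_eq (by simp)) ?_
  have : ∀ n : ℕ, α (-((n : ℤ) + 1)).natAbs = α (n + 1) := fun n => by congr 1
  simp only [this]
  exact ENNReal.tsum_comp_le_tsum_of_injective (add_left_injective 1) α

lemma tsum_natAbs_sub_le (α : ℕ → ℝ≥0∞) (k : ℤ) :
    ∑' n : ℤ, α (n - k).natAbs ≤ 2 * ∑' j, α j := by
  have h := (Equiv.subRight k).tsum_eq (fun j : ℤ => α j.natAbs)
  simp only [Equiv.subRight_apply] at h
  rw [h]; exact tsum_natAbs_le α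

/-- Young's inequality `ℓ¹ * ℓ² ⊆ ℓ²` on `ℤ`. -/
lemma tsum_conv_sq_le (α : ℕ → ℝ≥0∞) (a : ℤ → ℝ≥0∞) :
    ∑' n : ℤ, (∑' k : ℤ, α (n - k).natAbs * a k) ^ 2
      ≤ (2 * ∑' j, α j) ^ 2 * ∑' k, a k ^ 2 := by
  have h1 : ∀ n : ℤ, ∑' k : ℤ, α (n - k).natAbs ≤ 2 * ∑' j, α j := fun n => by
    have h := (Equiv.subLeft n).tsum_eq (fun j : ℤ => α j.natAbs)
    simp only [Equiv.subLeft_apply] at h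
    rw [h]; exact tsum_natAbs_le α
  have h2 : ∀ k : ℤ, ∑' n : ℤ, α (n - k).natAbs ≤ 2 * ∑' j, α j := tsum_natAbs_sub_le α
  have := lintegral_kernel_rpow_le (μ := (Measure.count : Measure ℤ))
    (ν := (Measure.count : Measure ℤ)) (k := fun n k => α (n - k).natAbs)
    (measurable_of_countable _) (p := 2) (by norm_num) (by simpa [lintegral_count] using h1)
    (by simpa [lintegral_count] using h2) (F := a) (measurable_of_countable _)
  simp only [lintegral_count, ENNReal.rpow_two] at this
  refine this.trans (le_of_eq ?_)
  norm_num [sq]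

/-- No condition on `m s` is needed: if it is 0 or ∞ the Bochner average is 0 by convention. -/
lemma enorm_setAverage_le {X : Type*} [MeasurableSpace X] (m : Measure X) (s : Set X)
    (f : X → ℂ) : ‖⨍ y in s, f y ∂m‖ₑ ≤ (m s)⁻¹ * ∫⁻ y in s, ‖f y‖ₑ ∂m := by
  rw [setAverage_eq, enorm_smul]
  rcases eq_or_ne (m s) 0 with h0 | h0
  · simp [measureReal_def, h0, Measure.restrict_eq_zero.2 h0]
  rcases eq_or_ne (m s) ∞ with h1 | h1
  · simp [measureReal_def, h1]
  gcongr
  · rw [enorm_inv (by simp [measureReal_def, ENNReal.toReal_eq_zero_iff, h0, h1]),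
      Real.enorm_eq_ofReal measureReal_nonneg, ofReal_measureReal h1]
  · exact enorm_integral_le_lintegral_enorm _

/-! Layer cake formulas and Marcinkiewicz interpolation. -/

/-- For finite u this is the real layer cake formula for a constant function and a Dirac mass; for u
= ∞ the right side dominates every finite value. -/
lemma ennreal_rpow_eq_lintegral {p : ℝ} (hp : 0 < p) (u : ℝ≥0∞) :
    u ^ p = ENNReal.ofReal p * ∫⁻ t in Ioi (0 : ℝ),
      (if ENNReal.ofReal t < u then 1 else 0) * ENNReal.ofReal (t ^ (p - 1)) := by
  have key : ∀ v : ℝ≥0, (v : ℝ≥0∞) ^ p = ENNReal.ofReal p * ∫⁻ t in Ioi (0 : ℝ),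
      (if ENNReal.ofReal t < v then 1 else 0) * ENNReal.ofReal (t ^ (p - 1)) := by
    intro v
    have h := lintegral_rpow_eq_lintegral_meas_lt_mul (Measure.dirac ()) (f := fun _ => (v : ℝ))
      (Filter.Eventually.of_forall fun _ => v.coe_nonneg) aemeasurable_const hp
    simp only [lintegral_dirac] at h
    rw [← ENNReal.ofReal_coe_nnreal, ENNReal.ofReal_rpow_of_nonneg v.coe_nonneg hp.le, h]
    congr 1
    refine setLIntegral_congr_fun measurableSet_Ioi fun t (ht : 0 < t) => ?_
    have : ENNReal.ofReal t < ENNReal.ofReal (v : ℝ) ↔ t < v := by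
      rw [ENNReal.ofReal_lt_ofReal_iff_of_nonneg ht.le]
    simp only [this]
    by_cases h' : t < v <;> simp [h']
  induction u with
  | coe v => exact key v
  | top =>
    rw [ENNReal.top_rpow_of_pos hp]
    refine (eq_top_iff.2 ?_).symm
    refine ENNReal.le_of_forall_nnreal_lt fun r _ => ?_
    -- The finite height whose p-th power is `r`.
    have h := key (r ^ (1 / p))
    rw [ENNReal.coe_rpow_of_nonneg _ (by positivity), ← ENNReal.rpow_mul,
      one_div_mul_cancel hp.ne', ENNReal.rpow_one] at h
    rw [h]
    gcongr with t
    split_ifs with h1 h2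
    · exact le_rfl
    · exact absurd ENNReal.ofReal_lt_top h2
    · simp
    · exact le_rfl

lemma measurable_ite_lt {X : Type*} [MeasurableSpace X] {F : X → ℝ≥0∞} (hF : Measurable F) :
    Measurable (fun z : X × ℝ => if ENNReal.ofReal z.2 < F z.1 then (1 : ℝ≥0∞) else 0) :=
  Measurable.ite (measurableSet_lt (by fun_prop) (by fun_prop)) measurable_const measurable_const

lemma lintegral_ite_one {X : Type*} [MeasurableSpace X] {m : Measure X} {P : X → Prop}
    [DecidablePred P] (hP : MeasurableSet {x | P x}) :
    ∫⁻ x, (if P x then (1 : ℝ≥0∞) else 0) ∂m = m {x | P x} := by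
  rw [← lintegral_indicator_one hP]
  refine lintegral_congr fun x => ?_
  by_cases h : P x <;> simp [h]

/-- The layer cake formula for functions with values in `[0, ∞]`. -/
lemma lintegral_rpow_eq_layer {X : Type*} [MeasurableSpace X] {m : Measure X} [SFinite m]
    {F : X → ℝ≥0∞} (hF : Measurable F) {p : ℝ} (hp : 0 < p) :
    ∫⁻ x, F x ^ p ∂m = ENNReal.ofReal p * ∫⁻ t in Ioi (0 : ℝ),
      m {x | ENNReal.ofReal t < F x} * ENNReal.ofReal (t ^ (p - 1)) := by
  simp_rw [ennreal_rpow_eq_lintegral hp]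
  have hm : Measurable (fun z : X × ℝ => (if ENNReal.ofReal z.2 < F z.1 then (1 : ℝ≥0∞) else 0)
      * ENNReal.ofReal (z.2 ^ (p - 1))) := (measurable_ite_lt hF).mul (by fun_prop)
  rw [lintegral_const_mul _ (Measurable.lintegral_prod_right' hm),
    lintegral_lintegral_swap hm.aemeasurable]
  congr 1
  refine lintegral_congr fun t => ?_
  change ∫⁻ x, (if ENNReal.ofReal t < F x then (1 : ℝ≥0∞) else 0)
    * ENNReal.ofReal (t ^ (p - 1)) ∂m = _
  rw [lintegral_mul_const _ (Measurable.ite (measurableSet_lt measurable_const hF)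
    measurable_const measurable_const), lintegral_ite_one (measurableSet_lt measurable_const hF)]

/-- Tonelli: at a fixed x the height t runs over (0, h x), and t^{p-2} is integrable at 0 because p
> 1. -/
lemma lintegral_layer_low {X : Type*} [MeasurableSpace X] {m : Measure X} [SFinite m]
    {h : X → ℝ≥0∞} (hh : Measurable h) {p : ℝ} (hp : 1 < p) :
    ∫⁻ t in Ioi (0 : ℝ), (∫⁻ x in {x | ENNReal.ofReal t < h x}, h x ∂m)
        * ENNReal.ofReal (t ^ (p - 2))
      = (ENNReal.ofReal (p - 1))⁻¹ * ∫⁻ x, h x ^ p ∂m := by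
  have hm : Measurable (fun z : ℝ × X => (if ENNReal.ofReal z.1 < h z.2 then (1 : ℝ≥0∞) else 0)
      * ENNReal.ofReal (z.1 ^ (p - 2)) * h z.2) :=
    (((measurable_ite_lt hh).comp measurable_swap).mul (by fun_prop)).mul (by fun_prop)
  calc _ = ∫⁻ t in Ioi (0 : ℝ), ∫⁻ x, (if ENNReal.ofReal t < h x then (1 : ℝ≥0∞) else 0)
        * ENNReal.ofReal (t ^ (p - 2)) * h x ∂m := by
        refine lintegral_congr fun t => ?_
        rw [← lintegral_indicator (measurableSet_lt measurable_const hh),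
          ← lintegral_mul_const _ (hh.indicator (measurableSet_lt measurable_const hh))]
        refine lintegral_congr fun x => ?_
        by_cases h' : ENNReal.ofReal t < h x <;> simp [h', mul_comm]
    _ = ∫⁻ x, (∫⁻ t in Ioi (0 : ℝ), (if ENNReal.ofReal t < h x then (1 : ℝ≥0∞) else 0)
        * ENNReal.ofReal (t ^ (p - 2)) * h x) ∂m := lintegral_lintegral_swap hm.aemeasurable
    _ = ∫⁻ x, (ENNReal.ofReal (p - 1))⁻¹ * h x ^ p ∂m := by
        refine lintegral_congr fun x => ?_
        have hmt : Measurable (fun t : ℝ => (if ENNReal.ofReal t < h x then (1 : ℝ≥0∞) else 0)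
          * ENNReal.ofReal (t ^ (p - 2))) := (Measurable.ite (measurableSet_lt (by fun_prop)
            measurable_const) measurable_const measurable_const).mul (by fun_prop)
        rw [lintegral_mul_const _ hmt]
        have e := ennreal_rpow_eq_lintegral (p := p - 1) (by linarith) (h x)
        rw [show p - 1 - 1 = p - 2 by ring] at e
        have e2 : h x ^ p = h x ^ (p - 1) * h x := by
          conv_rhs => rw [← ENNReal.rpow_one (h x), ← ENNReal.rpow_mul, one_mul]
          rw [← ENNReal.rpow_add_of_nonneg _ _ (by linarith) (by norm_num)]
          congr 1; ring
        rw [e2, e, ← mul_assoc, ← mul_assoc, ENNReal.inv_mul_cancel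
          (by simpa using hp) ENNReal.ofReal_ne_top, one_mul]
    _ = _ := lintegral_const_mul _ (hh.pow_const p)

/-- Tonelli again: now t runs over [h x, ∞), and t^{p-3} is integrable at infinity because p < 2. -/
lemma lintegral_layer_high {X : Type*} [MeasurableSpace X] {m : Measure X} [SFinite m]
    {h : X → ℝ≥0∞} (hh : Measurable h) (hfin : ∀ x, h x ≠ ∞) {p : ℝ} (hp2 : p < 2) :
    ∫⁻ t in Ioi (0 : ℝ), (∫⁻ x in {x | h x ≤ ENNReal.ofReal t}, h x ^ 2 ∂m)
        * ENNReal.ofReal (t ^ (p - 3))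
      ≤ (ENNReal.ofReal (2 - p))⁻¹ * ∫⁻ x, h x ^ p ∂m := by
  have hmi : Measurable (fun z : ℝ × X => if h z.2 ≤ ENNReal.ofReal z.1 then (1 : ℝ≥0∞) else 0) :=
    Measurable.ite (measurableSet_le (by fun_prop) (by fun_prop)) measurable_const measurable_const
  have hm : Measurable (fun z : ℝ × X => (if h z.2 ≤ ENNReal.ofReal z.1 then (1 : ℝ≥0∞) else 0)
      * ENNReal.ofReal (z.1 ^ (p - 3)) * h z.2 ^ 2) :=
    (hmi.mul (by fun_prop)).mul (by fun_prop)
  calc _ = ∫⁻ t in Ioi (0 : ℝ), ∫⁻ x, (if h x ≤ ENNReal.ofReal t then (1 : ℝ≥0∞) else 0)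
        * ENNReal.ofReal (t ^ (p - 3)) * h x ^ 2 ∂m := by
        refine lintegral_congr fun t => ?_
        rw [← lintegral_indicator (measurableSet_le hh measurable_const),
          ← lintegral_mul_const _ ((hh.pow_const 2).indicator
            (measurableSet_le hh measurable_const))]
        refine lintegral_congr fun x => ?_
        by_cases h' : h x ≤ ENNReal.ofReal t <;> simp [h', mul_comm]
    _ = ∫⁻ x, (∫⁻ t in Ioi (0 : ℝ), (if h x ≤ ENNReal.ofReal t then (1 : ℝ≥0∞) else 0)
        * ENNReal.ofReal (t ^ (p - 3)) * h x ^ 2) ∂m := lintegral_lintegral_swap hm.aemeasurable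
    _ ≤ ∫⁻ x, (ENNReal.ofReal (2 - p))⁻¹ * h x ^ p ∂m := by
        refine lintegral_mono fun x => ?_
        have hmt : Measurable (fun t : ℝ => (if h x ≤ ENNReal.ofReal t then (1 : ℝ≥0∞) else 0)
          * ENNReal.ofReal (t ^ (p - 3))) := (Measurable.ite (measurableSet_le measurable_const
            (by fun_prop)) measurable_const measurable_const).mul (by fun_prop)
        rw [lintegral_mul_const _ hmt]
        rcases eq_or_ne (h x) 0 with h0 | h0
        · simp [h0]
        set r := (h x).toReal with hr
        have hr0 : 0 < r := ENNReal.toReal_pos h0 (hfin x)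
        have hxr : h x = ENNReal.ofReal r := (ENNReal.ofReal_toReal (hfin x)).symm
        have e1 : ∫⁻ t in Ioi (0 : ℝ), (if h x ≤ ENNReal.ofReal t then (1 : ℝ≥0∞) else 0)
            * ENNReal.ofReal (t ^ (p - 3)) ≤ ENNReal.ofReal (r ^ (p - 2) / (2 - p)) := by
          calc _ ≤ ∫⁻ t in Ici r, ENNReal.ofReal (t ^ (p - 3)) := by
                rw [← lintegral_indicator measurableSet_Ioi, ← lintegral_indicator measurableSet_Ici]
                refine lintegral_mono fun t => ?_
                by_cases ht : r ≤ t
                · rw [indicator_of_mem (show t ∈ Ici r from ht)]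
                  refine (indicator_le_self _ _ _).trans ?_
                  split_ifs <;> simp
                · refine le_of_eq_of_le (b := 0) ?_ zero_le
                  by_cases ht0 : t ∈ Ioi (0 : ℝ)
                  · have : ¬ h x ≤ ENNReal.ofReal t := by
                      rw [hxr, ENNReal.ofReal_le_ofReal_iff (le_of_lt ht0)]; exact ht
                    simp [this]
                  · simp [ht0]
            _ = ∫⁻ t in Ioi r, ENNReal.ofReal (t ^ (p - 3)) := setLIntegral_congr Ioi_ae_eq_Ici.symm
            _ = ENNReal.ofReal (∫ t in Ioi r, t ^ (p - 3)) := by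
                rw [ofReal_integral_eq_lintegral_ofReal
                  (integrableOn_Ioi_rpow_of_lt (by linarith) hr0)]
                filter_upwards [ae_restrict_mem measurableSet_Ioi] with t ht
                exact Real.rpow_nonneg (hr0.le.trans (le_of_lt ht)) _
            _ = _ := by
                rw [integral_Ioi_rpow_of_lt (by linarith) hr0]
                congr 1
                rw [show p - 3 + 1 = -(2 - p) by ring, show p - 2 = -(2 - p) by ring, neg_div_neg_eq]
        refine (mul_le_mul_left e1 _).trans (le_of_eq ?_)
        rw [hxr, ENNReal.ofReal_rpow_of_pos hr0, ← ENNReal.ofReal_pow hr0.le,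
          ← ENNReal.ofReal_inv_of_pos (by linarith), ← ENNReal.ofReal_mul (by
            have := Real.rpow_nonneg hr0.le (p - 2)
            exact div_nonneg this (by linarith)), ← ENNReal.ofReal_mul (by
              rw [inv_nonneg]; linarith)]
        congr 1
        rw [div_mul_eq_mul_div, ← Real.rpow_natCast, ← Real.rpow_add hr0]
        norm_num
        rw [div_eq_inv_mul]
    _ = _ := lintegral_const_mul _ (hh.pow_const p)

/-- The layer cake formula for F / a. The dilation by a lets a weak type bound lose a constant
factor in the height. -/
lemma lintegral_rpow_le_of_meas_le {X : Type*} [MeasurableSpace X] {m : Measure X} [SFinite m]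
    {F : X → ℝ≥0∞} (hF : Measurable F) {p : ℝ} (hp : 0 < p) {a : ℝ} (ha : 0 < a)
    {Φ : ℝ → ℝ≥0∞} (hΦ : ∀ t > 0, m {x | ENNReal.ofReal (a * t) < F x} ≤ Φ t) :
    ∫⁻ x, F x ^ p ∂m ≤ ENNReal.ofReal (p * a ^ p) *
      ∫⁻ t in Ioi (0 : ℝ), Φ t * ENNReal.ofReal (t ^ (p - 1)) := by
  have ha0 : ENNReal.ofReal a ≠ 0 := by simpa using ha
  have h1 := lintegral_rpow_eq_layer (m := m) (F := fun x => (ENNReal.ofReal a)⁻¹ * F x)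
    (hF.const_mul _) hp
  have h2 : ∫⁻ x, F x ^ p ∂m
      = ENNReal.ofReal a ^ p * ∫⁻ x, ((ENNReal.ofReal a)⁻¹ * F x) ^ p ∂m := by
    rw [← lintegral_const_mul _ ((hF.const_mul _).pow_const p)]
    refine lintegral_congr fun x => ?_
    rw [← ENNReal.mul_rpow_of_nonneg _ _ hp.le, ← mul_assoc,
      ENNReal.mul_inv_cancel ha0 ENNReal.ofReal_ne_top, one_mul]
  rw [h2, h1, ← mul_assoc]
  have h3 : ENNReal.ofReal a ^ p * ENNReal.ofReal p = ENNReal.ofReal (p * a ^ p) := by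
    rw [ENNReal.ofReal_rpow_of_pos ha, ← ENNReal.ofReal_mul (by positivity), mul_comm]
  rw [h3]
  refine mul_le_mul_right (setLIntegral_mono' measurableSet_Ioi fun t ht => ?_) _
  gcongr
  refine le_trans (measure_mono fun x
    (hx : ENNReal.ofReal t < (ENNReal.ofReal a)⁻¹ * F x) => ?_) (hΦ t ht)
  rw [mem_ofPred_eq, ENNReal.ofReal_mul ha.le]
  calc ENNReal.ofReal a * ENNReal.ofReal t
      < ENNReal.ofReal a * ((ENNReal.ofReal a)⁻¹ * F x) :=
        (ENNReal.mul_lt_mul_iff_right ha0 ENNReal.ofReal_ne_top).2 hx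
    _ = F x := by rw [← mul_assoc, ENNReal.mul_inv_cancel ha0 ENNReal.ofReal_ne_top, one_mul]

/-- Marcinkiewicz interpolation between weak `L¹` and `L^∞`, in distributional form. -/
lemma marcinkiewicz_one_top {p : ℝ} (hp : 1 < p) (a : ℝ) (ha : 0 < a) (C : ℝ≥0) :
    ∃ C' : ℝ≥0, ∀ {X : Type*} [MeasurableSpace X] {m : Measure X} [SFinite m]
      {F h : X → ℝ≥0∞}, Measurable F → Measurable h →
      (∀ t > 0, m {x | ENNReal.ofReal (a * t) < F x}
        ≤ C * (ENNReal.ofReal t)⁻¹ * ∫⁻ x in {x | ENNReal.ofReal t < h x}, h x ∂m) →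
      ∫⁻ x, F x ^ p ∂m ≤ C' * ∫⁻ x, h x ^ p ∂m := by
  refine ⟨(p * a ^ p).toNNReal * (C * (p - 1).toNNReal⁻¹), ?_⟩
  intro X _ m _ F h hF hh hw
  refine (lintegral_rpow_le_of_meas_le hF (by linarith) ha hw).trans (le_of_eq ?_)
  have hp1 : 0 < p - 1 := by linarith
  have e : ∫⁻ t in Ioi (0 : ℝ), C * (ENNReal.ofReal t)⁻¹ *
      (∫⁻ x in {x | ENNReal.ofReal t < h x}, h x ∂m) * ENNReal.ofReal (t ^ (p - 1))
      = C * ((ENNReal.ofReal (p - 1))⁻¹ * ∫⁻ x, h x ^ p ∂m) := by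
    rw [← lintegral_layer_low hh hp, ← lintegral_const_mul' _ _ ENNReal.coe_ne_top]
    refine setLIntegral_congr_fun measurableSet_Ioi fun t (ht : 0 < t) => ?_
    have : ENNReal.ofReal (t ^ (p - 1)) = ENNReal.ofReal t * ENNReal.ofReal (t ^ (p - 2)) := by
      rw [← ENNReal.ofReal_mul ht.le]
      congr 1
      rw [show p - 1 = 1 + (p - 2) by ring, Real.rpow_add ht, Real.rpow_one]
    simp only [this]
    calc _ = C * ((ENNReal.ofReal t)⁻¹ * ENNReal.ofReal t) *
          ((∫⁻ x in {x | ENNReal.ofReal t < h x}, h x ∂m) * ENNReal.ofReal (t ^ (p - 2))) := by ring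
      _ = _ := by
        rw [ENNReal.inv_mul_cancel (by simpa using ht) ENNReal.ofReal_ne_top, mul_one]
  rw [e]
  push_cast
  rw [ENNReal.coe_inv (by simpa using hp1)]
  simp only [ENNReal.ofReal, mul_assoc]

/-- Marcinkiewicz interpolation between weak `L¹` and weak `L²`, in distributional form. -/
lemma marcinkiewicz_one_two {p : ℝ} (hp : 1 < p) (hp2 : p < 2) (a : ℝ) (ha : 0 < a) (C : ℝ≥0) :
    ∃ C' : ℝ≥0, ∀ {X : Type*} [MeasurableSpace X] {m : Measure X} [SFinite m]
      {F h : X → ℝ≥0∞}, Measurable F → Measurable h → (∀ x, h x ≠ ∞) →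
      (∀ t > 0, m {x | ENNReal.ofReal (a * t) < F x}
        ≤ C * (ENNReal.ofReal t)⁻¹ * (∫⁻ x in {x | ENNReal.ofReal t < h x}, h x ∂m)
        + C * (ENNReal.ofReal t)⁻¹ ^ 2 * (∫⁻ x in {x | h x ≤ ENNReal.ofReal t}, h x ^ 2 ∂m)) →
      ∫⁻ x, F x ^ p ∂m ≤ C' * ∫⁻ x, h x ^ p ∂m := by
  -- The factor 1 / (p - 1) comes from the part of `h` above height t, and 1 / (2 - p) from the part
  -- below.
  refine ⟨(p * a ^ p).toNNReal * (C * (p - 1).toNNReal⁻¹ + C * (2 - p).toNNReal⁻¹), ?_⟩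
  intro X _ m _ F h hF hh hfin hw
  refine (lintegral_rpow_le_of_meas_le hF (by linarith) ha hw).trans ?_
  have hp1 : 0 < p - 1 := by linarith
  have hp3 : 0 < 2 - p := by linarith
  have e : ∫⁻ t in Ioi (0 : ℝ), (C * (ENNReal.ofReal t)⁻¹ *
      (∫⁻ x in {x | ENNReal.ofReal t < h x}, h x ∂m)
      + C * (ENNReal.ofReal t)⁻¹ ^ 2 * (∫⁻ x in {x | h x ≤ ENNReal.ofReal t}, h x ^ 2 ∂m))
        * ENNReal.ofReal (t ^ (p - 1))
      ≤ C * ((ENNReal.ofReal (p - 1))⁻¹ * ∫⁻ x, h x ^ p ∂m)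
        + C * ((ENNReal.ofReal (2 - p))⁻¹ * ∫⁻ x, h x ^ p ∂m) := by
    calc _ = ∫⁻ t in Ioi (0 : ℝ), (C * ((∫⁻ x in {x | ENNReal.ofReal t < h x}, h x ∂m)
            * ENNReal.ofReal (t ^ (p - 2))) +
            C * ((∫⁻ x in {x | h x ≤ ENNReal.ofReal t}, h x ^ 2 ∂m)
            * ENNReal.ofReal (t ^ (p - 3)))) := by
          refine setLIntegral_congr_fun measurableSet_Ioi fun t (ht : 0 < t) => ?_
          have h1 : ENNReal.ofReal (t ^ (p - 1))
              = ENNReal.ofReal t * ENNReal.ofReal (t ^ (p - 2)) := by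
            rw [← ENNReal.ofReal_mul ht.le]
            congr 1
            rw [show p - 1 = 1 + (p - 2) by ring, Real.rpow_add ht, Real.rpow_one]
          have h2 : ENNReal.ofReal (t ^ (p - 2))
              = ENNReal.ofReal t * ENNReal.ofReal (t ^ (p - 3)) := by
            rw [← ENNReal.ofReal_mul ht.le]
            congr 1
            rw [show p - 2 = 1 + (p - 3) by ring, Real.rpow_add ht, Real.rpow_one]
          have h3 : (ENNReal.ofReal t)⁻¹ * ENNReal.ofReal t = 1 :=
            ENNReal.inv_mul_cancel (by simpa using ht) ENNReal.ofReal_ne_top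
          rw [add_mul]
          congr 1
          · rw [h1]
            calc _ = C * ((ENNReal.ofReal t)⁻¹ * ENNReal.ofReal t) *
                  ((∫⁻ x in {x | ENNReal.ofReal t < h x}, h x ∂m)
                    * ENNReal.ofReal (t ^ (p - 2))) := by ring
              _ = _ := by rw [h3, mul_one]
          · rw [h1, h2]
            calc _ = C * ((ENNReal.ofReal t)⁻¹ * ENNReal.ofReal t) ^ 2 *
                  ((∫⁻ x in {x | h x ≤ ENNReal.ofReal t}, h x ^ 2 ∂m)
                    * ENNReal.ofReal (t ^ (p - 3))) := by ring
              _ = _ := by rw [h3, one_pow, mul_one]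
      _ ≤ _ := by
          have hmeas : Measurable (fun t : ℝ =>
              ∫⁻ x in {x | ENNReal.ofReal t < h x}, h x ∂m) := by
            have : Measurable (fun z : ℝ × X =>
                {z : ℝ × X | ENNReal.ofReal z.1 < h z.2}.indicator (fun z => h z.2) z) :=
              (hh.comp measurable_snd).indicator (measurableSet_lt (by fun_prop) (by fun_prop))
            convert Measurable.lintegral_prod_right' (ν := m) this using 2 with t
            rw [← lintegral_indicator (measurableSet_lt measurable_const hh)]
            rfl
          have hmeas' : Measurable (fun t : ℝ => (C : ℝ≥0∞) *
              ((∫⁻ x in {x | ENNReal.ofReal t < h x}, h x ∂m) * ENNReal.ofReal (t ^ (p - 2)))) :=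
            (hmeas.mul (by fun_prop)).const_mul _
          rw [lintegral_add_left hmeas',
            lintegral_const_mul' _ _ ENNReal.coe_ne_top,
            lintegral_const_mul' _ _ ENNReal.coe_ne_top, lintegral_layer_low hh hp]
          gcongr
          exact lintegral_layer_high hh hfin hp2
  refine (mul_le_mul_right e _).trans (le_of_eq ?_)
  push_cast
  rw [ENNReal.coe_inv (by simpa using hp1), ENNReal.coe_inv (by simpa using hp3)]
  simp only [ENNReal.ofReal, mul_assoc, add_mul]

/-! Averaging over the cells of a countable measurable partition, given as the fibres of a map. -/

/-- The average of `f` over the fibre of `c` through `x`. -/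
noncomputable def cellAvg {X ι : Type*} [MeasurableSpace X] (m : Measure X) (c : X → ι)
    (f : X → ℂ) (x : X) : ℂ := ⨍ y in c ⁻¹' {c x}, f y ∂m

/-- The average of `h` over the fibre of `c` through `x`, for `h` with values in `[0, ∞]`. -/
noncomputable def cellLAvg {X ι : Type*} [MeasurableSpace X] (m : Measure X) (c : X → ι)
    (h : X → ℝ≥0∞) (x : X) : ℝ≥0∞ := (m (c ⁻¹' {c x}))⁻¹ * ∫⁻ y in c ⁻¹' {c x}, h y ∂m

section Cells

variable {X ι : Type*} [MeasurableSpace X] {m : Measure X} {c : X → ι}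

lemma enorm_cellAvg_le (f : X → ℂ) (x : X) :
    ‖cellAvg m c f x‖ₑ ≤ cellLAvg m c (fun y => ‖f y‖ₑ) x := enorm_setAverage_le _ _ _

omit [MeasurableSpace X] in
lemma iUnion_fibres (s : Set ι) : c ⁻¹' s = ⋃ i : s, c ⁻¹' {(i : ι)} := by
  ext x; simp

omit [MeasurableSpace X] in
lemma pairwise_disjoint_fibres (s : Set ι) :
    Pairwise (Function.onFun Disjoint fun i : s => c ⁻¹' {(i : ι)}) := by
  intro i j hij
  refine Disjoint.preimage _ ?_
  simpa [Subtype.ext_iff] using hij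

lemma cellLAvg_of_mem (h : X → ℝ≥0∞) {i : ι} {x : X} (hx : x ∈ c ⁻¹' {i}) :
    cellLAvg m c h x = (m (c ⁻¹' {i}))⁻¹ * ∫⁻ y in c ⁻¹' {i}, h y ∂m := by
  rw [cellLAvg, show c x = i from hx]

lemma cellAvg_of_mem (f : X → ℂ) {i : ι} {x : X} (hx : x ∈ c ⁻¹' {i}) :
    cellAvg m c f x = ⨍ y in c ⁻¹' {i}, f y ∂m := by
  rw [cellAvg, show c x = i from hx]

variable [Countable ι]

lemma measurableSet_saturated (hc : ∀ i, MeasurableSet (c ⁻¹' {i})) (s : Set ι) :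
    MeasurableSet (c ⁻¹' s) := by
  rw [← biUnion_preimage_singleton]
  exact MeasurableSet.biUnion (to_countable s) fun i _ => hc i

lemma measurable_comp_cells {β : Type*} [MeasurableSpace β]
    (hc : ∀ i, MeasurableSet (c ⁻¹' {i})) (φ : ι → β) : Measurable (fun x => φ (c x)) :=
  fun t _ => measurableSet_saturated hc (φ ⁻¹' t)

lemma measurable_cellAvg (hc : ∀ i, MeasurableSet (c ⁻¹' {i})) (f : X → ℂ) :
    Measurable (cellAvg m c f) :=
  measurable_comp_cells hc fun i => ⨍ y in c ⁻¹' {i}, f y ∂m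

lemma measurable_cellLAvg (hc : ∀ i, MeasurableSet (c ⁻¹' {i})) (h : X → ℝ≥0∞) :
    Measurable (cellLAvg m c h) :=
  measurable_comp_cells hc fun i => (m (c ⁻¹' {i}))⁻¹ * ∫⁻ y in c ⁻¹' {i}, h y ∂m

lemma lintegral_saturated (hc : ∀ i, MeasurableSet (c ⁻¹' {i})) (s : Set ι) (h : X → ℝ≥0∞) :
    ∫⁻ x in c ⁻¹' s, h x ∂m = ∑' i : s, ∫⁻ x in c ⁻¹' {(i : ι)}, h x ∂m := by
  rw [iUnion_fibres s, lintegral_iUnion (s := fun i : s => c ⁻¹' {(i : ι)}) (fun i => hc i) (pairwise_disjoint_fibres s)]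

lemma lintegral_eq_tsum_fibres (hc : ∀ i, MeasurableSet (c ⁻¹' {i})) (h : X → ℝ≥0∞) :
    ∫⁻ x, h x ∂m = ∑' i, ∫⁻ x in c ⁻¹' {i}, h x ∂m := by
  have hu : ⋃ i, c ⁻¹' {i} = univ := by ext; simp
  rw [← lintegral_iUnion hc fun i j hij => Disjoint.preimage _ (by simpa using hij), hu,
    setLIntegral_univ]

/-- Jensen's inequality for averages over the cells of a partition. -/
lemma lintegral_cellLAvg_rpow_le (hc : ∀ i, MeasurableSet (c ⁻¹' {i})) (s : Set ι)
    {h : X → ℝ≥0∞} (hh : Measurable h) {p : ℝ} (hp : 1 ≤ p) :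
    ∫⁻ x in c ⁻¹' s, cellLAvg m c h x ^ p ∂m ≤ ∫⁻ x in c ⁻¹' s, h x ^ p ∂m := by
  have hp0 : 0 < p := by linarith
  rw [lintegral_saturated hc, lintegral_saturated hc]
  refine ENNReal.tsum_le_tsum fun i => ?_
  set A := c ⁻¹' {(i : ι)} with hA
  rw [setLIntegral_congr_fun (hc i) (g := fun _ => ((m A)⁻¹ * ∫⁻ y in A, h y ∂m) ^ p)
    (fun x hx => by rw [cellLAvg_of_mem h hx]), setLIntegral_const]
  -- A null cell contributes nothing, and on a cell of infinite measure the average is 0 because `(m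
  -- A)⁻¹ = 0`.
  rcases eq_or_ne (m A) 0 with h0 | h0
  · simp [← hA, h0]
  rcases eq_or_ne (m A) ∞ with h1 | h1
  · simp [h1, hp0]
  have hip : 1 / p ≤ 1 := by rw [div_le_one hp0]; exact hp
  have hJ : ∫⁻ y in A, h y ∂m ≤ m A ^ (1 - 1 / p) * (∫⁻ y in A, h y ^ p ∂m) ^ (1 / p) := by
    have hh' := ENNReal.lintegral_mul_norm_pow_le (μ := m.restrict A) (f := fun _ => 1)
      (g := fun y => h y ^ p) aemeasurable_const
      (hh.pow_const p).aemeasurable (p := 1 - 1 / p) (q := 1 / p)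
      (by linarith) (by positivity) (by ring)
    simpa [← ENNReal.rpow_mul, hp0.ne'] using hh'
  calc ((m A)⁻¹ * ∫⁻ y in A, h y ∂m) ^ p * m A
      ≤ ((m A)⁻¹ * (m A ^ (1 - 1 / p) * (∫⁻ y in A, h y ^ p ∂m) ^ (1 / p))) ^ p * m A := by
        gcongr
    _ = ((m A) ^ (-1 : ℝ) * m A ^ (1 - 1 / p)) ^ p * m A * ∫⁻ y in A, h y ^ p ∂m := by
        rw [← mul_assoc, ENNReal.mul_rpow_of_nonneg _ _ hp0.le, ← ENNReal.rpow_mul _ (1 / p),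
          one_div_mul_cancel hp0.ne', ENNReal.rpow_one, ENNReal.rpow_neg_one]
        ring
    _ = ∫⁻ y in A, h y ^ p ∂m := by
        rw [← ENNReal.rpow_add _ _ h0 h1, ← ENNReal.rpow_mul]
        have : (-1 + (1 - 1 / p)) * p = -1 := by field_simp; ring
        rw [this, ENNReal.rpow_neg_one, ENNReal.inv_mul_cancel h0 h1, one_mul]

lemma lintegral_cellLAvg (hc : ∀ i, MeasurableSet (c ⁻¹' {i}))
    (hfin : ∀ i, m (c ⁻¹' {i}) ≠ ∞) (s : Set ι) (h : X → ℝ≥0∞) :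
    ∫⁻ x in c ⁻¹' s, cellLAvg m c h x ∂m = ∫⁻ x in c ⁻¹' s, h x ∂m := by
  rw [lintegral_saturated hc, lintegral_saturated hc]
  congr 1
  funext i
  rw [setLIntegral_congr_fun (hc i) (fun x hx => cellLAvg_of_mem h hx), setLIntegral_const]
  rcases eq_or_ne (m (c ⁻¹' {(i : ι)})) 0 with h0 | h0
  · simp [h0, Measure.restrict_eq_zero.2 h0]
  · rw [mul_comm, ← mul_assoc, ENNReal.mul_inv_cancel h0 (hfin i), one_mul]

omit [Countable ι] in
lemma setIntegral_cellAvg_fibre (hc : ∀ i, MeasurableSet (c ⁻¹' {i}))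
    (hfin : ∀ i, m (c ⁻¹' {i}) ≠ ∞) (f : X → ℂ) (i : ι) :
    ∫ x in c ⁻¹' {i}, cellAvg m c f x ∂m = ∫ x in c ⁻¹' {i}, f x ∂m := by
  rw [setIntegral_congr_fun (hc i) (fun x hx => cellAvg_of_mem f hx), setIntegral_const,
    measure_smul_setAverage _ (hfin i)]

lemma integrableOn_cellAvg (hc : ∀ i, MeasurableSet (c ⁻¹' {i}))
    (hfin : ∀ i, m (c ⁻¹' {i}) ≠ ∞) {s : Set ι} {f : X → ℂ} (hf : IntegrableOn f (c ⁻¹' s) m) :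
    IntegrableOn (cellAvg m c f) (c ⁻¹' s) m := by
  refine ⟨(measurable_cellAvg hc f).aestronglyMeasurable, ?_⟩
  refine lt_of_le_of_lt ?_ hf.2
  rw [← lintegral_cellLAvg hc hfin s (fun x => ‖f x‖ₑ)]
  exact lintegral_mono fun x => enorm_cellAvg_le f x

lemma setIntegral_cellAvg (hc : ∀ i, MeasurableSet (c ⁻¹' {i}))
    (hfin : ∀ i, m (c ⁻¹' {i}) ≠ ∞) {s : Set ι} {f : X → ℂ} (hf : IntegrableOn f (c ⁻¹' s) m) :
    ∫ x in c ⁻¹' s, cellAvg m c f x ∂m = ∫ x in c ⁻¹' s, f x ∂m := by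
  have hg := integrableOn_cellAvg hc hfin hf
  rw [iUnion_fibres s] at hf hg ⊢
  rw [integral_iUnion (s := fun i : s => c ⁻¹' {(i : ι)}) (fun i => hc i) (pairwise_disjoint_fibres s) hf,
    integral_iUnion (s := fun i : s => c ⁻¹' {(i : ι)}) (fun i => hc i) (pairwise_disjoint_fibres s) hg]
  exact tsum_congr fun i => setIntegral_cellAvg_fibre hc hfin f i

/-- The cancellation behind every estimate for mean-zero functions: it holds on any union of cells
on which f is integrable, so whole cells inside a ball drop out of the ball average. -/
lemma setIntegral_sub_cellAvg (hc : ∀ i, MeasurableSet (c ⁻¹' {i}))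
    (hfin : ∀ i, m (c ⁻¹' {i}) ≠ ∞) {s : Set ι} {f : X → ℂ} (hf : IntegrableOn f (c ⁻¹' s) m) :
    ∫ x in c ⁻¹' s, (f x - cellAvg m c f x) ∂m = 0 := by
  rw [integral_sub hf (integrableOn_cellAvg hc hfin hf), setIntegral_cellAvg hc hfin hf, sub_self]

/-- Pythagoras: on s, the difference between f and its mean is orthogonal to constants. Equality
holds, but only this direction is needed. -/
lemma lintegral_sub_average_sq_add_le {s : Set X} (hs : m s ≠ ∞) {f : X → ℂ}
    (hf : MemLp f 2 (m.restrict s)) :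
    ∫⁻ x in s, ‖f x - ⨍ y in s, f y ∂m‖ₑ ^ 2 ∂m + ∫⁻ _ in s, ‖⨍ y in s, f y ∂m‖ₑ ^ 2 ∂m
      ≤ ∫⁻ x in s, ‖f x‖ₑ ^ 2 ∂m := by
  set a := ⨍ y in s, f y ∂m with ha
  have : IsFiniteMeasure (m.restrict s) := ⟨by simpa using hs.lt_top⟩
  have hfa : MemLp (fun x => f x - a) 2 (m.restrict s) := hf.sub (memLp_const a)
  have hi : Integrable f (m.restrict s) := hf.integrable (by norm_num)
  have hsq : ∀ {g : X → ℂ}, MemLp g 2 (m.restrict s) →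
      Integrable (fun x => ‖g x‖ ^ 2) (m.restrict s) :=
    fun hg => (memLp_two_iff_integrable_sq_norm hg.1).1 hg
  have conv : ∀ {g : X → ℂ}, MemLp g 2 (m.restrict s) →
      ∫⁻ x in s, ‖g x‖ₑ ^ 2 ∂m = ENNReal.ofReal (∫ x in s, ‖g x‖ ^ 2 ∂m) := by
    intro g hg
    rw [ofReal_integral_eq_lintegral_ofReal (hsq hg)
      (Filter.Eventually.of_forall fun _ => by positivity)]
    refine lintegral_congr fun x => ?_
    rw [ENNReal.ofReal_pow (norm_nonneg _), ofReal_norm]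
  rw [conv hfa, conv (memLp_const a), conv hf, ← ENNReal.ofReal_add
    (integral_nonneg fun _ => by positivity) (integral_nonneg fun _ => by positivity)]
  refine ENNReal.ofReal_le_ofReal (le_of_eq ?_)
  have h1 : ∀ x, ‖f x - a‖ ^ 2 = ‖f x‖ ^ 2 - 2 * (f x * (starRingEnd ℂ) a).re + ‖a‖ ^ 2 := by
    intro x
    rw [← Complex.normSq_eq_norm_sq, ← Complex.normSq_eq_norm_sq, ← Complex.normSq_eq_norm_sq,
      Complex.normSq_sub]
    ring
  have hfc : Integrable (fun x => f x * (starRingEnd ℂ) a) (m.restrict s) := hi.mul_const _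
  have h2 : ∫ x in s, (f x * (starRingEnd ℂ) a).re ∂m = m.real s * ‖a‖ ^ 2 := by
    have e1 : ∫ x in s, (f x * (starRingEnd ℂ) a).re ∂m
        = (∫ x in s, f x * (starRingEnd ℂ) a ∂m).re := integral_re hfc
    rw [e1, integral_mul_const, ← measure_smul_setAverage f hs, ← ha, smul_mul_assoc,
      Complex.mul_conj, Complex.normSq_eq_norm_sq, Complex.smul_re, Complex.ofReal_re, smul_eq_mul]
  have hre : Integrable (fun x => 2 * (f x * (starRingEnd ℂ) a).re) (m.restrict s) :=
    hfc.re.const_mul 2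
  have hre' : Integrable (fun x => ‖f x‖ ^ 2 - 2 * (f x * (starRingEnd ℂ) a).re)
      (m.restrict s) := (hsq hf).sub hre
  have h3 : ∫ x in s, ‖f x - a‖ ^ 2 ∂m
      = ∫ x in s, ‖f x‖ ^ 2 ∂m - 2 * (m.real s * ‖a‖ ^ 2) + m.real s * ‖a‖ ^ 2 := by
    rw [integral_congr_ae (Filter.Eventually.of_forall h1),
      integral_add hre' (integrable_const _), integral_sub (hsq hf) hre,
      integral_const_mul, h2]
    simp
  rw [h3]
  simp
  ring

/-- Orthogonality of `f - E f` and `E f` in `L²`, for `E` the averaging over cells. -/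
lemma lintegral_sub_cellAvg_sq_add_le (hc : ∀ i, MeasurableSet (c ⁻¹' {i}))
    (hfin : ∀ i, m (c ⁻¹' {i}) ≠ ∞) {f : X → ℂ} (hf : MemLp f 2 m) :
    ∫⁻ x, ‖f x - cellAvg m c f x‖ₑ ^ 2 ∂m + ∫⁻ x, ‖cellAvg m c f x‖ₑ ^ 2 ∂m
      ≤ ∫⁻ x, ‖f x‖ₑ ^ 2 ∂m := by
  rw [lintegral_eq_tsum_fibres hc, lintegral_eq_tsum_fibres hc,
    lintegral_eq_tsum_fibres hc (fun x => ‖f x‖ₑ ^ 2), ← ENNReal.tsum_add]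
  refine ENNReal.tsum_le_tsum fun i => ?_
  refine le_trans (le_of_eq ?_) (lintegral_sub_average_sq_add_le (hfin i) (hf.restrict _))
  congr 1
  · exact setLIntegral_congr_fun (hc i) fun x hx => by rw [cellAvg_of_mem f hx]
  · exact setLIntegral_congr_fun (hc i) fun x hx => by rw [cellAvg_of_mem f hx]

end Cells

/-! ### Cube grids: doubling, annuli and the kernels of ball averages -/

/-- Dyadic cubes, given as the fibres of maps `c k : X → I k`, in a space whose balls of radius
at least `ρ` satisfy annular decay. The scale `δ ^ M` is large compared with `ρ`. -/
structure CubeGrid {X : Type*} [PseudoMetricSpace X] [MeasurableSpace X] (m : Measure X)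
    {I : ℤ → Type*} (c : ∀ k, X → I k) (z : ∀ k, I k → X) (δ c₀ C₀ ε K ρ : ℝ) (M : ℤ) : Prop where
  one_lt : 1 < δ
  c₀_pos : 0 < c₀
  C₀_pos : 0 < C₀
  small : 18 * C₀ ≤ c₀ * δ
  ε_pos : 0 < ε
  K_pos : 0 < K
  ρ_pos : 0 < ρ
  measurable_dist : Measurable fun p : X × X => dist p.1 p.2
  countable : ∀ k, Countable (I k)
  measurableSet_fibre : ∀ k α, MeasurableSet (c k ⁻¹' {α})
  nested : ∀ k l, k ≤ l → ∀ x y, c k x = c k y → c l x = c l y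
  ball_subset : ∀ k α y, dist y (z k α) ≤ c₀ / 3 * δ ^ k → c k y = α
  dist_centre : ∀ k x, dist x (z k (c k x)) ≤ 2 * C₀ * δ ^ k
  finite_ball : ∀ x r, m (closedBall x r) ≠ ∞
  pos_ball : ∀ x r, ρ ≤ r → m (closedBall x r) ≠ 0
  decay : ∀ x r, ρ ≤ r → ∀ s, 0 < s → s ≤ r →
    m (closedBall x (r + s)) ≤ ENNReal.ofReal (1 + K * (s / r) ^ ε) * m (closedBall x r)
  scale_le : ρ ≤ c₀ / 18 * δ ^ M
  scale_le' : ρ ≤ δ ^ M / 2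

/-- The rate `δ ^ (-ε)` of annular decay. -/
noncomputable def decayRate (δ ε : ℝ) : ℝ≥0 := (δ ^ (-ε)).toNNReal

/-- The kernel of the average over the part of the ball of radius `δ ^ n` near its boundary. -/
noncomputable def annulusKernel {X : Type*} [PseudoMetricSpace X] [MeasurableSpace X]
    (m : Measure X) (δ C₀ : ℝ) (n k : ℤ) (x y : X) : ℝ≥0∞ :=
  {p : X × X | δ ^ n - 4 * C₀ * δ ^ k < dist p.1 p.2 ∧
    dist p.1 p.2 ≤ δ ^ n + 4 * C₀ * δ ^ k}.indicator
    (fun p => (m (closedBall p.1 (δ ^ n)))⁻¹) (x, y)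

/-- The kernel of the ball average. -/
noncomputable def ballKernel {X : Type*} [PseudoMetricSpace X] [MeasurableSpace X]
    (m : Measure X) (r : ℝ) (x y : X) : ℝ≥0∞ :=
  {p : X × X | dist p.2 p.1 ≤ r}.indicator (fun p => (m (closedBall p.1 r))⁻¹) (x, y)

namespace CubeGrid

variable {X : Type*} [PseudoMetricSpace X] [MeasurableSpace X] {m : Measure X}
  {I : ℤ → Type*} {c : ∀ k, X → I k} {z : ∀ k, I k → X} {δ c₀ C₀ ε K ρ : ℝ} {M : ℤ}
  (G : CubeGrid m c z δ c₀ C₀ ε K ρ M)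

include G

lemma δ_pos : 0 < δ := by linarith [G.one_lt]

lemma zpow_pos (k : ℤ) : 0 < δ ^ k := _root_.zpow_pos G.δ_pos k

lemma zpow_mono {k l : ℤ} (h : k ≤ l) : δ ^ k ≤ δ ^ l := zpow_le_zpow_right₀ G.one_lt.le h

lemma ρ_le {n : ℤ} (hn : M ≤ n) : ρ ≤ δ ^ n := by
  have := G.zpow_mono hn
  have := G.scale_le'
  have := G.zpow_pos M
  linarith

lemma ρ_le_half {n : ℤ} (hn : M ≤ n) : ρ ≤ δ ^ n / 2 := by
  have := G.zpow_mono hn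
  have := G.scale_le'
  linarith

lemma ρ_le_c₀ {n : ℤ} (hn : M ≤ n) : ρ ≤ c₀ / 18 * δ ^ n := by
  have h1 := G.zpow_mono hn
  have := G.scale_le
  have := G.c₀_pos
  have : c₀ / 18 * δ ^ M ≤ c₀ / 18 * δ ^ n := by gcongr
  linarith

lemma measurableSet_closedBall (x : X) (r : ℝ) : MeasurableSet (closedBall x r) :=
  measurableSet_le (G.measurable_dist.comp (measurable_id.prodMk measurable_const))
    measurable_const

lemma sigmaFinite : SigmaFinite m := by
  rcases isEmpty_or_nonempty X with h | ⟨⟨x⟩⟩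
  · exact ⟨⟨⟨fun _ => ∅, fun _ => trivial, fun _ => by simp, by ext y; exact h.elim y⟩⟩⟩
  · exact ⟨⟨⟨fun n => closedBall x n, fun _ => trivial, fun n => (G.finite_ball x n).lt_top,
      Metric.iUnion_closedBall_nat x⟩⟩⟩

lemma measurable_measure_ball (r : ℝ) : Measurable fun x => m (closedBall x r) := by
  have := G.sigmaFinite
  exact measurable_measure_prodMk_left (ν := m) (s := {p : X × X | dist p.2 p.1 ≤ r})
    (measurableSet_le (G.measurable_dist.comp measurable_swap) measurable_const)

/-- Doubling, for balls of radius at least `ρ`. -/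
lemma exists_ball_comparison (Λ : ℝ) : ∃ C : ℝ≥0, ∀ x y : X, ∀ r r' : ℝ, ρ ≤ r →
    dist x y ≤ Λ * r → r' ≤ Λ * r → m (closedBall y r') ≤ C * m (closedBall x r) := by
  have h2 : ∀ j : ℕ, ∀ x : X, ∀ r : ℝ, ρ ≤ r →
      m (closedBall x (2 ^ j * r)) ≤ (1 + K).toNNReal ^ j * m (closedBall x r) := by
    intro j x r hr
    have hr0 : 0 < r := G.ρ_pos.trans_le hr
    induction j with
    | zero => simp
    | succ j ih =>
      have h1 : r ≤ 2 ^ j * r := le_mul_of_one_le_left hr0.le (one_le_pow₀ (by norm_num))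
      -- Annular decay with s equal to the radius is doubling with constant 1 + K.
      have := G.decay x (2 ^ j * r) (hr.trans h1) (2 ^ j * r) (by positivity) le_rfl
      rw [div_self (by positivity), Real.one_rpow, mul_one, ← two_mul, ← mul_assoc, ← pow_succ']
        at this
      refine this.trans ?_
      rw [pow_succ' ((1 + K).toNNReal : ℝ≥0∞), mul_assoc]
      exact mul_le_mul_right ih _
  -- The ball around y of radius at most Λr lies in the ball around x of radius 2Λr.
  obtain ⟨j, hj⟩ := pow_unbounded_of_one_lt (2 * Λ) (one_lt_two (α := ℝ))
  refine ⟨(1 + K).toNNReal ^ j, fun x y r r' hr hxy hr' => ?_⟩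
  have hr0 : 0 < r := G.ρ_pos.trans_le hr
  refine (measure_mono fun w hw => ?_).trans (h2 j x r hr) |>.trans (by push_cast; rfl)
  rw [mem_closedBall] at hw ⊢
  have : dist w x ≤ dist w y + dist x y := dist_triangle_right _ _ _
  nlinarith

lemma c_centre (k : ℤ) (α : I k) : c k (z k α) = α := by
  refine G.ball_subset k α _ ?_
  rw [dist_self]
  have := G.zpow_pos k
  have := G.c₀_pos
  positivity

lemma dist_le_of_eq {k : ℤ} {x y : X} (h : c k x = c k y) : dist x y ≤ 4 * C₀ * δ ^ k := by
  have h1 := G.dist_centre k x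
  have h2 := G.dist_centre k y
  rw [← h] at h2
  have := dist_triangle_right x y (z k (c k x))
  linarith

lemma cell_subset_ball (k : ℤ) (x : X) : c k ⁻¹' {c k x} ⊆ closedBall x (4 * C₀ * δ ^ k) :=
  fun y (hy : c k y = c k x) => by simpa [mem_closedBall] using G.dist_le_of_eq hy

lemma finite_cell (k : ℤ) (α : I k) : m (c k ⁻¹' {α}) ≠ ∞ := by
  rw [← G.c_centre k α]
  exact measure_ne_top_of_subset (G.cell_subset_ball k _) (G.finite_ball _ _)

lemma centre_ball_subset_cell {k : ℤ} (x : X) {b : ℝ} (hb : b ≤ c₀ / 3) :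
    closedBall (z k (c k x)) (b * δ ^ k) ⊆ c k ⁻¹' {c k x} := fun _ hy =>
  G.ball_subset k _ _ ((mem_closedBall.1 hy).trans
    (mul_le_mul_of_nonneg_right hb (G.zpow_pos k).le))

/-- Balls of radius comparable to the size of a nearby cube have measure at most comparable to
that of the smaller concentric part of the cube. -/
lemma exists_centre_comparison (Λ : ℝ) : ∃ C : ℝ≥0, ∀ k, M ≤ k → ∀ x y : X,
    dist x y ≤ Λ * δ ^ k → ∀ r ≤ Λ * δ ^ k,
      m (closedBall y r) ≤ C * m (closedBall (z k (c k x)) (c₀ / 18 * δ ^ k)) := by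
  have hc := G.c₀_pos
  have hC := G.C₀_pos
  -- Multiplied by the radius c₀δ^k/18 of the core this is (|Λ| + 2C₀)δ^k, which bounds the distance
  -- from y to the centre of the cube of x.
  obtain ⟨C, h⟩ := G.exists_ball_comparison (18 / c₀ * (|Λ| + 2 * C₀))
  refine ⟨C, fun k hk x y hxy r hr => h _ _ _ _ (G.ρ_le_c₀ hk) ?_ ?_⟩
  all_goals
    have hk := G.zpow_pos k
    have hd := G.dist_centre k x
    have hΛ : Λ * δ ^ k ≤ |Λ| * δ ^ k := mul_le_mul_of_nonneg_right (le_abs_self Λ) hk.le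
    have e : 18 / c₀ * (|Λ| + 2 * C₀) * (c₀ / 18 * δ ^ k) = |Λ| * δ ^ k + 2 * C₀ * δ ^ k := by
      field_simp
    rw [e]
  · have := dist_triangle_left (z k (c k x)) y x
    linarith
  · have : 0 ≤ 2 * C₀ * δ ^ k := by positivity
    linarith

lemma exists_cell_comparison (Λ : ℝ) : ∃ C : ℝ≥0, ∀ k, M ≤ k → ∀ x y : X,
    dist x y ≤ Λ * δ ^ k → ∀ r ≤ Λ * δ ^ k,
      m (closedBall y r) ≤ C * m (c k ⁻¹' {c k x}) := by
  obtain ⟨C, h⟩ := G.exists_centre_comparison Λ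
  refine ⟨C, fun k hk x y hxy r hr => (h k hk x y hxy r hr).trans ?_⟩
  gcongr
  exact G.centre_ball_subset_cell x (by linarith [G.c₀_pos])

lemma pos_cell {k : ℤ} (hk : M ≤ k) (x : X) : m (c k ⁻¹' {c k x}) ≠ 0 := fun h =>
  G.pos_ball (z k (c k x)) (c₀ / 18 * δ ^ k) (G.ρ_le_c₀ hk)
    (measure_mono_null (G.centre_ball_subset_cell x (by linarith [G.c₀_pos])) h)

lemma decayRate_lt_one : decayRate δ ε < 1 := by
  rw [decayRate, Real.toNNReal_lt_one]
  exact Real.rpow_lt_one_of_one_lt_of_neg G.one_lt (by linarith [G.ε_pos])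

lemma decayRate_pow {n k : ℤ} (hk : k ≤ n) :
    (decayRate δ ε : ℝ) ^ (n - k).natAbs = (δ ^ k / δ ^ n) ^ ε := by
  rw [decayRate, Real.coe_toNNReal _ (Real.rpow_nonneg G.δ_pos.le _), ← Real.rpow_natCast,
    ← Real.rpow_mul G.δ_pos.le, ← zpow_sub₀ G.δ_pos.ne', ← Real.rpow_intCast,
    ← Real.rpow_mul G.δ_pos.le]
  congr 1
  have : ((n - k).natAbs : ℝ) = ((n - k : ℤ) : ℝ) := by
    rw [← Int.cast_natCast, Int.natAbs_of_nonneg (by lia)]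
  rw [this]
  push_cast
  ring

/-- Annular decay around spheres of radius `δ ^ n`. -/
lemma exists_annulus_le : ∃ C : ℝ≥0, ∀ n k, M ≤ n → k ≤ n → ∀ x : X,
    m {y | δ ^ n - 4 * C₀ * δ ^ k < dist x y ∧ dist x y ≤ δ ^ n + 4 * C₀ * δ ^ k}
      ≤ C * decayRate δ ε ^ (n - k).natAbs * m (closedBall x (δ ^ n)) := by
  have hC := G.C₀_pos
  have hε := G.ε_pos
  have hK := G.K_pos
  obtain ⟨C, h⟩ := G.exists_ball_comparison (1 + 4 * C₀)
  set P : ℝ := (12 * C₀) ^ ε with hP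
  have hP0 : 0 < P := by positivity
  refine ⟨max (K * P).toNNReal (C * P.toNNReal), fun n k hn hk x => ?_⟩
  have hnp := G.zpow_pos n
  have hkp := G.zpow_pos k
  have hkn := G.zpow_mono hk
  have hPr : (12 * C₀ * (δ ^ k / δ ^ n)) ^ ε
      = P * (decayRate δ ε : ℝ) ^ (n - k).natAbs := by
    rw [Real.mul_rpow (by positivity) (by positivity), G.decayRate_pow hk]
  -- For a thin annulus the inner radius is at least 2δ^n/3, hence at least ρ and at least the width
  -- 8C₀δ^k. The ratio of width to inner radius is then at most 12C₀δ^{k-n}, whence the constant P.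
  by_cases hs : 12 * C₀ * δ ^ k ≤ δ ^ n
  · have hr : ρ ≤ δ ^ n - 4 * C₀ * δ ^ k := by
      have := G.ρ_le_half hn
      linarith
    have hd := G.decay x _ hr (8 * C₀ * δ ^ k) (by positivity) (by linarith)
    have hr0 : 0 < δ ^ n - 4 * C₀ * δ ^ k := G.ρ_pos.trans_le hr
    have hsub : {y | δ ^ n - 4 * C₀ * δ ^ k < dist x y ∧ dist x y ≤ δ ^ n + 4 * C₀ * δ ^ k}
        ⊆ closedBall x (δ ^ n - 4 * C₀ * δ ^ k + 8 * C₀ * δ ^ k)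
          \ closedBall x (δ ^ n - 4 * C₀ * δ ^ k) := by
      rintro y ⟨h1, h2⟩
      simp only [mem_sdiff, mem_closedBall, dist_comm y x, not_le]
      exact ⟨by linarith, h1⟩
    have hle : (8 * C₀ * δ ^ k / (δ ^ n - 4 * C₀ * δ ^ k)) ^ ε
        ≤ P * (decayRate δ ε : ℝ) ^ (n - k).natAbs := by
      rw [← hPr]
      refine Real.rpow_le_rpow (by positivity) ?_ hε.le
      rw [← mul_div_assoc, div_le_div_iff₀ hr0 hnp]
      nlinarith [mul_pos hC hkp]
    calc _ ≤ m (closedBall x (δ ^ n - 4 * C₀ * δ ^ k + 8 * C₀ * δ ^ k)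
          \ closedBall x (δ ^ n - 4 * C₀ * δ ^ k)) := measure_mono hsub
      _ = m (closedBall x (δ ^ n - 4 * C₀ * δ ^ k + 8 * C₀ * δ ^ k))
          - m (closedBall x (δ ^ n - 4 * C₀ * δ ^ k)) :=
        measure_sdiff (Metric.closedBall_subset_closedBall (by linarith [mul_pos hC hkp]))
          (G.measurableSet_closedBall _ _).nullMeasurableSet (G.finite_ball _ _)
      _ ≤ ENNReal.ofReal (K * P * (decayRate δ ε : ℝ) ^ (n - k).natAbs)
          * m (closedBall x (δ ^ n - 4 * C₀ * δ ^ k)) := by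
        rw [tsub_le_iff_right]
        refine hd.trans ?_
        rw [← add_one_mul]
        gcongr
        rw [← ENNReal.ofReal_one, ← ENNReal.ofReal_add (by positivity) (by norm_num)]
        refine ENNReal.ofReal_le_ofReal ?_
        nlinarith
      _ ≤ _ := by
        rw [ENNReal.ofReal_mul (by positivity), ENNReal.ofReal_pow (by positivity),
          ENNReal.ofReal_coe_nnreal]
        gcongr
        · rw [ENNReal.ofReal]
          exact_mod_cast le_max_left _ _
        · linarith [mul_pos hC hkp]
  · push Not at hs
    -- For a thick annulus the claimed gain is at least 1, so plain doubling suffices.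
    have h1 : 1 ≤ P * (decayRate δ ε : ℝ) ^ (n - k).natAbs := by
      rw [← hPr]
      refine Real.one_le_rpow ?_ hε.le
      rw [← mul_div_assoc, le_div_iff₀ hnp]
      linarith
    have h1' : (1 : ℝ≥0∞) ≤ P.toNNReal * decayRate δ ε ^ (n - k).natAbs := by
      rw [← ENNReal.coe_pow, ← ENNReal.coe_mul, ← ENNReal.coe_one, ENNReal.coe_le_coe,
        ← NNReal.coe_le_coe]
      push_cast
      rwa [Real.coe_toNNReal _ hP0.le]
    calc _ ≤ m (closedBall x (δ ^ n + 4 * C₀ * δ ^ k)) :=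
          measure_mono fun y hy => by rw [mem_closedBall, dist_comm]; exact hy.2
      _ ≤ C * m (closedBall x (δ ^ n)) := by
          refine h x x _ _ (G.ρ_le hn) ?_ ?_
          · rw [dist_self]; positivity
          · nlinarith
      _ ≤ C * (P.toNNReal * decayRate δ ε ^ (n - k).natAbs) * m (closedBall x (δ ^ n)) := by
          gcongr
          exact le_mul_of_one_le_right (zero_le) h1'
      _ ≤ _ := by
          rw [← mul_assoc]
          gcongr
          exact_mod_cast le_max_right _ _

lemma measurable_annulusKernel (n k : ℤ) :
    Measurable (Function.uncurry (annulusKernel m δ C₀ n k)) :=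
  Measurable.indicator ((G.measurable_measure_ball _).inv.comp measurable_fst)
    ((measurableSet_lt measurable_const G.measurable_dist).inter
      (measurableSet_le G.measurable_dist measurable_const))

lemma measurable_ballKernel (r : ℝ) : Measurable (Function.uncurry (ballKernel m r)) :=
  Measurable.indicator ((G.measurable_measure_ball _).inv.comp measurable_fst)
    (measurableSet_le (G.measurable_dist.comp measurable_swap) measurable_const)

lemma measurableSet_annulus (a b : ℝ) (x : X) :
    MeasurableSet {y | a < dist x y ∧ dist x y ≤ b} :=
  (measurableSet_lt measurable_const (G.measurable_dist.comp measurable_prodMk_left)).inter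
    (measurableSet_le (G.measurable_dist.comp measurable_prodMk_left) measurable_const)

/-- Schur's test needs both marginals. The integral in y is the relative measure of an annulus
around x. In the other variable the kernel is normalised by the ball at x, which doubling trades for
the ball at y, the two points being within (1 + 4C₀)δ^n. -/
lemma exists_annulusKernel_le : ∃ C : ℝ≥0, ∀ n k, M ≤ n → k ≤ n →
    (∀ x, ∫⁻ y, annulusKernel m δ C₀ n k x y ∂m ≤ C * decayRate δ ε ^ (n - k).natAbs) ∧
    (∀ y, ∫⁻ x, annulusKernel m δ C₀ n k x y ∂m ≤ C * decayRate δ ε ^ (n - k).natAbs) := by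
  obtain ⟨C, hC⟩ := G.exists_annulus_le
  obtain ⟨D, hD⟩ := G.exists_ball_comparison (1 + 4 * C₀)
  have hC0 := G.C₀_pos
  refine ⟨C + D * C, fun n k hn hk => ⟨fun x => ?_, fun y => ?_⟩⟩
  · have hp := G.pos_ball x (δ ^ n) (G.ρ_le hn)
    have hf := G.finite_ball x (δ ^ n)
    calc ∫⁻ y, annulusKernel m δ C₀ n k x y ∂m
        = ∫⁻ y, {y | δ ^ n - 4 * C₀ * δ ^ k < dist x y ∧
            dist x y ≤ δ ^ n + 4 * C₀ * δ ^ k}.indicator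
            (fun _ => (m (closedBall x (δ ^ n)))⁻¹) y ∂m := rfl
      _ = (m (closedBall x (δ ^ n)))⁻¹ * m {y | δ ^ n - 4 * C₀ * δ ^ k < dist x y ∧
            dist x y ≤ δ ^ n + 4 * C₀ * δ ^ k} :=
          lintegral_indicator_const (G.measurableSet_annulus _ _ x) _
      _ ≤ (m (closedBall x (δ ^ n)))⁻¹ *
          (C * decayRate δ ε ^ (n - k).natAbs * m (closedBall x (δ ^ n))) := by
          gcongr; exact hC n k hn hk x
      _ = C * decayRate δ ε ^ (n - k).natAbs := by
          rw [mul_comm, mul_assoc, ENNReal.mul_inv_cancel hp hf, mul_one]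
      _ ≤ _ := by gcongr; exact_mod_cast le_self_add
  · have hp := G.pos_ball y (δ ^ n) (G.ρ_le hn)
    have hf := G.finite_ball y (δ ^ n)
    calc ∫⁻ x, annulusKernel m δ C₀ n k x y ∂m
        ≤ ∫⁻ x, {x | δ ^ n - 4 * C₀ * δ ^ k < dist y x ∧
            dist y x ≤ δ ^ n + 4 * C₀ * δ ^ k}.indicator
            (fun _ => D * (m (closedBall y (δ ^ n)))⁻¹) x ∂m := by
          refine lintegral_mono fun x => ?_
          by_cases hx : δ ^ n - 4 * C₀ * δ ^ k < dist y x ∧ dist y x ≤ δ ^ n + 4 * C₀ * δ ^ k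
          · rw [annulusKernel, indicator_of_mem (by simpa [dist_comm x y] using hx),
              indicator_of_mem (by exact hx)]
            have hkn := G.zpow_mono hk
            have hnp := G.zpow_pos n
            have hb := hD x y (δ ^ n) (δ ^ n) (G.ρ_le hn)
              (by rw [dist_comm]; nlinarith [hx.2]) (by nlinarith)
            rw [ENNReal.inv_le_iff_inv_le, ENNReal.mul_inv (Or.inr (by simpa using hp))
              (Or.inr (by simpa using hf)), inv_inv]
            rw [mul_comm, ← div_eq_mul_inv]
            exact ENNReal.div_le_of_le_mul' hb
          · rw [annulusKernel, indicator_of_notMem (by simpa [dist_comm x y] using hx)]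
            exact zero_le
      _ = D * (m (closedBall y (δ ^ n)))⁻¹ * m {x | δ ^ n - 4 * C₀ * δ ^ k < dist y x ∧
            dist y x ≤ δ ^ n + 4 * C₀ * δ ^ k} :=
          lintegral_indicator_const (G.measurableSet_annulus _ _ y) _
      _ ≤ D * (m (closedBall y (δ ^ n)))⁻¹ *
          (C * decayRate δ ε ^ (n - k).natAbs * m (closedBall y (δ ^ n))) := by
          gcongr; exact hC n k hn hk y
      _ = D * C * decayRate δ ε ^ (n - k).natAbs *
          ((m (closedBall y (δ ^ n)))⁻¹ * m (closedBall y (δ ^ n))) := by ring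
      _ = D * C * decayRate δ ε ^ (n - k).natAbs := by
          rw [ENNReal.inv_mul_cancel hp hf, mul_one]
      _ ≤ _ := by push_cast; gcongr; exact le_add_self

lemma exists_ballKernel_le : ∃ C : ℝ≥0, 1 ≤ C ∧ ∀ r, ρ ≤ r →
    (∀ x, ∫⁻ y, ballKernel m r x y ∂m ≤ 1) ∧ (∀ y, ∫⁻ x, ballKernel m r x y ∂m ≤ C) := by
  obtain ⟨D, hD⟩ := G.exists_ball_comparison 1
  refine ⟨D + 1, by simp, fun r hr => ⟨fun x => ?_, fun y => ?_⟩⟩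
  · calc ∫⁻ y, ballKernel m r x y ∂m
        = ∫⁻ y, (closedBall x r).indicator (fun _ => (m (closedBall x r))⁻¹) y ∂m := rfl
      _ = (m (closedBall x r))⁻¹ * m (closedBall x r) :=
          lintegral_indicator_const (G.measurableSet_closedBall x r) _
      _ ≤ 1 := ENNReal.inv_mul_le_one _
  · have hp := G.pos_ball y r hr
    have hf := G.finite_ball y r
    calc ∫⁻ x, ballKernel m r x y ∂m
        ≤ ∫⁻ x, (closedBall y r).indicator (fun _ => D * (m (closedBall y r))⁻¹) x ∂m := by
          refine lintegral_mono fun x => ?_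
          by_cases hx : x ∈ closedBall y r
          · have hx' : dist y x ≤ r := by rw [dist_comm]; exact hx
            rw [ballKernel, indicator_of_mem (by exact hx'), indicator_of_mem hx]
            have hb := hD x y r r hr (by rw [dist_comm]; linarith) (by linarith)
            rw [ENNReal.inv_le_iff_inv_le, ENNReal.mul_inv (Or.inr (by simpa using hp))
              (Or.inr (by simpa using hf)), inv_inv]
            rw [mul_comm, ← div_eq_mul_inv]
            exact ENNReal.div_le_of_le_mul' hb
          · rw [ballKernel, indicator_of_notMem
              (by rw [mem_closedBall, dist_comm] at hx; exact hx)]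
            exact zero_le
      _ = D * (m (closedBall y r))⁻¹ * m (closedBall y r) :=
          lintegral_indicator_const (G.measurableSet_closedBall y r) _
      _ = D := by rw [mul_assoc, ENNReal.inv_mul_cancel hp hf, mul_one]
      _ ≤ _ := by exact_mod_cast le_self_add

end CubeGrid

/-! ### Small boundaries of dyadic cubes -/

/-- The cubes of generation `j` inside the cube `α` of generation `k` which come close to its
complement, relative to their size. -/
def boundaryCubes {X : Type*} [PseudoMetricSpace X] {I : ℤ → Type*} (c : ∀ k, X → I k)
    (δ c₀ : ℝ) (j k : ℤ) (α : I k) : Set (I j) :=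
  {i | ∃ y, c j y = i ∧ c k y = α ∧ ∃ u, dist u y ≤ c₀ / 18 * δ ^ j ∧ c k u ≠ α}

namespace CubeGrid

variable {X : Type*} [PseudoMetricSpace X] [MeasurableSpace X] {m : Measure X}
  {I : ℤ → Type*} {c : ∀ k, X → I k} {z : ∀ k, I k → X} {δ c₀ C₀ ε K ρ : ℝ} {M : ℤ}
  (G : CubeGrid m c z δ c₀ C₀ ε K ρ M)

include G

lemma boundaryCubes_subset_cell {j k : ℤ} (hjk : j ≤ k) (α : I k) :
    c j ⁻¹' boundaryCubes c δ c₀ j k α ⊆ c k ⁻¹' {α} := by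
  rintro x ⟨y, hy, hyα, -⟩
  exact (G.nested j k hjk y x hy).symm.trans hyα

lemma boundaryCubes_mono {j l k : ℤ} (hjl : j ≤ l) (α : I k) :
    c j ⁻¹' boundaryCubes c δ c₀ j k α ⊆ c l ⁻¹' boundaryCubes c δ c₀ l k α := by
  rintro x ⟨y, hy, hyα, u, hu, huα⟩
  refine ⟨y, G.nested j l hjl y x hy, hyα, u, hu.trans ?_, huα⟩
  have := G.zpow_mono hjl
  have := G.c₀_pos
  gcongr

lemma measure_saturated (j : ℤ) (s : Set (I j)) :
    m (c j ⁻¹' s) = ∑' i : s, m (c j ⁻¹' {(i : I j)}) := by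
  have := G.countable j
  simpa using lintegral_saturated (m := m) (G.measurableSet_fibre j) s (fun _ => 1)

/-- Let F be the union of the boundary cubes of generation j. For each i between j and k, the cubes
of generation i meeting F cover F, and the union W i of their cores (balls of radius c₀δ^i/18 around
the centres) has measure at least m(F)/C. The sets W i lie in the cube α and are pairwise disjoint:
the smaller cubes stay near the complement of α, whereas the cores of the larger ones are far from
it. Hence k - j + 1 disjoint pieces fit into one cube. -/
lemma exists_boundaryCubes_le : ∃ C : ℝ≥0, ∀ j k, M ≤ j → j ≤ k → ∀ α : I k,
    ((k - j).natAbs + 1 : ℕ) * m (c j ⁻¹' boundaryCubes c δ c₀ j k α) ≤ C * m (c k ⁻¹' {α}) := by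
  obtain ⟨C, hC⟩ := G.exists_centre_comparison (4 * C₀)
  have hc := G.c₀_pos
  have hC0 := G.C₀_pos
  refine ⟨C, fun j k hj hjk α => ?_⟩
  set F := c j ⁻¹' boundaryCubes c δ c₀ j k α with hF
  let W : ℤ → Set X := fun i => ⋃ i' ∈ c i '' F, closedBall (z i i') (c₀ / 18 * δ ^ i)
  have hball : ∀ i (i' : I i) w, w ∈ closedBall (z i i') (c₀ / 18 * δ ^ i) → c i w = i' := by
    intro i i' w hw
    refine G.ball_subset i i' w ((mem_closedBall.1 hw).trans ?_)
    have := G.zpow_pos i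
    gcongr
    norm_num
  have hWmeas : ∀ i, MeasurableSet (W i) := fun i => by
    have := G.countable i
    exact MeasurableSet.biUnion (to_countable _) fun _ _ => G.measurableSet_closedBall _ _
  have hWsub : ∀ i ∈ Finset.Icc j k, W i ⊆ c k ⁻¹' {α} := by
    intro i hi w hw
    obtain ⟨i', ⟨y, hy, rfl⟩, hw⟩ := mem_iUnion₂.1 hw
    exact (G.nested i k (Finset.mem_Icc.1 hi).2 _ _ (hball i _ w hw)).trans
      (G.boundaryCubes_subset_cell hjk α hy)
  have hlarge : ∀ i ∈ Finset.Icc j k, m F ≤ C * m (W i) := by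
    intro i hi
    have := G.countable i
    have hji := (Finset.mem_Icc.1 hi).1
    calc m F ≤ m (c i ⁻¹' (c i '' F)) := measure_mono (subset_preimage_image _ _)
      _ = ∑' i' : c i '' F, m (c i ⁻¹' {(i' : I i)}) := G.measure_saturated i _
      _ ≤ ∑' i' : c i '' F, C * m (closedBall (z i i') (c₀ / 18 * δ ^ i)) := by
          refine ENNReal.tsum_le_tsum fun i' => ?_
          have h := hC i (hj.trans hji) (z i i') (z i i')
            (by rw [dist_self]; have := G.zpow_pos i; positivity) _ le_rfl
          rw [G.c_centre] at h
          refine (measure_mono ?_).trans h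
          have := G.cell_subset_ball i (z i i')
          rwa [G.c_centre] at this
      _ = C * m (W i) := by
          rw [ENNReal.tsum_mul_left, measure_biUnion (to_countable _) _
            (fun _ _ => G.measurableSet_closedBall _ _)]
          intro i₁ _ i₂ _ hne
          rw [Function.onFun, Set.disjoint_left]
          intro w h₁ h₂
          exact hne ((hball i _ w h₁).symm.trans (hball i _ w h₂))
  -- A common point w leads from the centre of the large cube to a point u outside α in three short
  -- steps. The ball of radius c₀δ^l/3 around that centre lies inside α, so it cannot contain u.
  have hdisj' : ∀ i l, j ≤ i → i < l → l ≤ k → Disjoint (W i) (W l) := by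
    intro i l hji hil hlk
    rw [Set.disjoint_left]
    intro w hwi hwl
    obtain ⟨_, ⟨y, ⟨y', hy', hyα, u, hu, huα⟩, rfl⟩, hwi⟩ := mem_iUnion₂.1 hwi
    obtain ⟨l', ⟨v, hv, rfl⟩, hwl⟩ := mem_iUnion₂.1 hwl
    have hwy : c i w = c i y' := (hball i _ w hwi).trans (G.nested j i hji _ _ hy').symm
    have hly : c l y' = c l v := (G.nested i l hil.le _ _ hwy).symm.trans (hball l _ w hwl)
    have hvk : c k v = α := G.boundaryCubes_subset_cell hjk α hv
    have hfar : c₀ / 3 * δ ^ l < dist u (z l (c l v)) := by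
      by_contra hcon
      push Not at hcon
      exact huα ((G.nested l k hlk _ _ (G.ball_subset l _ u hcon)).trans hvk)
    have h1 : dist w y' ≤ 4 * C₀ * δ ^ i := G.dist_le_of_eq hwy
    have h2 : dist w (z l (c l v)) ≤ c₀ / 18 * δ ^ l := mem_closedBall.1 hwl
    have h3 : δ ^ j ≤ δ ^ l := G.zpow_mono (hji.trans hil.le)
    have h4 : 18 * (C₀ * δ ^ i) ≤ c₀ * δ ^ l := by
      have e : δ ^ (i + 1) ≤ δ ^ l := G.zpow_mono hil
      rw [zpow_add_one₀ G.δ_pos.ne'] at e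
      nlinarith [G.small, G.zpow_pos i]
    have h5 := dist_triangle4 u y' w (z l (c l v))
    rw [dist_comm y' w] at h5
    have h6 : c₀ / 18 * δ ^ j ≤ c₀ / 18 * δ ^ l := by gcongr
    -- In units of c₀δ^l/18 the three steps have lengths at most 1, 4 and 1, summing to 6, that is
    -- c₀δ^l/3: this is where the constant 18 in `G.small` is spent.
    nlinarith [mul_pos hc (G.zpow_pos l)]
  have hdisj : (Finset.Icc j k : Set ℤ).PairwiseDisjoint W := by
    intro i hi l hl hne
    simp only [Finset.coe_Icc, mem_Icc] at hi hl
    rcases lt_or_gt_of_ne hne with h | h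
    · exact hdisj' i l hi.1 h hl.2
    · exact (hdisj' l i hl.1 h hi.2).symm
  calc ((k - j).natAbs + 1 : ℕ) * m F = ∑ _i ∈ Finset.Icc j k, m F := by
        rw [Finset.sum_const, Int.card_Icc, nsmul_eq_mul]
        congr 2
        lia
    _ ≤ ∑ i ∈ Finset.Icc j k, C * m (W i) := Finset.sum_le_sum hlarge
    _ = C * m (⋃ i ∈ Finset.Icc j k, W i) := by
        rw [← Finset.mul_sum, measure_biUnion_finset hdisj fun i _ => hWmeas i]
    _ ≤ C * m (c k ⁻¹' {α}) := by
        gcongr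
        exact iUnion₂_subset hWsub

/-- The linear gain halves the measure once k - j is large. Since a boundary cube of α lies in a
coarser boundary cube σ of α, and is a boundary cube of σ as well, the halving can be iterated. -/
lemma exists_boundaryCubes_geometric : ∃ J : ℕ, 1 ≤ J ∧ ∀ i : ℕ, ∀ k, M ≤ k - i * J →
    ∀ α : I k, m (c (k - i * J) ⁻¹' boundaryCubes c δ c₀ (k - i * J) k α)
      ≤ (2⁻¹ : ℝ≥0∞) ^ i * m (c k ⁻¹' {α}) := by
  obtain ⟨C, hC⟩ := G.exists_boundaryCubes_le
  obtain ⟨J, hJ⟩ := exists_nat_ge (2 * C)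
  refine ⟨J + 1, by simp, fun i => ?_⟩
  have hstep : ∀ k, M ≤ k - (J + 1 : ℕ) → ∀ α : I k,
      m (c (k - (J + 1 : ℕ)) ⁻¹' boundaryCubes c δ c₀ (k - (J + 1 : ℕ)) k α)
        ≤ 2⁻¹ * m (c k ⁻¹' {α}) := by
    intro k hk α
    have h := hC _ k hk (by lia) α
    rw [show (k - (k - ((J + 1 : ℕ) : ℤ))).natAbs + 1 = J + 2 by lia] at h
    set A := m (c (k - (J + 1 : ℕ)) ⁻¹' boundaryCubes c δ c₀ (k - (J + 1 : ℕ)) k α)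
    have h2 : (2 * C : ℝ≥0∞) * A ≤ C * m (c k ⁻¹' {α}) := by
      refine le_trans ?_ h
      gcongr
      calc (2 * C : ℝ≥0∞) ≤ (J : ℝ≥0∞) := by exact_mod_cast hJ
        _ ≤ _ := by exact_mod_cast (by lia : J ≤ J + 2)
    rcases eq_or_ne C 0 with h0 | h0
    · have : A = 0 := by simpa [h0] using h
      simp [this]
    · rw [mul_comm (2 : ℝ≥0∞), mul_assoc, ENNReal.mul_le_mul_iff_right (by simpa using h0)
        ENNReal.coe_ne_top] at h2
      calc A = 2⁻¹ * (2 * A) := by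
            rw [← mul_assoc, ENNReal.inv_mul_cancel (by norm_num) (by norm_num), one_mul]
        _ ≤ _ := by gcongr
  induction i with
  | zero =>
    intro k hk α
    simp only [pow_zero, one_mul]
    exact measure_mono (G.boundaryCubes_subset_cell (by simp) α)
  | succ i ih =>
    intro k hk α
    set l := k - ((J + 1 : ℕ) : ℤ) with hl
    have he : k - ((i + 1 : ℕ) : ℤ) * ((J + 1 : ℕ) : ℤ) = l - i * ((J + 1 : ℕ) : ℤ) := by
      rw [hl]; push_cast; ring
    rw [he] at hk ⊢
    set j := l - i * ((J + 1 : ℕ) : ℤ) with hj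
    have hjl : j ≤ l := by
      have : (0 : ℤ) ≤ i * ((J + 1 : ℕ) : ℤ) := by positivity
      lia
    have := G.countable l
    have hsub : c j ⁻¹' boundaryCubes c δ c₀ j k α ⊆
        ⋃ σ ∈ boundaryCubes c δ c₀ l k α, c j ⁻¹' boundaryCubes c δ c₀ j l σ := by
      intro x hx
      refine mem_iUnion₂.2 ⟨c l x, G.boundaryCubes_mono hjl α hx, ?_⟩
      obtain ⟨y, hy, hyα, u, hu, huα⟩ := hx
      -- The same witness u serves for σ: a point outside α is outside every subcube of α.
      refine ⟨y, hy, G.nested j l hjl _ _ hy, u, hu, fun h => huα ?_⟩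
      rw [← hyα]
      exact G.nested l k (by lia) _ _ (h.trans (G.nested j l hjl _ _ hy).symm)
    calc m (c j ⁻¹' boundaryCubes c δ c₀ j k α)
        ≤ ∑' σ : boundaryCubes c δ c₀ l k α, m (c j ⁻¹' boundaryCubes c δ c₀ j l σ) :=
          (measure_mono hsub).trans (measure_biUnion_le m (to_countable _) _)
      _ ≤ ∑' σ : boundaryCubes c δ c₀ l k α, (2⁻¹ : ℝ≥0∞) ^ i * m (c l ⁻¹' {(σ : I l)}) :=
          ENNReal.tsum_le_tsum fun σ => ih l hk σ
      _ = (2⁻¹ : ℝ≥0∞) ^ i * m (c l ⁻¹' boundaryCubes c δ c₀ l k α) := by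
          rw [ENNReal.tsum_mul_left, G.measure_saturated l]
      _ ≤ (2⁻¹ : ℝ≥0∞) ^ i * (2⁻¹ * m (c k ⁻¹' {α})) := by
          gcongr
          exact hstep k (hk.trans hjl) α
      _ = _ := by rw [pow_succ, mul_assoc]

/-- The cubes have small boundaries. -/
lemma exists_boundary_le : ∃ C τ : ℝ≥0, τ < 1 ∧ ∀ n k, M ≤ n → n ≤ k → ∀ α : I k,
    m {y | c k y = α ∧ ∃ u, dist u y ≤ 2 * δ ^ n ∧ c k u ≠ α}
      ≤ C * τ ^ (k - n).natAbs * m (c k ⁻¹' {α}) := by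
  obtain ⟨J, hJ1, hJ⟩ := G.exists_boundaryCubes_geometric
  have hc := G.c₀_pos
  -- Then 2δ^n ≤ c₀δ^{n+j₀}/18, so the layer of width 2δ^n is covered by boundary cubes of
  -- generation n + j₀.
  obtain ⟨j₀, hj₀⟩ := pow_unbounded_of_one_lt (2 * (18 / c₀)) G.one_lt
  -- One halving every J generations. The constant τ^{-(j₀+J)} pays for the shift by j₀, for
  -- rounding to a multiple of J, and for the case k < n + j₀.
  set τ : ℝ≥0 := (1 / 2) ^ ((J : ℝ)⁻¹) with hτ
  have hτJ : τ ^ J = 1 / 2 := NNReal.rpow_inv_natCast_pow _ (by lia)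
  have hτ1 : τ < 1 := NNReal.rpow_lt_one (by norm_num) (by positivity)
  have hτ0 : 0 < τ := NNReal.rpow_pos (by norm_num)
  have key : ∀ s t : ℕ, t ≤ s + (j₀ + J) →
      (τ : ℝ≥0∞) ^ s ≤ ((τ : ℝ≥0∞) ^ (j₀ + J))⁻¹ * (τ : ℝ≥0∞) ^ t := by
    intro s t hst
    rw [← ENNReal.coe_pow, ← ENNReal.coe_pow, ← ENNReal.coe_pow,
      ← ENNReal.coe_inv (pow_pos hτ0 _).ne', ← ENNReal.coe_mul, ENNReal.coe_le_coe,
      ← div_eq_inv_mul, le_div_iff₀ (pow_pos hτ0 _), ← pow_add]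
    exact pow_le_pow_of_le_one (zero_le) hτ1.le hst
  refine ⟨(τ ^ (j₀ + J))⁻¹, τ, hτ1, fun n k hn hnk α => ?_⟩
  have hco : (((τ ^ (j₀ + J))⁻¹ : ℝ≥0) : ℝ≥0∞) = ((τ : ℝ≥0∞) ^ (j₀ + J))⁻¹ := by
    rw [ENNReal.coe_inv (pow_pos hτ0 _).ne', ENNReal.coe_pow]
  rw [hco]
  by_cases hcase : n + j₀ ≤ k
  · set t := (k - n - j₀).natAbs with ht
    set i := t / J with hi
    have hiJ : i * J ≤ t := Nat.div_mul_le_self t J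
    have hiJ' : t < i * J + J := by
      have := Nat.lt_div_mul_add (a := t) (b := J) (by lia)
      exact this
    have hiJz : (i : ℤ) * J ≤ k - n - j₀ := by
      have : ((i * J : ℕ) : ℤ) ≤ (t : ℤ) := by exact_mod_cast hiJ
      push_cast at this
      lia
    have hsub : {y | c k y = α ∧ ∃ u, dist u y ≤ 2 * δ ^ n ∧ c k u ≠ α}
        ⊆ c (n + j₀) ⁻¹' boundaryCubes c δ c₀ (n + j₀) k α := by
      rintro y ⟨hy, u, hu, huα⟩
      refine ⟨y, rfl, hy, u, hu.trans ?_, huα⟩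
      rw [zpow_add₀ G.δ_pos.ne', zpow_natCast]
      have := G.zpow_pos n
      rw [mul_div_assoc', div_lt_iff₀ hc] at hj₀
      nlinarith
    calc _ ≤ m (c (k - i * J) ⁻¹' boundaryCubes c δ c₀ (k - i * J) k α) :=
          measure_mono (hsub.trans (G.boundaryCubes_mono (by lia) α))
      _ ≤ (2⁻¹ : ℝ≥0∞) ^ i * m (c k ⁻¹' {α}) := hJ i k (by lia) α
      _ = (τ : ℝ≥0∞) ^ (i * J) * m (c k ⁻¹' {α}) := by
          have : (2⁻¹ : ℝ≥0∞) = (τ : ℝ≥0∞) ^ J := by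
            rw [← ENNReal.coe_pow, hτJ]; norm_num
          rw [this, ← pow_mul, mul_comm J i]
      _ ≤ _ := by
          exact mul_le_mul_left (key _ _ (by lia)) _
  · calc _ ≤ (τ : ℝ≥0∞) ^ 0 * m (c k ⁻¹' {α}) := by
          rw [pow_zero, one_mul]
          exact measure_mono fun y hy => hy.1
      _ ≤ _ := by
          exact mul_le_mul_left (key _ _ (by lia)) _

end CubeGrid

/-! ### The differences of ball and cube averages, one scale at a time -/

/-- Integrability on balls. -/
def BallIntegrable {X : Type*} [PseudoMetricSpace X] [MeasurableSpace X] (m : Measure X)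
    (f : X → ℂ) : Prop := ∀ x r, IntegrableOn f (closedBall x r) m

/-- The average of `f` over the closed ball of radius `r` centred at `x`. -/
noncomputable def ballMean {X : Type*} [PseudoMetricSpace X] [MeasurableSpace X] (m : Measure X)
    (r : ℝ) (f : X → ℂ) (x : X) : ℂ := ⨍ y in closedBall x r, f y ∂m

/-- The difference between the ball average and the cube average at scale `n`. -/
noncomputable def avgDiff {X : Type*} [PseudoMetricSpace X] [MeasurableSpace X] (m : Measure X)
    (δ : ℝ) {I : ℤ → Type*} (c : ∀ k, X → I k) (n : ℤ) (f : X → ℂ) (x : X) : ℂ :=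
  ballMean m (δ ^ n) f x - cellAvg m (c n) f x

/-- The square function with scales restricted to `A`. -/
noncomputable def squareOn {X : Type*} [PseudoMetricSpace X] [MeasurableSpace X] (m : Measure X)
    (δ : ℝ) {I : ℤ → Type*} (c : ∀ k, X → I k) (A : Set ℤ) (f : X → ℂ) (x : X) : ℝ≥0∞ :=
  ellTwo (A.indicator fun n => ‖avgDiff m δ c n f x‖ₑ)

lemma eLpNorm_two_sq {X E : Type*} [MeasurableSpace X] {m : Measure X} [NormedAddCommGroup E]
    (f : X → E) : eLpNorm f 2 m ^ 2 = ∫⁻ x, ‖f x‖ₑ ^ 2 ∂m := by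
  rw [eLpNorm_eq_lintegral_rpow_enorm_toReal (by norm_num) (by norm_num)]
  simp only [ENNReal.toReal_ofNat, ENNReal.rpow_two]
  exact sqrt_sq_ennreal _

lemma le_of_sq_le_sq_ennreal {a b : ℝ≥0∞} (h : a ^ 2 ≤ b ^ 2) : a ≤ b := by
  rw [← sq_sqrt_ennreal a, ← sq_sqrt_ennreal b]
  exact ENNReal.rpow_le_rpow h (by norm_num)

lemma add_sq_le_ennreal (a b : ℝ≥0∞) : (a + b) ^ 2 ≤ 2 * (a ^ 2 + b ^ 2) := by
  have := ENNReal.rpow_add_le_mul_rpow_add_rpow a b (p := 2) (by norm_num)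
  norm_num at this
  exact this

section BallMean

variable {X : Type*} [PseudoMetricSpace X] [MeasurableSpace X] {m : Measure X}

lemma enorm_ballMean_le' (r : ℝ) (f : X → ℂ) (x : X) : ‖ballMean m r f x‖ₑ
    ≤ (m (closedBall x r))⁻¹ * ∫⁻ y in closedBall x r, ‖f y‖ₑ ∂m := enorm_setAverage_le _ _ _

lemma BallIntegrable.sub {f g : X → ℂ} (hf : BallIntegrable m f) (hg : BallIntegrable m g) :
    BallIntegrable m (fun x => f x - g x) := fun x r => (hf x r).sub (hg x r)

lemma ballMean_add {f g : X → ℂ} (hf : BallIntegrable m f) (hg : BallIntegrable m g) (r : ℝ)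
    (x : X) : ballMean m r (fun y => f y + g y) x = ballMean m r f x + ballMean m r g x := by
  simp only [ballMean, setAverage_eq]
  rw [integral_add (hf x r) (hg x r), smul_add]

end BallMean

namespace CubeGrid

variable {X : Type*} [PseudoMetricSpace X] [MeasurableSpace X] {m : Measure X}
  {I : ℤ → Type*} {c : ∀ k, X → I k} {z : ∀ k, I k → X} {δ c₀ C₀ ε K ρ : ℝ} {M : ℤ}
  (G : CubeGrid m c z δ c₀ C₀ ε K ρ M)

include G

lemma lintegral_ballKernel {r : ℝ} (hr : ρ ≤ r) (h : X → ℝ≥0∞) (x : X) :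
    ∫⁻ y, ballKernel m r x y * h y ∂m
      = (m (closedBall x r))⁻¹ * ∫⁻ y in closedBall x r, h y ∂m := by
  rw [← lintegral_indicator (G.measurableSet_closedBall x r),
    ← lintegral_const_mul' _ _ (by simpa using G.pos_ball x r hr)]
  refine lintegral_congr fun y => ?_
  by_cases hy : y ∈ closedBall x r
  · rw [ballKernel, indicator_of_mem (by exact hy), indicator_of_mem hy]
  · rw [ballKernel, indicator_of_notMem (by exact hy), indicator_of_notMem hy, zero_mul, mul_zero]

lemma enorm_ballMean_le {r : ℝ} (hr : ρ ≤ r) (f : X → ℂ) (x : X) :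
    ‖ballMean m r f x‖ₑ ≤ ∫⁻ y, ballKernel m r x y * ‖f y‖ₑ ∂m :=
  (enorm_ballMean_le' r f x).trans (G.lintegral_ballKernel hr _ x).ge

lemma measurable_setIntegral_ball {f : X → ℂ} (hf : Measurable f) (r : ℝ) :
    Measurable fun x => ∫ y in closedBall x r, f y ∂m := by
  have := G.sigmaFinite
  have h1 : StronglyMeasurable (Function.uncurry fun x y : X => (closedBall x r).indicator f y) :=
    Measurable.stronglyMeasurable (Measurable.indicator (s := {p : X × X | dist p.2 p.1 ≤ r})
      (hf.comp measurable_snd)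
      (measurableSet_le (G.measurable_dist.comp measurable_swap) measurable_const))
  have h2 := (StronglyMeasurable.integral_prod_right (ν := m) h1).measurable
  simpa only [integral_indicator (G.measurableSet_closedBall _ r)] using h2

lemma measurable_ballMean {f : X → ℂ} (hf : Measurable f) (r : ℝ) :
    Measurable (ballMean m r f) := by
  have : ballMean m r f = fun x => (m.real (closedBall x r))⁻¹ • ∫ y in closedBall x r, f y ∂m := by
    funext x
    rw [ballMean, setAverage_eq]
  rw [this]
  exact ((G.measurable_measure_ball r).ennreal_toReal.inv).smul (G.measurable_setIntegral_ball hf r)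

lemma measurable_avgDiff {f : X → ℂ} (hf : Measurable f) (n : ℤ) :
    Measurable (avgDiff m δ c n f) := by
  have := G.countable n
  exact (G.measurable_ballMean hf _).sub (measurable_cellAvg (G.measurableSet_fibre n) f)

lemma measurable_squareOn {f : X → ℂ} (hf : Measurable f) (A : Set ℤ) :
    Measurable (squareOn m δ c A f) := by
  refine Measurable.pow_const (Measurable.tsum fun n => ?_) _
  by_cases hn : n ∈ A
  · simp only [indicator_of_mem hn]
    exact (G.measurable_avgDiff hf n).enorm.pow_const 2
  · simp only [indicator_of_notMem hn]
    fun_prop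

lemma integrableOn_cell {f : X → ℂ} (hf : BallIntegrable m f) (k : ℤ) (α : I k) :
    IntegrableOn f (c k ⁻¹' {α}) m := by
  rw [← G.c_centre k α]
  exact (hf _ _).mono_set (G.cell_subset_ball k _)

lemma cellAvg_add {f g : X → ℂ} (hf : BallIntegrable m f) (hg : BallIntegrable m g) (k : ℤ)
    (x : X) : cellAvg m (c k) (fun y => f y + g y) x
      = cellAvg m (c k) f x + cellAvg m (c k) g x := by
  simp only [cellAvg, setAverage_eq]
  rw [integral_add (G.integrableOn_cell hf _ _) (G.integrableOn_cell hg _ _), smul_add]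

lemma avgDiff_add {f g : X → ℂ} (hf : BallIntegrable m f) (hg : BallIntegrable m g) (n : ℤ)
    (x : X) : avgDiff m δ c n (fun y => f y + g y) x
      = avgDiff m δ c n f x + avgDiff m δ c n g x := by
  simp only [avgDiff, ballMean_add hf hg, G.cellAvg_add hf hg]
  ring

lemma squareOn_add_le {f g : X → ℂ} (hf : BallIntegrable m f) (hg : BallIntegrable m g)
    (A : Set ℤ) (x : X) : squareOn m δ c A (fun y => f y + g y) x
      ≤ squareOn m δ c A f x + squareOn m δ c A g x := by
  refine le_trans (ellTwo_mono fun n => ?_) (ellTwo_add_le _ _)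
  by_cases hn : n ∈ A
  · simp only [indicator_of_mem hn, G.avgDiff_add hf hg]
    exact enorm_add_le _ _
  · simp [indicator_of_notMem hn]

/-- A saturated set containing only whole cells of generation `k` inside a ball is contained in a
larger ball; hence cube averages of ball integrable functions are ball integrable. -/
lemma ballIntegrable_cellAvg {f : X → ℂ} (hf : BallIntegrable m f) (k : ℤ) :
    BallIntegrable m (cellAvg m (c k) f) := by
  intro x r
  have := G.countable k
  refine (integrableOn_cellAvg (s := c k '' closedBall x r) (G.measurableSet_fibre k)
    (G.finite_cell k) ((hf x (r + 4 * C₀ * δ ^ k)).mono_set ?_)).mono_set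
    (subset_preimage_image _ _)
  rintro y ⟨w, hw, hwy⟩
  rw [mem_closedBall] at hw ⊢
  have := G.dist_le_of_eq hwy
  have := dist_triangle_left y x w
  linarith

/-- Averaging a function with mean zero on cells only sees the cells crossing the sphere. -/
lemma enorm_ballMean_sub_cellAvg_le {ι : Type*} [Countable ι] {q : X → ι}
    (hq : ∀ i, MeasurableSet (q ⁻¹' {i})) (hfin : ∀ i, m (q ⁻¹' {i}) ≠ ∞) {κ : X → ℤ}
    (hκ : ∀ y y', q y = q y' → dist y y' ≤ 4 * C₀ * δ ^ κ y)
    {f : X → ℂ} (hf : BallIntegrable m f) {n : ℤ} (hn : ρ ≤ δ ^ n) (x : X)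
    {W : Set X} (hW : ∀ y y', dist y x ≤ δ ^ n → q y = q y' → δ ^ n < dist y' x → y ∈ W) :
    ‖ballMean m (δ ^ n) (fun y => f y - cellAvg m q f y) x‖ₑ
      ≤ ∫⁻ y, annulusKernel m δ C₀ n (κ y) x y
          * W.indicator (fun y => ‖f y - cellAvg m q f y‖ₑ) y ∂m := by
  set b : X → ℂ := fun y => f y - cellAvg m q f y with hb
  set B := closedBall x (δ ^ n) with hB
  have hBm : MeasurableSet B := G.measurableSet_closedBall x _
  -- Cells meeting `B` may be arbitrarily large, so integrability is not automatic; without it the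
  -- Bochner average is 0.
  by_cases hbi : IntegrableOn b B m
  swap
  · rw [ballMean, setAverage_eq, integral_undef hbi]
    simp
  -- Cells inside the ball contribute nothing. Every other point of the ball shares its cell with a
  -- point outside, hence is close to the sphere.
  set U := q ⁻¹' {i | q ⁻¹' {i} ⊆ B} with hU
  have hUm : MeasurableSet U := measurableSet_saturated hq _
  have hUB : U ⊆ B := fun y hy => hy rfl
  have h0 : ∫ y in U, b y ∂m = 0 :=
    setIntegral_sub_cellAvg hq hfin ((hf x (δ ^ n)).mono_set hUB)
  have hdiff : ∫ y in B, b y ∂m = ∫ y in B \ U, b y ∂m := by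
    rw [setIntegral_sdiff hUm hbi hUB, h0, sub_zero]
  have hV : (m B)⁻¹ ≠ ∞ := by simpa using G.pos_ball x _ hn
  have hreal : ‖(m.real B)⁻¹‖ₑ = (m B)⁻¹ := by
    have h1 := G.pos_ball x _ hn
    have h2 := G.finite_ball x (δ ^ n)
    rw [enorm_inv (by simp [measureReal_def, ENNReal.toReal_eq_zero_iff, hB, h1, h2]),
      Real.enorm_eq_ofReal measureReal_nonneg, ofReal_measureReal h2]
  rw [ballMean, setAverage_eq, ← hB, hdiff, enorm_smul, hreal]
  calc (m B)⁻¹ * ‖∫ y in B \ U, b y ∂m‖ₑ ≤ (m B)⁻¹ * ∫⁻ y in B \ U, ‖b y‖ₑ ∂m := by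
        gcongr; exact enorm_integral_le_lintegral_enorm _
    _ = ∫⁻ y, (B \ U).indicator (fun y => (m B)⁻¹ * ‖b y‖ₑ) y ∂m := by
        rw [← lintegral_const_mul' _ _ hV, lintegral_indicator (hBm.diff hUm)]
    _ ≤ _ := by
        refine lintegral_mono fun y => ?_
        by_cases hyBU : y ∈ B \ U
        swap
        · rw [indicator_of_notMem hyBU]
          exact zero_le
        rw [indicator_of_mem hyBU]
        obtain ⟨hyB, hyU⟩ := hyBU
        have hy : dist y x ≤ δ ^ n := mem_closedBall.1 hyB
        obtain ⟨y', hqy, hy'⟩ : ∃ y', q y' = q y ∧ y' ∉ B := by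
          by_contra hcon
          push Not at hcon
          exact hyU fun y' hy' => hcon y' hy'
        rw [hB, mem_closedBall, not_le] at hy'
        have hyW := hW y y' hy hqy.symm hy'
        have hdist := hκ y y' hqy.symm
        have htri := dist_triangle_left y' x y
        have h0' : 0 ≤ 4 * C₀ * δ ^ κ y := dist_nonneg.trans hdist
        rw [annulusKernel, indicator_of_mem, indicator_of_mem hyW]
        rw [mem_ofPred_eq, dist_comm x y]
        exact ⟨by linarith, by linarith⟩

/-- The hypothesis `hx` makes the cube of generation n through x a union of cells of q, on each of
which the integrand has mean zero. -/
lemma cellAvg_sub_cellAvg_eq_zero {ι : Type*} [Countable ι] {q : X → ι}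
    (hq : ∀ i, MeasurableSet (q ⁻¹' {i})) (hfin : ∀ i, m (q ⁻¹' {i}) ≠ ∞)
    {f : X → ℂ} (hf : BallIntegrable m f) {n : ℤ} {x : X}
    (hx : ∀ y y', c n y = c n x → q y = q y' → c n y' = c n x) :
    cellAvg m (c n) (fun y => f y - cellAvg m q f y) x = 0 := by
  have he : c n ⁻¹' {c n x} = q ⁻¹' (q '' (c n ⁻¹' {c n x})) := by
    refine (subset_preimage_image _ _).antisymm ?_
    rintro y ⟨w, hw, hwy⟩
    exact hx w y hw hwy
  have hi := G.integrableOn_cell hf n (c n x)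
  rw [cellAvg, setAverage_eq, he, setIntegral_sub_cellAvg hq hfin (by rwa [← he]), smul_zero]

lemma cellAvg_eq_self {g : X → ℂ} {n : ℤ} (hn : M ≤ n) {x : X} (h : ∀ y, c n y = c n x → g y = g x) :
    cellAvg m (c n) g x = g x := by
  rw [cellAvg, setAverage_congr_fun (G.measurableSet_fibre n _) (g := fun _ => g x)
    (Filter.Eventually.of_forall fun y hy => h y hy),
    setAverage_const (G.pos_cell hn x) (G.finite_cell n _)]

lemma ballMean_eq_self {g : X → ℂ} {r : ℝ} (hr : ρ ≤ r) {x : X}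
    (h : ∀ y, dist y x ≤ r → g y = g x) : ballMean m r g x = g x := by
  rw [ballMean, setAverage_congr_fun (G.measurableSet_closedBall x r) (g := fun _ => g x)
    (Filter.Eventually.of_forall fun y hy => h y hy),
    setAverage_const (G.pos_ball x r hr) (G.finite_ball x r)]

lemma cellAvg_cellAvg {f : X → ℂ} (hf : BallIntegrable m f) {k n : ℤ} (hkn : k ≤ n) (x : X) :
    cellAvg m (c n) (cellAvg m (c k) f) x = cellAvg m (c n) f x := by
  have := G.countable k
  have h := G.cellAvg_sub_cellAvg_eq_zero (n := n) (x := x) (G.measurableSet_fibre k)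
    (G.finite_cell k) hf fun y y' hy hyy' => (G.nested k n hkn _ _ hyy').symm.trans hy
  have h2 := G.cellAvg_add (G.ballIntegrable_cellAvg hf k)
    (hf.sub (G.ballIntegrable_cellAvg hf k)) n x
  simp only [add_sub_cancel] at h2
  rw [h2, h, add_zero]

lemma memLp_two_ballIntegrable {f : X → ℂ} {p : ℝ≥0∞} (hp : 1 ≤ p) (hf : MemLp f p m) :
    BallIntegrable m f := fun x r => by
  have : IsFiniteMeasure (m.restrict (closedBall x r)) := ⟨by simpa using (G.finite_ball x r).lt_top⟩
  exact (hf.restrict _).integrable hp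

/-- The cube average vanishes by cancellation, and the ball average is dominated by the annulus
kernel, both of whose marginals carry the decay rate; Schur's test does the rest. -/
lemma exists_avgDiff_meanZero : ∃ C : ℝ≥0, ∀ n k, M ≤ n → k ≤ n → ∀ f : X → ℂ, Measurable f →
    BallIntegrable m f →
    ∫⁻ x, ‖avgDiff m δ c n (fun y => f y - cellAvg m (c k) f y) x‖ₑ ^ 2 ∂m
      ≤ (C * decayRate δ ε ^ (n - k).natAbs) ^ 2
        * ∫⁻ x, ‖f x - cellAvg m (c k) f x‖ₑ ^ 2 ∂m := by
  obtain ⟨C, hC⟩ := G.exists_annulusKernel_le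
  refine ⟨C, fun n k hn hkn f hf hfi => ?_⟩
  have := G.sigmaFinite
  have := G.countable k
  obtain ⟨hA, hB⟩ := hC n k hn hkn
  have hfm := measurable_cellAvg (m := m) (G.measurableSet_fibre k) f
  have hs := lintegral_kernel_rpow_le (G.measurable_annulusKernel n k) (p := 2) (by norm_num) hA hB
    (F := fun y => ‖f y - cellAvg m (c k) f y‖ₑ) (hf.sub hfm).enorm
  norm_num at hs
  rw [← sq] at hs
  refine le_trans (lintegral_mono fun x => ?_) hs
  gcongr
  rw [avgDiff, G.cellAvg_sub_cellAvg_eq_zero (G.measurableSet_fibre k) (G.finite_cell k) hfi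
    fun y y' hy hyy' => (G.nested k n hkn _ _ hyy').symm.trans hy, sub_zero]
  refine (G.enorm_ballMean_sub_cellAvg_le (G.measurableSet_fibre k) (G.finite_cell k)
    (κ := fun _ => k) (fun y y' h => G.dist_le_of_eq h) hfi (G.ρ_le hn) x (W := univ)
    (fun _ _ _ _ _ => trivial)).trans (le_of_eq ?_)
  simp

/-- The boundary layer need not be measurable, so it is replaced by a measurable hull, taken cube by
cube in order to keep the bound in each cube. -/
lemma exists_boundary_set : ∃ C τ : ℝ≥0, τ < 1 ∧ ∀ n k, M ≤ n → n ≤ k →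
    ∃ E : Set X, MeasurableSet E ∧ (∀ y u, dist u y ≤ 2 * δ ^ n → c k u ≠ c k y → y ∈ E) ∧
      ∀ α : I k, m (E ∩ c k ⁻¹' {α}) ≤ C * τ ^ (k - n).natAbs * m (c k ⁻¹' {α}) := by
  obtain ⟨C, τ, hτ, h⟩ := G.exists_boundary_le
  refine ⟨C, τ, hτ, fun n k hn hnk => ?_⟩
  have := G.countable k
  let F : I k → Set X := fun α =>
    toMeasurable m {y | c k y = α ∧ ∃ u, dist u y ≤ 2 * δ ^ n ∧ c k u ≠ α} ∩ c k ⁻¹' {α}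
  refine ⟨⋃ α, F α, MeasurableSet.iUnion fun α => (measurableSet_toMeasurable _ _).inter
    (G.measurableSet_fibre k α), fun y u hu huy => ?_, fun α => ?_⟩
  · exact mem_iUnion.2 ⟨c k y, subset_toMeasurable _ _ ⟨rfl, u, hu, huy⟩, rfl⟩
  · refine le_trans (measure_mono ?_) ((measure_toMeasurable _).trans_le (h n k hn hnk α))
    rintro y ⟨hy, hyα⟩
    obtain ⟨β, hy1, hy2⟩ := mem_iUnion.1 hy
    have : β = α := (show c k y = β from hy2).symm.trans hyα
    exact this ▸ hy1

/-- Here E_n g = g, and the ball average at x is g(x) as well unless the ball leaves the cube of x.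
In that case the whole ball lies in the boundary layer E, so T_n g is controlled by the restriction
of g to E, which carries a small fraction of each cube. -/
lemma exists_avgDiff_const : ∃ C τ : ℝ≥0, τ < 1 ∧ ∀ n k, M ≤ n → n ≤ k → ∀ g : X → ℂ,
    Measurable g → (∀ x y, c k x = c k y → g x = g y) →
    ∫⁻ x, ‖avgDiff m δ c n g x‖ₑ ^ 2 ∂m ≤ C * τ ^ (k - n).natAbs * ∫⁻ x, ‖g x‖ₑ ^ 2 ∂m := by
  obtain ⟨D, hD1, hD⟩ := G.exists_ballKernel_le
  obtain ⟨C, τ, hτ, h⟩ := G.exists_boundary_set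
  refine ⟨2 * (D + 1) * C, τ, hτ, fun n k hn hnk g hg hconst => ?_⟩
  have := G.sigmaFinite
  have := G.countable k
  obtain ⟨E, hE, hEs, hEm⟩ := h n k hn hnk
  obtain ⟨hA, hB⟩ := hD (δ ^ n) (G.ρ_le hn)
  set u : X → ℝ≥0∞ := E.indicator fun y => ‖g y‖ₑ with hu
  have hum : Measurable u := hg.enorm.indicator hE
  have hpt : ∀ x, ‖avgDiff m δ c n g x‖ₑ ≤ ∫⁻ y, ballKernel m (δ ^ n) x y * u y ∂m + u x := by
    intro x
    have hcell : cellAvg m (c n) g x = g x :=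
      G.cellAvg_eq_self hn fun y hy => hconst _ _ (G.nested n k hnk _ _ hy)
    by_cases hx : ∀ y, dist y x ≤ δ ^ n → c k y = c k x
    · rw [avgDiff, hcell, G.ballMean_eq_self (G.ρ_le hn) fun y hy => hconst _ _ (hx y hy)]
      simp
    · push Not at hx
      obtain ⟨v, hv, hvx⟩ := hx
      have hnp := G.zpow_pos n
      have hxE : x ∈ E := hEs x v (by linarith) hvx
      -- Either y shares the cube of x and v lies outside it, within 2δ^n of y, or x itself lies
      -- outside the cube of y. This is why the layer has width 2δ^n.
      have hyE : ∀ y, dist y x ≤ δ ^ n → y ∈ E := by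
        intro y hy
        by_cases hyx : c k y = c k x
        · refine hEs y v ?_ (by rwa [hyx])
          have := dist_triangle_right v y x
          linarith
        · exact hEs y x (by rw [dist_comm]; linarith) (fun h => hyx h.symm)
      rw [avgDiff, hcell]
      refine (enorm_sub_le).trans (add_le_add ((G.enorm_ballMean_le (G.ρ_le hn) g x).trans ?_) ?_)
      · rw [G.lintegral_ballKernel (G.ρ_le hn), G.lintegral_ballKernel (G.ρ_le hn)]
        gcongr 1
        refine le_of_eq (setLIntegral_congr_fun (G.measurableSet_closedBall _ _) fun y hy => ?_)
        rw [hu, indicator_of_mem (hyE y hy)]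
      · rw [hu, indicator_of_mem hxE]
  have hs := lintegral_kernel_rpow_le (G.measurable_ballKernel (δ ^ n)) (p := 2) (by norm_num) hA hB
    hum
  norm_num at hs
  have hmeas : Measurable fun x => ∫⁻ y, ballKernel m (δ ^ n) x y * u y ∂m :=
    Measurable.lintegral_prod_right' (f := fun p : X × X => ballKernel m (δ ^ n) p.1 p.2 * u p.2)
      ((G.measurable_ballKernel _).mul (hum.comp measurable_snd))
  have hu2 : ∫⁻ x, u x ^ 2 ∂m ≤ C * τ ^ (k - n).natAbs * ∫⁻ x, ‖g x‖ₑ ^ 2 ∂m := by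
    rw [lintegral_eq_tsum_fibres (G.measurableSet_fibre k),
      lintegral_eq_tsum_fibres (G.measurableSet_fibre k) (fun x => ‖g x‖ₑ ^ 2),
      ← ENNReal.tsum_mul_left]
    refine ENNReal.tsum_le_tsum fun α => ?_
    set a := g (z k α) with ha
    have hga : ∀ y ∈ c k ⁻¹' {α}, g y = a := fun y hy =>
      hconst _ _ (by rw [G.c_centre]; exact hy)
    have e1 : ∫⁻ x in c k ⁻¹' {α}, u x ^ 2 ∂m = ‖a‖ₑ ^ 2 * m (E ∩ c k ⁻¹' {α}) := by
      rw [← Measure.restrict_apply hE, ← lintegral_indicator_const hE]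
      refine setLIntegral_congr_fun (G.measurableSet_fibre k α) fun y hy => ?_
      by_cases hyE : y ∈ E
      · simp [hu, hyE, hga y hy]
      · simp [hu, hyE]
    have e2 : ∫⁻ x in c k ⁻¹' {α}, ‖g x‖ₑ ^ 2 ∂m = ‖a‖ₑ ^ 2 * m (c k ⁻¹' {α}) := by
      rw [← setLIntegral_const]
      exact setLIntegral_congr_fun (G.measurableSet_fibre k α) fun y hy => by rw [hga y hy]
    rw [e1, e2]
    calc _ ≤ ‖a‖ₑ ^ 2 * (C * τ ^ (k - n).natAbs * m (c k ⁻¹' {α})) := by gcongr; exact hEm α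
      _ = _ := by ring
  calc ∫⁻ x, ‖avgDiff m δ c n g x‖ₑ ^ 2 ∂m
      ≤ ∫⁻ x, 2 * ((∫⁻ y, ballKernel m (δ ^ n) x y * u y ∂m) ^ 2 + u x ^ 2) ∂m :=
        lintegral_mono fun x => (pow_le_pow_left' (hpt x) 2).trans (add_sq_le_ennreal _ _)
    _ = 2 * (∫⁻ x, (∫⁻ y, ballKernel m (δ ^ n) x y * u y ∂m) ^ 2 ∂m + ∫⁻ x, u x ^ 2 ∂m) := by
        rw [lintegral_const_mul' _ _ (by norm_num), lintegral_add_left (hmeas.pow_const 2)]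
    _ ≤ 2 * (D * ∫⁻ x, u x ^ 2 ∂m + ∫⁻ x, u x ^ 2 ∂m) := by gcongr
    _ = 2 * (D + 1) * ∫⁻ x, u x ^ 2 ∂m := by ring
    _ ≤ 2 * (D + 1) * (C * τ ^ (k - n).natAbs * ∫⁻ x, ‖g x‖ₑ ^ 2 ∂m) := by gcongr
    _ = _ := by push_cast; ring

end CubeGrid

/-! ### The L² estimate by martingale differences -/

namespace CubeGrid

variable {X : Type*} [PseudoMetricSpace X] [MeasurableSpace X] {m : Measure X}
  {I : ℤ → Type*} {c : ∀ k, X → I k} {z : ∀ k, I k → X} {δ c₀ C₀ ε K ρ : ℝ} {M : ℤ}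
  (G : CubeGrid m c z δ c₀ C₀ ε K ρ M)

include G

lemma lintegral_cellAvg_sq_le (k : ℤ) {f : X → ℂ} (hf : Measurable f) :
    ∫⁻ x, ‖cellAvg m (c k) f x‖ₑ ^ 2 ∂m ≤ ∫⁻ x, ‖f x‖ₑ ^ 2 ∂m := by
  have := G.countable k
  have h := lintegral_cellLAvg_rpow_le (m := m) (G.measurableSet_fibre k) univ hf.enorm (p := 2)
    (by norm_num)
  simp only [preimage_univ, Measure.restrict_univ, ENNReal.rpow_two] at h
  exact (lintegral_mono fun x => pow_le_pow_left' (enorm_cellAvg_le f x) 2).trans h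

lemma memLp_cellAvg (k : ℤ) {f : X → ℂ} (hf : Measurable f) (hf2 : MemLp f 2 m) :
    MemLp (cellAvg m (c k) f) 2 m := by
  have := G.countable k
  refine ⟨(measurable_cellAvg (G.measurableSet_fibre k) f).aestronglyMeasurable, ?_⟩
  refine lt_of_le_of_lt (le_of_sq_le_sq_ennreal ?_) hf2.2
  rw [eLpNorm_two_sq, eLpNorm_two_sq]
  exact G.lintegral_cellAvg_sq_le k hf

/-- The martingale differences of `f`, starting with `f - E_M f`. -/
noncomputable def martDiff (m : Measure X) (c : ∀ k, X → I k) (M : ℤ) (f : X → ℂ) (k : ℤ) (x : X) :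
    ℂ :=
  if k = M then f x - cellAvg m (c M) f x else cellAvg m (c (k - 1)) f x - cellAvg m (c k) f x

lemma martDiff_eq_sub {f : X → ℂ} (hf : BallIntegrable m f) {k : ℤ} (hk : k ≠ M) (x : X) :
    martDiff m c M f k x
      = cellAvg m (c (k - 1)) f x - cellAvg m (c k) (cellAvg m (c (k - 1)) f) x := by
  rw [martDiff, if_neg hk, G.cellAvg_cellAvg hf (by lia)]

/-- Pythagoras applied successively to E_M f, E_{M+1} f, ...; keeping the last average on the left
makes the induction close. -/
lemma sum_martDiff_sq_le {f : X → ℂ} (hf : Measurable f) (hf2 : MemLp f 2 m) (j : ℕ) :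
    ∑ i ∈ Finset.range (j + 1), ∫⁻ x, ‖martDiff m c M f (M + i) x‖ₑ ^ 2 ∂m
      + ∫⁻ x, ‖cellAvg m (c (M + j)) f x‖ₑ ^ 2 ∂m ≤ ∫⁻ x, ‖f x‖ₑ ^ 2 ∂m := by
  have hbi := G.memLp_two_ballIntegrable (by norm_num) hf2
  induction j with
  | zero =>
    have := G.countable M
    have h := lintegral_sub_cellAvg_sq_add_le (G.measurableSet_fibre M) (G.finite_cell M) hf2
    have e : M + ((0 : ℕ) : ℤ) = M := by simp
    rw [zero_add, Finset.sum_range_one, e]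
    simpa [martDiff] using h
  | succ j ih =>
    refine le_trans ?_ ih
    rw [Finset.sum_range_succ, add_assoc]
    gcongr
    have := G.countable (M + (j + 1 : ℕ))
    have h := lintegral_sub_cellAvg_sq_add_le (G.measurableSet_fibre (M + (j + 1 : ℕ)))
      (G.finite_cell _) (G.memLp_cellAvg (M + j) hf hf2)
    have e : cellAvg m (c (M + ((j + 1 : ℕ) : ℤ) - 1)) f = cellAvg m (c (M + j)) f :=
      congrArg (fun k => cellAvg m (c k) f) (by push_cast; ring)
    simp only [G.martDiff_eq_sub hbi (show M + ((j + 1 : ℕ) : ℤ) ≠ M by lia), e]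
    simpa only [G.cellAvg_cellAvg hbi (show M + (j : ℤ) ≤ M + ((j + 1 : ℕ) : ℤ) by lia)] using h

lemma tsum_martDiff_sq_le {f : X → ℂ} (hf : Measurable f) (hf2 : MemLp f 2 m) :
    ∑' k : ℤ, (Ici M).indicator (fun k => eLpNorm (martDiff m c M f k) 2 m) k ^ 2
      ≤ ∫⁻ x, ‖f x‖ₑ ^ 2 ∂m := by
  have hinj : Function.Injective fun i : ℕ => M + (i : ℤ) := fun i j h => by simpa using h
  rw [← hinj.tsum_eq]
  · refine ENNReal.tsum_le_of_sum_range_le fun j => ?_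
    refine le_trans ?_ (le_self_add.trans (G.sum_martDiff_sq_le hf hf2 j))
    rw [Finset.sum_range_succ]
    refine le_trans (Finset.sum_le_sum fun i _ => ?_) le_self_add
    rw [indicator_of_mem (by simp), eLpNorm_two_sq]
  · intro k hk
    by_contra hcon
    refine hk ?_
    simp only
    rw [indicator_of_notMem, zero_pow two_ne_zero]
    · exact fun hkM => hcon ⟨(k - M).natAbs, by have := mem_Ici.1 hkM; simp only; lia⟩

lemma measurable_martDiff {f : X → ℂ} (hf : Measurable f) (k : ℤ) :
    Measurable (martDiff m c M f k) := by
  have h : ∀ k, Measurable (cellAvg m (c k) f) := fun k => by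
    have := G.countable k
    exact measurable_cellAvg (G.measurableSet_fibre k) f
  unfold martDiff
  split_ifs
  · exact hf.sub (h M)
  · exact (h _).sub (h _)

lemma ballIntegrable_martDiff {f : X → ℂ} (hf : BallIntegrable m f) (k : ℤ) :
    BallIntegrable m (martDiff m c M f k) := by
  unfold martDiff
  split_ifs
  · exact hf.sub (G.ballIntegrable_cellAvg hf M)
  · exact (G.ballIntegrable_cellAvg hf _).sub (G.ballIntegrable_cellAvg hf _)

lemma eLpNorm_avgDiff_add_le {f g h : X → ℂ} (hf : BallIntegrable m f) (hg : BallIntegrable m g)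
    (hfm : Measurable f) (hgm : Measurable g) (he : ∀ x, h x = f x + g x) (n : ℤ) :
    eLpNorm (avgDiff m δ c n h) 2 m
      ≤ eLpNorm (avgDiff m δ c n f) 2 m + eLpNorm (avgDiff m δ c n g) 2 m := by
  have : h = fun x => f x + g x := funext he
  have e : avgDiff m δ c n h = avgDiff m δ c n f + avgDiff m δ c n g := by
    rw [this]
    exact funext fun x => G.avgDiff_add hf hg n x
  rw [e]
  exact eLpNorm_add_le (G.measurable_avgDiff hfm n).aestronglyMeasurable
    (G.measurable_avgDiff hgm n).aestronglyMeasurable (by norm_num)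

/-- A finite telescoping sum with remainder E_{M+j} f. No martingale convergence is needed, since
T_n is small on functions that are constant on very large cubes. -/
lemma eLpNorm_avgDiff_le_sum {f : X → ℂ} (hf : Measurable f) (hbi : BallIntegrable m f) (n : ℤ)
    (j : ℕ) : eLpNorm (avgDiff m δ c n f) 2 m
      ≤ ∑ i ∈ Finset.range (j + 1), eLpNorm (avgDiff m δ c n (martDiff m c M f (M + i))) 2 m
        + eLpNorm (avgDiff m δ c n (cellAvg m (c (M + j)) f)) 2 m := by
  have hm : ∀ k, Measurable (cellAvg m (c k) f) := fun k => by
    have := G.countable k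
    exact measurable_cellAvg (G.measurableSet_fibre k) f
  induction j with
  | zero =>
    have e : M + ((0 : ℕ) : ℤ) = M := by simp
    rw [zero_add, Finset.sum_range_one, e]
    refine G.eLpNorm_avgDiff_add_le (G.ballIntegrable_martDiff hbi M)
      (G.ballIntegrable_cellAvg hbi M) (G.measurable_martDiff hf M) (hm M) (fun x => ?_) n
    simp [martDiff]
  | succ j ih =>
    refine ih.trans ?_
    rw [Finset.sum_range_succ _ (j + 1), add_assoc]
    gcongr
    refine G.eLpNorm_avgDiff_add_le (G.ballIntegrable_martDiff hbi _)
      (G.ballIntegrable_cellAvg hbi _) (G.measurable_martDiff hf _) (hm _) (fun x => ?_) n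
    rw [martDiff, if_neg (by lia)]
    have e : cellAvg m (c (M + ((j + 1 : ℕ) : ℤ) - 1)) f = cellAvg m (c (M + j)) f :=
      congrArg (fun k => cellAvg m (c k) f) (by push_cast; ring)
    rw [e, sub_add_cancel]

/-- Almost orthogonality of `avgDiff n` and the martingale differences. -/
lemma exists_avgDiff_martDiff_le : ∃ C β : ℝ≥0, β < 1 ∧ ∀ f : X → ℂ, Measurable f →
    MemLp f 2 m → ∀ n, M ≤ n →
    (∀ k, M ≤ k → eLpNorm (avgDiff m δ c n (martDiff m c M f k)) 2 m
      ≤ C * β ^ (n - k).natAbs * eLpNorm (martDiff m c M f k) 2 m) ∧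
    (∀ k, n ≤ k → eLpNorm (avgDiff m δ c n (cellAvg m (c k) f)) 2 m
      ≤ C * β ^ (n - k).natAbs * eLpNorm f 2 m) := by
  obtain ⟨C₁, h₁⟩ := G.exists_avgDiff_meanZero
  obtain ⟨C₂, τ, hτ, h₂⟩ := G.exists_avgDiff_const
  set θ := decayRate δ ε with hθ
  set σ := NNReal.sqrt τ with hσ
  -- σ is a square root because boundary measure enters the L² norm squared. The bound β ≥ 1/2 gives
  -- 2β ≥ 1, which pays for one missing power: the k-th difference is constant only on cubes of
  -- generation k - 1.
  set β : ℝ≥0 := max (max θ σ) (1 / 2) with hβ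
  have hσ2 : σ ^ 2 = τ := NNReal.sq_sqrt τ
  have hθβ : θ ≤ β := (le_max_left _ _).trans (le_max_left _ _)
  have hσβ : σ ≤ β := (le_max_right _ _).trans (le_max_left _ _)
  have hβ2 : 1 ≤ 2 * β := by
    have : (1 / 2 : ℝ≥0) ≤ β := le_max_right _ _
    calc (1 : ℝ≥0) = 2 * (1 / 2) := by norm_num
      _ ≤ _ := by gcongr
  have hβ1 : β < 1 := by
    refine max_lt (max_lt G.decayRate_lt_one ?_) (by norm_num [← NNReal.coe_lt_coe])
    rw [hσ, ← NNReal.sqrt_one]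
    exact NNReal.sqrt_lt_sqrt.2 hτ
  set C : ℝ≥0 := C₁ + 2 * NNReal.sqrt C₂ with hC
  -- constants on cubes of generation `l`, read with one generation to spare
  have hconst : ∀ n l, M ≤ n → n ≤ l → ∀ g : X → ℂ, Measurable g →
      (∀ x y, c l x = c l y → g x = g y) → ∀ t ≤ (n - l).natAbs + 1,
      eLpNorm (avgDiff m δ c n g) 2 m ≤ C * β ^ t * eLpNorm g 2 m := by
    intro n l hn hl g hg hgc t ht
    refine le_of_sq_le_sq_ennreal ?_
    rw [mul_pow, eLpNorm_two_sq, eLpNorm_two_sq]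
    refine (h₂ n l hn hl g hg hgc).trans ?_
    gcongr
    rw [← ENNReal.coe_pow, ← ENNReal.coe_pow, ← ENNReal.coe_mul, ← ENNReal.coe_mul,
      ← ENNReal.coe_pow, ENNReal.coe_le_coe]
    calc C₂ * τ ^ (l - n).natAbs = (NNReal.sqrt C₂ * σ ^ (l - n).natAbs) ^ 2 := by
          rw [mul_pow, NNReal.sq_sqrt, ← hσ2]; ring
      _ ≤ (NNReal.sqrt C₂ * (β ^ (l - n).natAbs * (2 * β))) ^ 2 := by
          gcongr
          exact (pow_le_pow_left' hσβ _).trans (le_mul_of_one_le_right zero_le hβ2)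
      _ = (2 * NNReal.sqrt C₂ * β ^ ((l - n).natAbs + 1)) ^ 2 := by ring
      _ ≤ (C * β ^ t) ^ 2 := by
          gcongr ?_ ^ 2
          refine mul_le_mul' le_add_self (pow_le_pow_of_le_one zero_le hβ1.le ?_)
          lia
  have hmean : ∀ n k, M ≤ n → k ≤ n → ∀ g : X → ℂ, Measurable g → BallIntegrable m g →
      eLpNorm (avgDiff m δ c n (fun x => g x - cellAvg m (c k) g x)) 2 m
        ≤ C * β ^ (n - k).natAbs * eLpNorm (fun x => g x - cellAvg m (c k) g x) 2 m := by
    intro n k hn hk g hg hgi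
    refine le_of_sq_le_sq_ennreal ?_
    rw [mul_pow, eLpNorm_two_sq, eLpNorm_two_sq]
    refine (h₁ n k hn hk g hg hgi).trans ?_
    gcongr
    exact_mod_cast (le_self_add : C₁ ≤ C)
  refine ⟨C, β, hβ1, fun f hf hf2 n hn => ⟨fun k hk => ?_, fun k hk => ?_⟩⟩
  · have hbi := G.memLp_two_ballIntegrable (by norm_num) hf2
    have hm : ∀ k, Measurable (cellAvg m (c k) f) := fun k => by
      have := G.countable k
      exact measurable_cellAvg (G.measurableSet_fibre k) f
    rcases eq_or_ne k M with rfl | hkM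
    · have e : martDiff m c k f k = fun x => f x - cellAvg m (c k) f x := by
        funext x; simp [martDiff]
      rw [e]
      exact hmean n k hn hn f hf hbi
    · by_cases hkn : k ≤ n
      · rw [funext (G.martDiff_eq_sub hbi hkM)]
        exact hmean n k hn hkn _ (hm _) (G.ballIntegrable_cellAvg hbi _)
      · refine hconst n (k - 1) hn (by lia) _ (G.measurable_martDiff hf k) (fun x y hxy => ?_) _
          (by lia)
        have hxy' : c k x = c k y := G.nested _ k (by lia) _ _ hxy
        simp only [martDiff, if_neg hkM, cellAvg, hxy, hxy']
  · have := G.countable k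
    refine (hconst n k hn hk _ (measurable_cellAvg (G.measurableSet_fibre k) f)
      (fun x y hxy => by simp only [cellAvg, hxy]) _ le_self_add).trans ?_
    gcongr
    refine le_of_sq_le_sq_ennreal ?_
    rw [eLpNorm_two_sq, eLpNorm_two_sq]
    exact G.lintegral_cellAvg_sq_le k hf

/-- The `L²` estimate for the square function over large scales. -/
theorem exists_squareOn_sq_le : ∃ C : ℝ≥0, ∀ f : X → ℂ, Measurable f → MemLp f 2 m →
    ∫⁻ x, squareOn m δ c (Ioi M) f x ^ 2 ∂m ≤ C * ∫⁻ x, ‖f x‖ₑ ^ 2 ∂m := by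
  obtain ⟨C, β, hβ, h⟩ := G.exists_avgDiff_martDiff_le
  set S : ℝ≥0 := ∑' j : ℕ, β ^ j with hS
  have hSs : ((S : ℝ≥0) : ℝ≥0∞) = ∑' j : ℕ, (β : ℝ≥0∞) ^ j := by
    rw [hS, ENNReal.coe_tsum (NNReal.summable_geometric hβ)]
    simp
  refine ⟨C ^ 2 * (2 * S) ^ 2, fun f hf hf2 => ?_⟩
  have hbi := G.memLp_two_ballIntegrable (by norm_num) hf2
  set a : ℤ → ℝ≥0∞ := (Ici M).indicator (fun k => eLpNorm (martDiff m c M f k) 2 m) with ha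
  have hn : ∀ n, M ≤ n → eLpNorm (avgDiff m δ c n f) 2 m
      ≤ C * ∑' k, (β : ℝ≥0∞) ^ (n - k).natAbs * a k := by
    intro n hn
    obtain ⟨hd, he⟩ := h f hf hf2 n hn
    have hinj : Function.Injective fun i : ℕ => M + (i : ℤ) := fun i j h => by simpa using h
    -- Stopping the expansion at generation M + j' = n + j leaves a remainder of size β^j ‖f‖₂,
    -- which vanishes as j → ∞.
    have hj : ∀ j : ℕ, eLpNorm (avgDiff m δ c n f) 2 m
        ≤ C * ∑' k, (β : ℝ≥0∞) ^ (n - k).natAbs * a k + C * β ^ j * eLpNorm f 2 m := by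
      intro j
      set j' := (n - M).natAbs + j with hj'
      refine (G.eLpNorm_avgDiff_le_sum hf hbi n j').trans (add_le_add ?_ ?_)
      · calc _ ≤ ∑ i ∈ Finset.range (j' + 1),
              C * ((β : ℝ≥0∞) ^ (n - (M + i)).natAbs * a (M + i)) := by
              refine Finset.sum_le_sum fun i _ => ?_
              rw [ha, indicator_of_mem (by simp), ← mul_assoc]
              exact hd _ (by simp)
          _ = C * ∑ i ∈ Finset.range (j' + 1),
              ((β : ℝ≥0∞) ^ (n - (M + i)).natAbs * a (M + i)) := by rw [Finset.mul_sum]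
          _ ≤ _ := by
              gcongr
              refine (ENNReal.sum_le_tsum _).trans ?_
              exact ENNReal.tsum_comp_le_tsum_of_injective hinj
                (fun k => (β : ℝ≥0∞) ^ (n - k).natAbs * a k)
      · refine (he (M + j') (by lia)).trans ?_
        have e : (n - (M + (j' : ℤ))).natAbs = j := by lia
        rw [e]
    have hlim : Filter.Tendsto (fun j : ℕ => C * ∑' k, (β : ℝ≥0∞) ^ (n - k).natAbs * a k
        + C * (β : ℝ≥0∞) ^ j * eLpNorm f 2 m) Filter.atTop
        (nhds (C * ∑' k, (β : ℝ≥0∞) ^ (n - k).natAbs * a k + C * 0 * eLpNorm f 2 m)) := by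
      refine Filter.Tendsto.const_add _ (ENNReal.Tendsto.mul_const (ENNReal.Tendsto.const_mul
        (ENNReal.tendsto_pow_atTop_nhds_zero_of_lt_one (by exact_mod_cast hβ))
        (Or.inr ENNReal.coe_ne_top)) (Or.inr hf2.2.ne))
    simpa using ge_of_tendsto' hlim hj
  have hsq : ∀ x, squareOn m δ c (Ioi M) f x ^ 2
      = ∑' n, (Ioi M).indicator (fun n => ‖avgDiff m δ c n f x‖ₑ ^ 2) n := by
    intro x
    rw [squareOn, ellTwo_sq]
    refine tsum_congr fun n => ?_
    by_cases hn : n ∈ Ioi M <;> simp [hn]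
  simp_rw [hsq]
  rw [lintegral_tsum fun n => ?_]
  · calc _ ≤ ∑' n : ℤ, (C * ∑' k, (β : ℝ≥0∞) ^ (n - k).natAbs * a k) ^ 2 := by
          refine ENNReal.tsum_le_tsum fun n => ?_
          by_cases hnM : n ∈ Ioi M
          · simp only [indicator_of_mem hnM]
            rw [← eLpNorm_two_sq]
            exact pow_le_pow_left' (hn n (le_of_lt hnM)) 2
          · simp [indicator_of_notMem hnM]
      _ = C ^ 2 * ∑' n : ℤ, (∑' k, (β : ℝ≥0∞) ^ (n - k).natAbs * a k) ^ 2 := by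
          simp_rw [mul_pow]
          rw [ENNReal.tsum_mul_left]
      _ ≤ C ^ 2 * ((2 * ∑' j : ℕ, (β : ℝ≥0∞) ^ j) ^ 2 * ∑' k, a k ^ 2) := by
          gcongr
          exact tsum_conv_sq_le (fun j => (β : ℝ≥0∞) ^ j) a
      _ ≤ C ^ 2 * ((2 * ∑' j : ℕ, (β : ℝ≥0∞) ^ j) ^ 2 * ∫⁻ x, ‖f x‖ₑ ^ 2 ∂m) := by
          gcongr
          exact G.tsum_martDiff_sq_le hf hf2
      _ = _ := by
          rw [← hSs]
          push_cast
          ring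
  · by_cases hnM : n ∈ Ioi M
    · simp only [indicator_of_mem hnM]
      exact ((G.measurable_avgDiff hf n).enorm.pow_const 2).aemeasurable
    · simp only [indicator_of_notMem hnM]
      exact aemeasurable_const

end CubeGrid

/-! ### Calderón-Zygmund stopping cubes and weak type (1,1) -/

/-- The partition into the cubes selected by the stopping generation `κ`. -/
def stopMap {X : Type*} {I : ℤ → Type*} (c : ∀ k, X → I k) (κ : X → ℤ) (x : X) : Σ k, I k :=
  ⟨κ x, c (κ x) x⟩

/-- The maximal function over balls of radius `δ ^ n`, `n > M`. -/
noncomputable def maxFun {X : Type*} [PseudoMetricSpace X] [MeasurableSpace X] (m : Measure X)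
    (δ : ℝ) (M : ℤ) (h : X → ℝ≥0∞) (x : X) : ℝ≥0∞ :=
  ⨆ n : Ioi M, (m (closedBall x (δ ^ (n : ℤ))))⁻¹ * ∫⁻ y in closedBall x (δ ^ (n : ℤ)), h y ∂m

/-- The Calderón-Zygmund stopping generation of `h` at height `γ`: `κ x` is the largest generation
whose cube through `x` has average of `h` larger than `γ`, or `M` if there is none. -/
structure IsStopping {X : Type*} [MeasurableSpace X] (m : Measure X) {I : ℤ → Type*}
    (c : ∀ k, X → I k) (M : ℤ) (h : X → ℝ≥0∞) (γ : ℝ≥0∞) (κ : X → ℤ) : Prop where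
  measurable : Measurable κ
  le : ∀ x, M ≤ κ x
  congr : ∀ x y, c (κ x) y = c (κ x) x → κ y = κ x
  avg_le : ∀ x k, κ x < k → cellLAvg m (c k) h x ≤ γ
  lt_avg : ∀ x, M < κ x → γ < cellLAvg m (c (κ x)) h x

namespace CubeGrid

variable {X : Type*} [PseudoMetricSpace X] [MeasurableSpace X] {m : Measure X}
  {I : ℤ → Type*} {c : ∀ k, X → I k} {z : ∀ k, I k → X} {δ c₀ C₀ ε K ρ : ℝ} {M : ℤ}
  (G : CubeGrid m c z δ c₀ C₀ ε K ρ M)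

include G

/-- κ is M plus the least j beyond which all averages are at most γ. It is constant on the stopping
cube because the averages over that cube and its ancestors depend only on the cube. -/
lemma exists_isStopping {h : X → ℝ≥0∞} {γ : ℝ≥0∞}
    (hlim : ∀ x, ∃ k₀, ∀ k, k₀ ≤ k → cellLAvg m (c k) h x ≤ γ) :
    ∃ κ : X → ℤ, IsStopping m c M h γ κ := by
  classical
  let P : X → ℕ → Prop := fun x j => ∀ i : ℕ, j < i → cellLAvg m (c (M + i)) h x ≤ γ
  have hP : ∀ x, ∃ j, P x j := fun x => by
    obtain ⟨k₀, hk₀⟩ := hlim x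
    exact ⟨(k₀ - M).natAbs, fun i hi => hk₀ _ (by lia)⟩
  have hmeas : ∀ k, Measurable (cellLAvg m (c k) h) := fun k => by
    have := G.countable k
    exact measurable_cellLAvg (G.measurableSet_fibre k) h
  have hcongr : ∀ k l x y, k ≤ l → c k x = c k y →
      cellLAvg m (c l) h x = cellLAvg m (c l) h y := fun k l x y hkl hxy => by
    simp only [cellLAvg, G.nested k l hkl x y hxy]
  have hlast : ∀ x, 0 < Nat.find (hP x) → γ < cellLAvg m (c (M + Nat.find (hP x))) h x := by
    intro x hx
    by_contra hcon
    refine Nat.find_min (hP x) (m := Nat.find (hP x) - 1) (by lia) fun i hi => ?_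
    rcases eq_or_lt_of_le (show Nat.find (hP x) ≤ i by lia) with h' | h'
    · rw [← h']; exact not_lt.1 hcon
    · exact Nat.find_spec (hP x) i h'
  refine ⟨fun x => M + Nat.find (hP x), ?_, fun x => by simp, fun x y hxy => ?_,
    fun x k hk => ?_, fun x hx => hlast x (by simpa using hx)⟩
  · have h1 : Measurable fun x => Nat.find (hP x) := by
      refine measurable_find hP fun j => ?_
      simp only [P, ofPred_forall]
      exact MeasurableSet.iInter fun i => MeasurableSet.iInter fun _ =>
        measurableSet_le (hmeas _) measurable_const
    exact (measurable_of_countable fun j : ℕ => M + (j : ℤ)).comp h1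
  · have hle : Nat.find (hP y) ≤ Nat.find (hP x) := by
      refine Nat.find_min' (hP y) fun i hi => ?_
      rw [hcongr _ (M + i) y x (by lia) hxy]
      exact Nat.find_spec (hP x) i hi
    have hge : ¬ Nat.find (hP y) < Nat.find (hP x) := fun hlt => by
      refine absurd (hlast x (by lia)) (not_lt.2 ?_)
      rw [← hcongr _ (M + (Nat.find (hP x) : ℤ)) y x le_rfl hxy]
      exact Nat.find_spec (hP y) _ hlt
    lia
  · have e : M + (((k - M).natAbs : ℕ) : ℤ) = k := by lia
    have := Nat.find_spec (hP x) (k - M).natAbs (by lia)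
    rwa [show cellLAvg m (c (M + (((k - M).natAbs : ℕ) : ℤ))) h x = cellLAvg m (c k) h x from
      congrArg (fun k => cellLAvg m (c k) h x) e] at this

/-- If large averages occur at arbitrarily large scales then the whole space is small. -/
lemma exists_measure_univ_le : ∃ C : ℝ≥0, ∀ (h : X → ℝ≥0∞) (γ : ℝ≥0∞), γ ≠ 0 → γ ≠ ∞ → ∀ x,
    (∀ k₀, ∃ k, k₀ ≤ k ∧ γ < cellLAvg m (c k) h x) → m univ ≤ C * (γ⁻¹ * ∫⁻ y, h y ∂m) := by
  obtain ⟨C, hC⟩ := G.exists_cell_comparison 1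
  refine ⟨C, fun h γ hγ hγ' x hx => ?_⟩
  rw [← Metric.iUnion_closedBall_nat x, Monotone.measure_iUnion fun i j hij =>
    Metric.closedBall_subset_closedBall (by exact_mod_cast hij)]
  refine iSup_le fun R => ?_
  obtain ⟨j, hj⟩ := pow_unbounded_of_one_lt (R : ℝ) G.one_lt
  obtain ⟨k, hk, hγk⟩ := hx (max M j)
  have hkM : M ≤ k := (le_max_left _ _).trans hk
  have hkj : (j : ℤ) ≤ k := (le_max_right _ _).trans hk
  have hRk : (R : ℝ) ≤ 1 * δ ^ k := by
    rw [one_mul]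
    refine hj.le.trans ?_
    rw [← zpow_natCast]
    exact G.zpow_mono hkj
  refine (hC k hkM x x (by rw [dist_self, one_mul]; exact (G.zpow_pos k).le) _ hRk).trans ?_
  gcongr
  have h1 := G.pos_cell hkM x
  have h2 := G.finite_cell k (c k x)
  rw [mul_comm γ⁻¹, ← div_eq_mul_inv, ENNReal.le_div_iff_mul_le (Or.inl hγ) (Or.inl hγ'), mul_comm]
  calc γ * m (c k ⁻¹' {c k x}) ≤ cellLAvg m (c k) h x * m (c k ⁻¹' {c k x}) := by gcongr
    _ = ∫⁻ y in c k ⁻¹' {c k x}, h y ∂m := by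
        rw [cellLAvg, mul_comm, ← mul_assoc, ENNReal.mul_inv_cancel h1 h2, one_mul]
    _ ≤ _ := setLIntegral_le_lintegral _ _

section Stopping

variable {h : X → ℝ≥0∞} {γ : ℝ≥0∞} {κ : X → ℤ} (hκ : IsStopping m c M h γ κ)

include hκ

omit G in
omit [PseudoMetricSpace X] in
lemma stopMap_eq_iff {x y : X} : stopMap c κ y = stopMap c κ x ↔ c (κ x) y = c (κ x) x := by
  constructor
  · intro he
    have h1 : κ y = κ x := congrArg Sigma.fst he
    simp only [stopMap] at he
    rw [h1] at he
    exact eq_of_heq (Sigma.mk.inj he).2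
  · intro he
    have h1 := hκ.congr x y he
    simp only [stopMap]
    rw [h1, he]

omit G in
omit [PseudoMetricSpace X] in
lemma stopMap_fibre (x : X) : stopMap c κ ⁻¹' {stopMap c κ x} = c (κ x) ⁻¹' {c (κ x) x} := by
  ext y
  exact stopMap_eq_iff hκ

lemma measurableSet_stopMap_fibre (i : Σ k, I k) : MeasurableSet (stopMap c κ ⁻¹' {i}) := by
  by_cases hi : i ∈ range (stopMap c κ)
  · obtain ⟨x, rfl⟩ := hi
    rw [stopMap_fibre hκ]
    exact G.measurableSet_fibre _ _
  · have : stopMap c κ ⁻¹' {i} = ∅ := by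
      ext y
      simp only [mem_preimage, mem_singleton_iff, mem_empty_iff_false, iff_false]
      exact fun h => hi ⟨y, h⟩
    rw [this]
    exact MeasurableSet.empty

lemma finite_stopMap_fibre (i : Σ k, I k) : m (stopMap c κ ⁻¹' {i}) ≠ ∞ := by
  by_cases hi : i ∈ range (stopMap c κ)
  · obtain ⟨x, rfl⟩ := hi
    rw [stopMap_fibre hκ]
    exact G.finite_cell _ _
  · have : stopMap c κ ⁻¹' {i} = ∅ := by
      ext y
      simp only [mem_preimage, mem_singleton_iff, mem_empty_iff_false, iff_false]
      exact fun h => hi ⟨y, h⟩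
    simp [this]

omit G in
omit [PseudoMetricSpace X] in
lemma cellLAvg_stopMap (u : X → ℝ≥0∞) (x : X) :
    cellLAvg m (stopMap c κ) u x = cellLAvg m (c (κ x)) u x := by
  simp only [cellLAvg, stopMap_fibre hκ]

end Stopping

lemma countable_sigma : Countable (Σ k, I k) := by
  have := G.countable
  infer_instance

/-- The parent of a stopping cube has average at most γ by maximality, and its measure is comparable
to that of the child. This also covers κ x = M, where no cube through x was selected. -/
lemma exists_cellLAvg_stopMap_le : ∃ A : ℝ≥0, 1 ≤ A ∧ ∀ (h : X → ℝ≥0∞) (γ : ℝ≥0∞) (κ : X → ℤ),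
    IsStopping m c M h γ κ → ∀ x, cellLAvg m (stopMap c κ) h x ≤ A * γ := by
  obtain ⟨A, hA⟩ := G.exists_cell_comparison (4 * C₀ * δ)
  refine ⟨A + 1, by simp, fun h γ κ hκ x => ?_⟩
  rw [cellLAvg_stopMap hκ]
  set k := κ x with hk
  have hkM : M ≤ k := hκ.le x
  have h1 := hκ.avg_le x (k + 1) (by lia)
  have hp := G.pos_cell hkM x
  have hf := G.finite_cell k (c k x)
  have hp' := G.pos_cell (show M ≤ k + 1 by lia) x
  have hf' := G.finite_cell (k + 1) (c (k + 1) x)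
  have hsub : c k ⁻¹' {c k x} ⊆ c (k + 1) ⁻¹' {c (k + 1) x} := fun y hy =>
    G.nested k (k + 1) (by lia) y x hy
  have hmeas : m (c (k + 1) ⁻¹' {c (k + 1) x}) ≤ A * m (c k ⁻¹' {c k x}) := by
    refine (measure_mono (G.cell_subset_ball (k + 1) x)).trans (hA k hkM x x ?_ _ (le_of_eq ?_))
    · have := G.C₀_pos
      have := G.δ_pos
      have := G.zpow_pos k
      rw [dist_self]
      positivity
    · rw [zpow_add_one₀ G.δ_pos.ne']; ring
  have hint : ∫⁻ y in c (k + 1) ⁻¹' {c (k + 1) x}, h y ∂m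
      ≤ γ * m (c (k + 1) ⁻¹' {c (k + 1) x}) := by
    calc _ = cellLAvg m (c (k + 1)) h x * m (c (k + 1) ⁻¹' {c (k + 1) x}) := by
          rw [cellLAvg, mul_comm, ← mul_assoc, ENNReal.mul_inv_cancel hp' hf', one_mul]
      _ ≤ _ := by gcongr
  calc cellLAvg m (c k) h x
      ≤ (m (c k ⁻¹' {c k x}))⁻¹ * ∫⁻ y in c (k + 1) ⁻¹' {c (k + 1) x}, h y ∂m := by
        rw [cellLAvg]
        gcongr
    _ ≤ (m (c k ⁻¹' {c k x}))⁻¹ * (γ * (A * m (c k ⁻¹' {c k x}))) := by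
        gcongr
        exact hint.trans (by gcongr)
    _ = A * γ * ((m (c k ⁻¹' {c k x}))⁻¹ * m (c k ⁻¹' {c k x})) := by ring
    _ = A * γ := by rw [ENNReal.inv_mul_cancel hp hf, mul_one]
    _ ≤ _ := by gcongr; exact_mod_cast le_self_add

/-- The exceptional set of the Calderón-Zygmund decomposition. -/
lemma exists_exceptional_set : ∃ C : ℝ≥0, ∀ (h : X → ℝ≥0∞) (γ : ℝ≥0∞) (κ : X → ℤ),
    γ ≠ 0 → γ ≠ ∞ → IsStopping m c M h γ κ → ∃ S : Set X, MeasurableSet S ∧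
      m S ≤ C * (γ⁻¹ * ∫⁻ y, h y ∂m) ∧
      ∀ x, x ∉ S → ∀ y, M < κ y → δ ^ κ y < dist x y := by
  have hC0 := G.C₀_pos
  obtain ⟨C, hC⟩ := G.exists_cell_comparison (1 + 4 * C₀)
  refine ⟨C, fun h γ κ hγ hγ' hκ => ?_⟩
  have := G.countable_sigma
  have hfm := G.measurableSet_stopMap_fibre hκ
  set s : Set (Σ k, I k) := stopMap c κ '' {y | M < κ y} with hs
  have hss : ∀ y, y ∈ stopMap c κ ⁻¹' s → M < κ y := by
    rintro y ⟨w, hw, hwy⟩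
    have h2 : κ w = κ y := congrArg Sigma.fst hwy
    exact h2 ▸ hw
  have hss' : ∀ y, M < κ y → y ∈ stopMap c κ ⁻¹' s := fun y hy => ⟨y, hy, rfl⟩
  -- Dilates of the selected cubes. The averages of `h` on those cubes exceed γ, so their total
  -- measure is at most γ⁻¹ ∫ h, and the dilation costs only a doubling constant.
  refine ⟨⋃ i ∈ s, closedBall (z i.1 i.2) ((1 + 4 * C₀) * δ ^ i.1),
    MeasurableSet.biUnion (to_countable s) fun i _ => G.measurableSet_closedBall _ _, ?_, ?_⟩
  · have hm : m (stopMap c κ ⁻¹' s) ≤ γ⁻¹ * ∫⁻ y, h y ∂m := by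
      rw [mul_comm γ⁻¹, ← div_eq_mul_inv, ENNReal.le_div_iff_mul_le (Or.inl hγ) (Or.inl hγ'), mul_comm]
      calc γ * m (stopMap c κ ⁻¹' s) = ∫⁻ _ in stopMap c κ ⁻¹' s, γ ∂m := by simp
        _ ≤ ∫⁻ y in stopMap c κ ⁻¹' s, cellLAvg m (stopMap c κ) h y ∂m := by
            refine setLIntegral_mono' (measurableSet_saturated hfm s) fun y hy => ?_
            rw [cellLAvg_stopMap hκ]
            exact (hκ.lt_avg y (hss y hy)).le
        _ = ∫⁻ y in stopMap c κ ⁻¹' s, h y ∂m :=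
            lintegral_cellLAvg hfm (G.finite_stopMap_fibre hκ) s h
        _ ≤ _ := setLIntegral_le_lintegral _ _
    have hm2 : m (stopMap c κ ⁻¹' s) = ∑' i : s, m (stopMap c κ ⁻¹' {(i : Σ k, I k)}) := by
      simpa using lintegral_saturated (m := m) hfm s (fun _ => 1)
    calc _ ≤ ∑' i : s, m (closedBall (z (i : Σ k, I k).1 (i : Σ k, I k).2)
            ((1 + 4 * C₀) * δ ^ (i : Σ k, I k).1)) := measure_biUnion_le m (to_countable s) _
      _ ≤ ∑' i : s, C * m (stopMap c κ ⁻¹' {(i : Σ k, I k)}) := by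
          refine ENNReal.tsum_le_tsum ?_
          rintro ⟨_, y, hy, rfl⟩
          simp only [stopMap_fibre hκ y]
          have hyp := G.zpow_pos (κ y)
          refine hC (κ y) (hκ.le y) y _ ?_ _ le_rfl
          refine (G.dist_centre _ _).trans ?_
          simp only [stopMap]
          nlinarith [mul_pos hC0 hyp]
      _ = C * m (stopMap c κ ⁻¹' s) := by rw [ENNReal.tsum_mul_left, hm2]
      _ ≤ _ := by gcongr
  · intro x hx y hy
    by_contra hcon
    push Not at hcon
    refine hx (mem_iUnion₂.2 ⟨stopMap c κ y, hss' y hy, ?_⟩)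
    rw [mem_closedBall]
    have h1 := G.dist_centre (κ y) y
    have h2 := dist_triangle x y (z (κ y) (c (κ y) y))
    simp only [stopMap]
    nlinarith [mul_pos hC0 (G.zpow_pos (κ y))]

lemma dist_le_of_stopMap_eq {h : X → ℝ≥0∞} {γ : ℝ≥0∞} {κ : X → ℤ}
    (hκ : IsStopping m c M h γ κ) (y y' : X) (hy : stopMap c κ y = stopMap c κ y') :
    dist y y' ≤ 4 * C₀ * δ ^ κ y :=
  G.dist_le_of_eq ((stopMap_eq_iff hκ).1 hy.symm).symm

lemma κ_le_of_dist_le {κ : X → ℤ} {S : Set X}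
    (hS : ∀ x, x ∉ S → ∀ y, M < κ y → δ ^ κ y < dist x y) {x y : X} (hx : x ∉ S) {n : ℤ}
    (hn : M ≤ n) (hy : dist y x ≤ δ ^ n) : κ y ≤ n := by
  by_contra hcon
  push Not at hcon
  have h1 := hS x hx y (by lia)
  rw [dist_comm] at h1
  have h2 : δ ^ n ≤ δ ^ κ y := G.zpow_mono hcon.le
  linarith

/-- The weak type `(1, 1)` estimate for the maximal function. -/
lemma exists_maxFun_weak : ∃ A C : ℝ≥0, 1 ≤ A ∧ ∀ (h : X → ℝ≥0∞) (γ : ℝ≥0∞), γ ≠ 0 → γ ≠ ∞ →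
    m {x | A * γ < maxFun m δ M h x} ≤ C * (γ⁻¹ * ∫⁻ y, h y ∂m) := by
  have hC0 := G.C₀_pos
  obtain ⟨C₁, h₁⟩ := G.exists_measure_univ_le
  obtain ⟨C₂, h₂⟩ := G.exists_exceptional_set
  obtain ⟨A, hA1, hA⟩ := G.exists_cellLAvg_stopMap_le
  obtain ⟨D, hD⟩ := G.exists_ball_comparison (1 + 4 * C₀)
  refine ⟨A * D + 1, C₁ + C₂, by simp, fun h γ hγ hγ' => ?_⟩
  have := G.countable_sigma
  push_cast
  -- If this fails no stopping generation exists, but then the bound already holds for the measure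
  -- of the whole space.
  by_cases hlim : ∀ x, ∃ k₀, ∀ k, k₀ ≤ k → cellLAvg m (c k) h x ≤ γ
  swap
  · push Not at hlim
    obtain ⟨x, hx⟩ := hlim
    exact (measure_mono (subset_univ _)).trans ((h₁ h γ hγ hγ' x hx).trans
      (mul_le_mul_left le_self_add _))
  obtain ⟨κ, hκ⟩ := G.exists_isStopping hlim
  obtain ⟨S, hSm, hS, hSκ⟩ := h₂ h γ κ hγ hγ' hκ
  have hfm := G.measurableSet_stopMap_fibre hκ
  refine (measure_mono fun x hx => ?_).trans (hS.trans (mul_le_mul_left le_add_self _))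
  by_contra hxS
  refine absurd (mem_ofPred_eq ▸ hx) (not_lt.2 (iSup_le fun n => ?_))
  obtain ⟨n, hn⟩ := n
  have hnM : M ≤ n := le_of_lt hn
  simp only
  set B := closedBall x (δ ^ n) with hB
  set s := stopMap c κ '' B with hs
  have hsat : stopMap c κ ⁻¹' s ⊆ closedBall x ((1 + 4 * C₀) * δ ^ n) := by
    rintro y ⟨w, hw, hwy⟩
    rw [hB, mem_closedBall] at hw
    have hκw := G.κ_le_of_dist_le hSκ hxS hnM hw
    have hd := G.dist_le_of_stopMap_eq hκ w y hwy
    have hz := G.zpow_mono hκw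
    have := dist_triangle_left y x w
    rw [mem_closedBall]
    nlinarith
  have hpB := G.pos_ball x _ (G.ρ_le hnM)
  have hfB := G.finite_ball x (δ ^ n)
  -- The ball is enlarged to the union of the stopping cubes it meets. Off the exceptional set these
  -- have generation at most n, so the union stays in a fixed dilate, and on it `h` may be replaced
  -- by its stopping averages, which are at most Aγ.
  calc (m B)⁻¹ * ∫⁻ y in B, h y ∂m ≤ (m B)⁻¹ * ∫⁻ y in stopMap c κ ⁻¹' s, h y ∂m := by
        gcongr
        exact subset_preimage_image _ _
    _ = (m B)⁻¹ * ∫⁻ y in stopMap c κ ⁻¹' s, cellLAvg m (stopMap c κ) h y ∂m := by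
        rw [lintegral_cellLAvg hfm (G.finite_stopMap_fibre hκ) s h]
    _ ≤ (m B)⁻¹ * ∫⁻ _ in stopMap c κ ⁻¹' s, A * γ ∂m := by
        gcongr with y
        exact hA h γ κ hκ y
    _ ≤ (m B)⁻¹ * (A * γ * (D * m B)) := by
        rw [setLIntegral_const]
        gcongr
        refine (measure_mono hsat).trans (hD x x _ _ (G.ρ_le hnM) ?_ le_rfl)
        have := G.zpow_pos n
        rw [dist_self]
        positivity
    _ = A * D * γ * ((m B)⁻¹ * m B) := by ring
    _ = A * D * γ := by rw [ENNReal.inv_mul_cancel hpB hfB, mul_one]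
    _ ≤ _ := by gcongr; exact le_self_add

lemma measurable_annulusKernel_stopping {κ : X → ℤ} (hκ : Measurable κ) (n : ℤ) :
    Measurable fun p : X × X => annulusKernel m δ C₀ n (κ p.2) p.1 p.2 := by
  have hpow : Measurable fun p : X × X => 4 * C₀ * δ ^ κ p.2 :=
    (measurable_of_countable fun k : ℤ => 4 * C₀ * δ ^ k).comp (hκ.comp measurable_snd)
  exact Measurable.indicator (s := {p : X × X | δ ^ n - 4 * C₀ * δ ^ κ p.2 < dist p.1 p.2 ∧
      dist p.1 p.2 ≤ δ ^ n + 4 * C₀ * δ ^ κ p.2})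
    ((G.measurable_measure_ball _).inv.comp measurable_fst)
    ((measurableSet_lt (measurable_const.sub hpow) G.measurable_dist).inter
      (measurableSet_le G.measurable_dist (measurable_const.add hpow)))

/-- The bad part of the Calderón-Zygmund decomposition, away from the exceptional set. -/
lemma exists_bad_part_le : ∃ C : ℝ≥0, ∀ (h : X → ℝ≥0∞) (γ : ℝ≥0∞) (κ : X → ℤ),
    IsStopping m c M h γ κ → ∀ S : Set X, MeasurableSet S →
      (∀ x, x ∉ S → ∀ y, M < κ y → δ ^ κ y < dist x y) → ∀ f : X → ℂ, Measurable f →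
      Integrable f m →
      ∫⁻ x in Sᶜ, squareOn m δ c (Ioi M) (fun y => f y - cellAvg m (stopMap c κ) f y) x ∂m
        ≤ C * ∫⁻ y, ‖f y‖ₑ ∂m := by
  obtain ⟨C, hC⟩ := G.exists_annulusKernel_le
  have hθ := G.decayRate_lt_one
  set θ := decayRate δ ε with hθdef
  set T : ℝ≥0 := ∑' j : ℕ, θ ^ j with hT
  have hTs : ((T : ℝ≥0) : ℝ≥0∞) = ∑' j : ℕ, (θ : ℝ≥0∞) ^ j := by
    rw [hT, ENNReal.coe_tsum (NNReal.summable_geometric hθ)]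
    simp
  refine ⟨C * (2 * T) * 2, fun h γ κ hκ S hSm hS f hf hfi => ?_⟩
  have := G.sigmaFinite
  have := G.countable_sigma
  have hfm := G.measurableSet_stopMap_fibre hκ
  have hff := G.finite_stopMap_fibre hκ
  have hbi : BallIntegrable m f := fun _ _ => hfi.integrableOn
  set b : X → ℂ := fun y => f y - cellAvg m (stopMap c κ) f y with hb
  have hbm : Measurable b := hf.sub (measurable_cellAvg hfm f)
  have hb1 : ∫⁻ y, ‖b y‖ₑ ∂m ≤ 2 * ∫⁻ y, ‖f y‖ₑ ∂m := by
    calc ∫⁻ y, ‖b y‖ₑ ∂m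
        ≤ ∫⁻ y, (‖f y‖ₑ + cellLAvg m (stopMap c κ) (fun y => ‖f y‖ₑ) y) ∂m :=
          lintegral_mono fun y => enorm_sub_le.trans (by gcongr; exact enorm_cellAvg_le f y)
      _ = ∫⁻ y, ‖f y‖ₑ ∂m + ∫⁻ y, ‖f y‖ₑ ∂m := by
          rw [lintegral_add_left hf.enorm]
          congr 1
          simpa using lintegral_cellLAvg hfm hff univ (fun y => ‖f y‖ₑ)
      _ = _ := by ring
  have hW : ∀ n : ℤ, MeasurableSet {y | κ y ≤ n} := fun n =>
    hκ.measurable (measurableSet_Iic (a := n))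
  have hpt : ∀ n ∈ Ioi M, ∀ x ∈ Sᶜ, ‖avgDiff m δ c n b x‖ₑ
      ≤ ∫⁻ y, annulusKernel m δ C₀ n (κ y) x y
        * {y | κ y ≤ n}.indicator (fun y => ‖b y‖ₑ) y ∂m := by
    intro n hn x hx
    have hnM : M ≤ n := le_of_lt hn
    -- Were some stopping cube larger than the cube of generation n through x, it would contain x,
    -- which would then lie in a selected cube, contrary to x ∉ S. So the cube of generation n is a
    -- union of stopping cubes.
    have h0 : cellAvg m (c n) b x = 0 := by
      refine G.cellAvg_sub_cellAvg_eq_zero hfm hff hbi fun y y' hy hyy' => ?_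
      have hκy : κ y ≤ n := by
        by_contra hcon
        push Not at hcon
        have hxy : c (κ y) x = c (κ y) y := (G.nested n (κ y) hcon.le _ _ hy).symm
        have hκx := hκ.congr y x hxy
        have := hS x hx x (by lia)
        rw [dist_self] at this
        exact absurd this (not_lt.2 (G.zpow_pos _).le)
      exact (G.nested _ n hκy _ _ ((stopMap_eq_iff hκ).1 hyy'.symm)).trans hy
    rw [avgDiff, h0, sub_zero]
    exact G.enorm_ballMean_sub_cellAvg_le hfm hff (fun y y' => G.dist_le_of_stopMap_eq hκ y y')
      hbi (G.ρ_le hnM) x fun y y' hy _ _ => G.κ_le_of_dist_le hS hx hnM hy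
  have hn : ∀ n ∈ Ioi M, ∫⁻ x in Sᶜ, ‖avgDiff m δ c n b x‖ₑ ∂m
      ≤ ∫⁻ y, C * (θ : ℝ≥0∞) ^ (n - κ y).natAbs * ‖b y‖ₑ ∂m := by
    intro n hn
    have hnM : M ≤ n := le_of_lt hn
    calc _ ≤ ∫⁻ x in Sᶜ, ∫⁻ y, annulusKernel m δ C₀ n (κ y) x y
          * {y | κ y ≤ n}.indicator (fun y => ‖b y‖ₑ) y ∂m ∂m :=
          setLIntegral_mono' hSm.compl fun x hx => hpt n hn x hx
      _ ≤ ∫⁻ x, ∫⁻ y, annulusKernel m δ C₀ n (κ y) x y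
          * {y | κ y ≤ n}.indicator (fun y => ‖b y‖ₑ) y ∂m ∂m := setLIntegral_le_lintegral _ _
      _ = ∫⁻ y, ∫⁻ x, annulusKernel m δ C₀ n (κ y) x y
          * {y | κ y ≤ n}.indicator (fun y => ‖b y‖ₑ) y ∂m ∂m :=
          lintegral_lintegral_swap ((G.measurable_annulusKernel_stopping hκ.measurable n).mul
            ((hbm.enorm.indicator (hW n)).comp measurable_snd)).aemeasurable
      _ ≤ _ := by
          refine lintegral_mono fun y => ?_
          have hk : Measurable fun x => annulusKernel m δ C₀ n (κ y) x y :=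
            (G.measurable_annulusKernel n (κ y)).comp measurable_prodMk_right
          rw [lintegral_mul_const _ hk]
          by_cases hy : κ y ≤ n
          · rw [indicator_of_mem (by exact hy)]
            gcongr
            exact (hC n (κ y) hnM hy).2 y
          · rw [indicator_of_notMem (by exact hy), mul_zero]
            exact zero_le
  -- Passing from ℓ² to ℓ¹ is harmless: after Tonelli each point y contributes a geometric series in
  -- |n - κ y|.
  calc _ ≤ ∫⁻ x in Sᶜ, ∑' n : ℤ, (Ioi M).indicator (fun n => ‖avgDiff m δ c n b x‖ₑ) n ∂m :=
        lintegral_mono fun x => ellTwo_le_tsum _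
    _ = ∑' n : ℤ, ∫⁻ x in Sᶜ, (Ioi M).indicator (fun n => ‖avgDiff m δ c n b x‖ₑ) n ∂m := by
        refine lintegral_tsum fun n => ?_
        by_cases hn : n ∈ Ioi M
        · simp only [indicator_of_mem hn]
          exact (G.measurable_avgDiff hbm n).enorm.aemeasurable
        · simp only [indicator_of_notMem hn]
          exact aemeasurable_const
    _ ≤ ∑' n : ℤ, ∫⁻ y, C * (θ : ℝ≥0∞) ^ (n - κ y).natAbs * ‖b y‖ₑ ∂m := by
        refine ENNReal.tsum_le_tsum fun n => ?_
        by_cases hnM : n ∈ Ioi M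
        · simp only [indicator_of_mem hnM]
          exact hn n hnM
        · simp [indicator_of_notMem hnM]
    _ = ∫⁻ y, ∑' n : ℤ, C * (θ : ℝ≥0∞) ^ (n - κ y).natAbs * ‖b y‖ₑ ∂m := by
        refine (lintegral_tsum fun n => ?_).symm
        exact (((measurable_of_countable fun k : ℤ => (C : ℝ≥0∞) * (θ : ℝ≥0∞) ^ (n - k).natAbs).comp
          hκ.measurable).mul hbm.enorm).aemeasurable
    _ ≤ ∫⁻ y, C * (2 * T) * ‖b y‖ₑ ∂m := by
        refine lintegral_mono fun y => ?_
        rw [ENNReal.tsum_mul_right, ENNReal.tsum_mul_left]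
        gcongr
        rw [hTs]
        exact tsum_natAbs_sub_le (fun j => (θ : ℝ≥0∞) ^ j) (κ y)
    _ = C * (2 * T) * ∫⁻ y, ‖b y‖ₑ ∂m := lintegral_const_mul _ hbm.enorm
    _ ≤ C * (2 * T) * (2 * ∫⁻ y, ‖f y‖ₑ ∂m) := by gcongr
    _ = _ := by push_cast; ring

/-- The weak type `(1, 1)` estimate for the square function over large scales. -/
theorem exists_squareOn_weak : ∃ C : ℝ≥0, ∀ f : X → ℂ, Measurable f → Integrable f m →
    ∀ γ : ℝ≥0∞, γ ≠ 0 → γ ≠ ∞ →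
      m {x | 2 * γ < squareOn m δ c (Ioi M) f x} ≤ C * (γ⁻¹ * ∫⁻ y, ‖f y‖ₑ ∂m) := by
  obtain ⟨C₁, h₁⟩ := G.exists_measure_univ_le
  obtain ⟨C₂, h₂⟩ := G.exists_exceptional_set
  obtain ⟨C₃, h₃⟩ := G.exists_bad_part_le
  obtain ⟨C₄, h₄⟩ := G.exists_squareOn_sq_le
  obtain ⟨A, hA1, hA⟩ := G.exists_cellLAvg_stopMap_le
  refine ⟨C₁ + (C₄ * A + (C₂ + C₃)), fun f hf hfi γ hγ hγ' => ?_⟩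
  have := G.countable_sigma
  set h : X → ℝ≥0∞ := fun y => ‖f y‖ₑ with hh
  have hhi : ∫⁻ y, h y ∂m ≠ ∞ := hfi.2.ne
  by_cases hlim : ∀ x, ∃ k₀, ∀ k, k₀ ≤ k → cellLAvg m (c k) h x ≤ γ
  swap
  · push Not at hlim
    obtain ⟨x, hx⟩ := hlim
    refine (measure_mono (subset_univ _)).trans ((h₁ h γ hγ hγ' x hx).trans ?_)
    gcongr
    exact_mod_cast le_self_add
  obtain ⟨κ, hκ⟩ := G.exists_isStopping hlim
  obtain ⟨S, hSm, hS, hSκ⟩ := h₂ h γ κ hγ hγ' hκ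
  have hfm := G.measurableSet_stopMap_fibre hκ
  have hff := G.finite_stopMap_fibre hκ
  set g := cellAvg m (stopMap c κ) f with hg
  have hgm : Measurable g := measurable_cellAvg hfm f
  have hgle : ∀ x, ‖g x‖ₑ ≤ cellLAvg m (stopMap c κ) h x := enorm_cellAvg_le f
  -- One factor |g| is bounded by Aγ; the other is averaged, which preserves the L¹ norm of `h`.
  have hg2 : ∫⁻ x, ‖g x‖ₑ ^ 2 ∂m ≤ A * γ * ∫⁻ y, h y ∂m := by
    calc ∫⁻ x, ‖g x‖ₑ ^ 2 ∂m ≤ ∫⁻ x, A * γ * cellLAvg m (stopMap c κ) h x ∂m := by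
          refine lintegral_mono fun x => ?_
          rw [sq]
          exact mul_le_mul' ((hgle x).trans (hA h γ κ hκ x)) (hgle x)
      _ = A * γ * ∫⁻ x, cellLAvg m (stopMap c κ) h x ∂m :=
          lintegral_const_mul _ (measurable_cellLAvg hfm h)
      _ = _ := by
          congr 1
          simpa using lintegral_cellLAvg hfm hff univ h
  have hgL2 : MemLp g 2 m := by
    refine ⟨hgm.aestronglyMeasurable, ?_⟩
    have : eLpNorm g 2 m ^ 2 < ∞ := by
      rw [eLpNorm_two_sq]
      exact hg2.trans_lt (ENNReal.mul_lt_top (ENNReal.mul_lt_top ENNReal.coe_lt_top hγ'.lt_top)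
        hhi.lt_top)
    by_contra hcon
    rw [not_lt, top_le_iff] at hcon
    simp [hcon] at this
  have hgi : BallIntegrable m g := G.memLp_two_ballIntegrable (by norm_num) hgL2
  set b : X → ℂ := fun y => f y - g y with hb
  have hbm : Measurable b := hf.sub hgm
  have hbi : BallIntegrable m b := BallIntegrable.sub (fun _ _ => hfi.integrableOn) hgi
  have hle : ∀ x, squareOn m δ c (Ioi M) f x
      ≤ squareOn m δ c (Ioi M) g x + squareOn m δ c (Ioi M) b x := by
    intro x
    have := G.squareOn_add_le hgi hbi (Ioi M) x
    simpa [hb] using this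
  have hSg : m {x | γ < squareOn m δ c (Ioi M) g x} ≤ C₄ * A * (γ⁻¹ * ∫⁻ y, h y ∂m) := by
    have hmk := mul_meas_ge_le_lintegral (μ := m)
      ((G.measurable_squareOn hgm (Ioi M)).pow_const 2) (γ ^ 2)
    have h5 : γ ^ 2 * m {x | γ < squareOn m δ c (Ioi M) g x}
        ≤ C₄ * (A * γ * ∫⁻ y, h y ∂m) := by
      calc _ ≤ γ ^ 2 * m {x | γ ^ 2 ≤ squareOn m δ c (Ioi M) g x ^ 2} := by
            gcongr with x
            intro hx
            exact pow_le_pow_left' (le_of_lt hx) 2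
        _ ≤ C₄ * ∫⁻ x, ‖g x‖ₑ ^ 2 ∂m := hmk.trans (h₄ g hgm hgL2)
        _ ≤ _ := by gcongr
    have hγ2 : (γ⁻¹) ^ 2 * γ ^ 2 = 1 := by
      rw [← mul_pow, ENNReal.inv_mul_cancel hγ hγ', one_pow]
    calc m {x | γ < squareOn m δ c (Ioi M) g x}
        = (γ⁻¹) ^ 2 * (γ ^ 2 * m {x | γ < squareOn m δ c (Ioi M) g x}) := by
          rw [← mul_assoc, hγ2, one_mul]
      _ ≤ (γ⁻¹) ^ 2 * (C₄ * (A * γ * ∫⁻ y, h y ∂m)) := by gcongr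
      _ = C₄ * A * ((γ⁻¹ * γ) * γ⁻¹ * ∫⁻ y, h y ∂m) := by ring
      _ = _ := by rw [ENNReal.inv_mul_cancel hγ hγ', one_mul]
  have hSb : m {x | γ < squareOn m δ c (Ioi M) b x} ≤ (C₂ + C₃) * (γ⁻¹ * ∫⁻ y, h y ∂m) := by
    have hmk := mul_meas_ge_le_lintegral (μ := m.restrict Sᶜ)
      (G.measurable_squareOn hbm (Ioi M)) γ
    have hsub : {x | γ < squareOn m δ c (Ioi M) b x}
        ⊆ S ∪ ({x | γ ≤ squareOn m δ c (Ioi M) b x} ∩ Sᶜ) := by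
      intro x hx
      by_cases hxS : x ∈ S
      · exact Or.inl hxS
      · rw [mem_ofPred_eq] at hx
        exact Or.inr ⟨hx.le, hxS⟩
    refine (measure_mono hsub).trans ((measure_union_le _ _).trans ?_)
    rw [add_mul]
    refine add_le_add hS ?_
    rw [← Measure.restrict_apply' hSm.compl]
    have h6 := hmk.trans (h₃ h γ κ hκ S hSm hSκ f hf hfi)
    calc _ = γ⁻¹ * (γ * m.restrict Sᶜ {x | γ ≤ squareOn m δ c (Ioi M) b x}) := by
          rw [← mul_assoc, ENNReal.inv_mul_cancel hγ hγ', one_mul]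
      _ ≤ γ⁻¹ * (C₃ * ∫⁻ y, h y ∂m) := by gcongr
      _ = _ := by ring
  have hsub : {x | 2 * γ < squareOn m δ c (Ioi M) f x}
      ⊆ {x | γ < squareOn m δ c (Ioi M) g x} ∪ {x | γ < squareOn m δ c (Ioi M) b x} := by
    intro x hx
    by_contra hcon
    simp only [mem_union, mem_ofPred_eq, not_or, not_lt] at hcon hx
    refine absurd hx (not_lt.2 ((hle x).trans ?_))
    rw [two_mul]
    exact add_le_add hcon.1 hcon.2
  calc _ ≤ C₄ * A * (γ⁻¹ * ∫⁻ y, h y ∂m) + (C₂ + C₃) * (γ⁻¹ * ∫⁻ y, h y ∂m) :=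
        (measure_mono hsub).trans ((measure_union_le _ _).trans (add_le_add hSg hSb))
    _ = (C₄ * A + (C₂ + C₃)) * (γ⁻¹ * ∫⁻ y, h y ∂m) := by ring
    _ ≤ _ := by
        push_cast
        exact mul_le_mul_left le_add_self _

end CubeGrid

/-! ### The quadratic maximal function and the regularity of ball averages -/

lemma ennreal_inv_le_of_le_mul {a b C : ℝ≥0∞} (h : b ≤ C * a) (hb : b ≠ 0) (hb' : b ≠ ∞)
    (ha : a ≠ 0) (ha' : a ≠ ∞) : a⁻¹ ≤ C * b⁻¹ := by
  calc a⁻¹ = a⁻¹ * (b * b⁻¹) := by rw [ENNReal.mul_inv_cancel hb hb', mul_one]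
    _ ≤ a⁻¹ * (C * a * b⁻¹) := by gcongr
    _ = (a⁻¹ * a) * (C * b⁻¹) := by ring
    _ = C * b⁻¹ := by rw [ENNReal.inv_mul_cancel ha ha', one_mul]

/-- The quadratic maximal function. -/
noncomputable def sqMaxFun {X : Type*} [PseudoMetricSpace X] [MeasurableSpace X] (m : Measure X)
    (δ : ℝ) (M : ℤ) (f : X → ℂ) (x : X) : ℝ≥0∞ :=
  maxFun m δ M (fun y => ‖f y‖ₑ ^ 2) x ^ (1 / 2 : ℝ)

lemma sqMaxFun_sq {X : Type*} [PseudoMetricSpace X] [MeasurableSpace X] (m : Measure X)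
    (δ : ℝ) (M : ℤ) (f : X → ℂ) (x : X) :
    sqMaxFun m δ M f x ^ 2 = maxFun m δ M (fun y => ‖f y‖ₑ ^ 2) x := sqrt_sq_ennreal _

namespace CubeGrid

variable {X : Type*} [PseudoMetricSpace X] [MeasurableSpace X] {m : Measure X}
  {I : ℤ → Type*} {c : ∀ k, X → I k} {z : ∀ k, I k → X} {δ c₀ C₀ ε K ρ : ℝ} {M : ℤ}
  (G : CubeGrid m c z δ c₀ C₀ ε K ρ M)

include G

lemma measurable_maxFun {h : X → ℝ≥0∞} (hh : Measurable h) : Measurable (maxFun m δ M h) := by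
  have := G.sigmaFinite
  refine Measurable.iSup fun n => (G.measurable_measure_ball _).inv.mul ?_
  have h1 : Measurable (Function.uncurry fun x y : X => (closedBall x (δ ^ (n : ℤ))).indicator h y) :=
    Measurable.indicator (s := {p : X × X | dist p.2 p.1 ≤ δ ^ (n : ℤ)})
      (hh.comp measurable_snd)
      (measurableSet_le (G.measurable_dist.comp measurable_swap) measurable_const)
  have h2 := h1.lintegral_prod_right' (ν := m)
  simpa only [Function.uncurry, lintegral_indicator (G.measurableSet_closedBall _ _)] using h2

lemma measurable_sqMaxFun {f : X → ℂ} (hf : Measurable f) : Measurable (sqMaxFun m δ M f) :=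
  (G.measurable_maxFun (hf.enorm.pow_const 2)).pow_const _

lemma maxFun_le_of_le {h : X → ℝ≥0∞} {a : ℝ≥0∞} (ha : ∀ᵐ y ∂m, h y ≤ a) (x : X) :
    maxFun m δ M h x ≤ a := by
  refine iSup_le fun n => ?_
  have hn : M ≤ n := le_of_lt n.2
  calc _ ≤ (m (closedBall x (δ ^ (n : ℤ))))⁻¹ * ∫⁻ _ in closedBall x (δ ^ (n : ℤ)), a ∂m :=
        mul_le_mul' le_rfl (lintegral_mono_ae (ae_restrict_of_ae ha))
    _ = a * ((m (closedBall x (δ ^ (n : ℤ))))⁻¹ * m (closedBall x (δ ^ (n : ℤ)))) := by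
        rw [setLIntegral_const]; ring
    _ = a := by
        rw [ENNReal.inv_mul_cancel (G.pos_ball _ _ (G.ρ_le hn)) (G.finite_ball _ _), mul_one]

lemma sqMaxFun_le_of_le {f : X → ℂ} {a : ℝ≥0∞} (ha : ∀ᵐ y ∂m, ‖f y‖ₑ ≤ a) (x : X) :
    sqMaxFun m δ M f x ≤ a := by
  rw [sqMaxFun, ← sq_sqrt_ennreal a]
  refine ENNReal.rpow_le_rpow (G.maxFun_le_of_le (ha.mono fun y hy => ?_) x) (by norm_num)
  exact pow_le_pow_left' hy 2

/-- The set s is placed in a ball around x' whose radius is a higher power of δ, and doubling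
compares the normalisations. -/
lemma exists_ballAvg_le_maxFun (Λ : ℝ) : ∃ C : ℝ≥0, ∀ n, M ≤ n → ∀ x x' : X,
    dist x x' ≤ Λ * δ ^ n → ∀ s ⊆ closedBall x' (Λ * δ ^ n), ∀ h : X → ℝ≥0∞,
      (m (closedBall x (δ ^ n)))⁻¹ * ∫⁻ y in s, h y ∂m ≤ C * maxFun m δ M h x' := by
  obtain ⟨j, hj⟩ := pow_unbounded_of_one_lt Λ G.one_lt
  obtain ⟨C, hC⟩ := G.exists_ball_comparison (max Λ (δ ^ (j + 1)))
  refine ⟨C, fun n hn x x' hxx' s hs h => ?_⟩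
  have hnp := G.zpow_pos n
  have hδ := G.one_lt
  -- The `+ 1` ensures N > M even when n = M, since `maxFun` uses only such radii.
  set N : ℤ := n + (j + 1 : ℕ) with hN
  have hNM : M < N := by lia
  have hNpow : δ ^ N = δ ^ (j + 1) * δ ^ n := by
    rw [hN, zpow_add₀ G.δ_pos.ne', zpow_natCast, mul_comm]
  have hΛ : Λ * δ ^ n ≤ δ ^ N := by
    rw [hNpow]
    gcongr
    exact hj.le.trans (pow_le_pow_right₀ hδ.le (by lia))
  have h1 : m (closedBall x' (δ ^ N)) ≤ C * m (closedBall x (δ ^ n)) := by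
    refine hC x x' _ _ (G.ρ_le hn) (hxx'.trans ?_) (hNpow.le.trans ?_)
    · gcongr; exact le_max_left _ _
    · gcongr; exact le_max_right _ _
  calc _ ≤ C * (m (closedBall x' (δ ^ N)))⁻¹ * ∫⁻ y in closedBall x' (δ ^ N), h y ∂m := by
        gcongr
        · exact ennreal_inv_le_of_le_mul h1 (G.pos_ball _ _ (G.ρ_le hNM.le)) (G.finite_ball _ _)
            (G.pos_ball _ _ (G.ρ_le hn)) (G.finite_ball _ _)
        · exact hs.trans (Metric.closedBall_subset_closedBall hΛ)
    _ ≤ _ := by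
        rw [mul_assoc]
        gcongr
        exact le_iSup (fun n : Ioi M => (m (closedBall x' (δ ^ (n : ℤ))))⁻¹
          * ∫⁻ y in closedBall x' (δ ^ (n : ℤ)), h y ∂m) ⟨N, hNM⟩

lemma exists_setLIntegral_le_cell_mul_maxFun (Λ : ℝ) : ∃ C : ℝ≥0, ∀ k, M ≤ k → ∀ x : X,
    ∀ s ⊆ closedBall x (Λ * δ ^ k), ∀ h : X → ℝ≥0∞,
      ∫⁻ y in s, h y ∂m ≤ C * m (c k ⁻¹' {c k x}) * maxFun m δ M h x := by
  obtain ⟨C, hC⟩ := G.exists_ballAvg_le_maxFun (max Λ 0)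
  obtain ⟨D, hD⟩ := G.exists_cell_comparison 1
  refine ⟨D * C, fun k hk x s hs h => ?_⟩
  have hkp := G.zpow_pos k
  have h1 := hC k hk x x (by rw [dist_self]; positivity) s
    (hs.trans (Metric.closedBall_subset_closedBall (by gcongr; exact le_max_left _ _))) h
  have h2 := hD k hk x x (by rw [dist_self]; positivity) (δ ^ k) (by rw [one_mul])
  calc ∫⁻ y in s, h y ∂m = m (closedBall x (δ ^ k))
        * ((m (closedBall x (δ ^ k)))⁻¹ * ∫⁻ y in s, h y ∂m) := by
        rw [← mul_assoc, ENNReal.mul_inv_cancel (G.pos_ball _ _ (G.ρ_le hk)) (G.finite_ball _ _),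
          one_mul]
    _ ≤ D * m (c k ⁻¹' {c k x}) * (C * maxFun m δ M h x) := by gcongr
    _ = _ := by push_cast; ring

/-- Ball averages at two points of a cube of generation `k` differ by a small amount at
scales `n` much larger than `k`. -/
lemma exists_ballMean_sub_le : ∃ C : ℝ≥0, ∀ n k, M ≤ k → k ≤ n → ∀ f : X → ℂ, Measurable f →
    BallIntegrable m f → ∀ x x' w, c k x' = c k x → c k w = c k x →
    ‖ballMean m (δ ^ n) f x - ballMean m (δ ^ n) f x'‖ₑ
      ≤ C * (decayRate δ ε ^ (1 / 2 : ℝ) : ℝ≥0) ^ (n - k).natAbs * sqMaxFun m δ M f w := by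
  have hC0 := G.C₀_pos
  obtain ⟨C₁, h₁⟩ := G.exists_annulusKernel_le
  obtain ⟨C₂, h₂⟩ := G.exists_ballAvg_le_maxFun (1 + 8 * C₀)
  set θ := decayRate δ ε with hθ
  refine ⟨(C₁ * (2 * (C₂ + C₁ * C₂))) ^ (1 / 2 : ℝ), fun n k hk hkn f hf hbi x x' w hx' hw => ?_⟩
  have hn : M ≤ n := hk.trans hkn
  have hnp := G.zpow_pos n
  have hkp := G.zpow_pos k
  have hkn' := G.zpow_mono hkn
  have hCn := mul_pos hC0 hnp
  have hρ := G.ρ_le hn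
  set B := closedBall x (δ ^ n) with hB
  set B' := closedBall x' (δ ^ n) with hB'
  have hBm := G.measurableSet_closedBall x (δ ^ n)
  have hBm' := G.measurableSet_closedBall x' (δ ^ n)
  have hB0 := G.pos_ball x _ hρ
  have hB0' := G.pos_ball x' _ hρ
  have hBf := G.finite_ball x (δ ^ n)
  have hBf' := G.finite_ball x' (δ ^ n)
  set a := ballMean m (δ ^ n) f x' with ha
  set κ := annulusKernel m δ C₀ n k x with hκ
  have hκm : Measurable κ := (G.measurable_annulusKernel n k).comp measurable_prodMk_left
  have hdx : dist x x' ≤ 4 * C₀ * δ ^ k := G.dist_le_of_eq hx'.symm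
  have hdw : dist x w ≤ 4 * C₀ * δ ^ k := G.dist_le_of_eq hw.symm
  have hdw' : dist x' w ≤ 4 * C₀ * δ ^ k := G.dist_le_of_eq (hx'.trans hw.symm)
  have hkn4 : 4 * C₀ * δ ^ k ≤ 4 * C₀ * δ ^ n := by gcongr
  have hDi : IntegrableOn (fun y => f y - a) B m :=
    (hbi x _).sub (integrableOn_const hBf)
  have hDi' : IntegrableOn (fun y => f y - a) B' m :=
    (hbi x' _).sub (integrableOn_const hBf')
  have hzero : ∫ y in B', (f y - a) ∂m = 0 := by
    rw [integral_sub (hbi x' _) (integrableOn_const hBf'), setIntegral_const, ha, ballMean,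
      setAverage_eq, smul_smul, mul_inv_cancel₀, one_smul, sub_self]
    exact (ENNReal.toReal_pos hB0' hBf').ne'
  -- Subtracting the mean `a` over B' makes the integral over B' vanish. Both integrals can then
  -- carry the normalisation of B, and they differ only on the symmetric difference, which lies in
  -- an annulus around x.
  have hmean : ballMean m (δ ^ n) f x - a
      = (m.real B)⁻¹ • (∫ y in B, (f y - a) ∂m - ∫ y in B', (f y - a) ∂m) := by
    rw [hzero, sub_zero, integral_sub (hbi x _) (integrableOn_const hBf), setIntegral_const,
      smul_sub, smul_smul, inv_mul_cancel₀, one_smul, ballMean, setAverage_eq]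
    exact (ENNReal.toReal_pos hB0 hBf).ne'
  have hfirst : ‖ballMean m (δ ^ n) f x - a‖ₑ ≤ ∫⁻ y, κ y * ‖f y - a‖ₑ ∂m := by
    rw [hmean, enorm_smul, ← integral_indicator hBm, ← integral_indicator hBm',
      ← integral_sub (hDi.integrable_indicator hBm) (hDi'.integrable_indicator hBm')]
    have hV : ‖(m.real B)⁻¹‖ₑ = (m B)⁻¹ := by
      rw [Measure.real, ← ENNReal.toReal_inv, Real.enorm_of_nonneg ENNReal.toReal_nonneg,
        ENNReal.ofReal_toReal (by simpa using hB0)]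
    rw [hV]
    refine (mul_le_mul' le_rfl (enorm_integral_le_lintegral_enorm _)).trans ?_
    rw [← lintegral_const_mul' _ _ (by simpa using hB0)]
    refine lintegral_mono fun y => ?_
    have hann : ∀ {y}, δ ^ n - 4 * C₀ * δ ^ k < dist x y → dist x y ≤ δ ^ n + 4 * C₀ * δ ^ k →
        κ y = (m B)⁻¹ := fun h1 h2 => by
      rw [hκ, annulusKernel, indicator_of_mem (by exact ⟨h1, h2⟩)]
    by_cases hy : y ∈ B <;> by_cases hy' : y ∈ B'
    · simp [indicator_of_mem hy, indicator_of_mem hy']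
    · rw [indicator_of_mem hy, indicator_of_notMem hy', sub_zero, hann]
      · rw [hB', mem_closedBall, not_le] at hy'
        have := dist_triangle_left y x' x
        linarith
      · rw [hB, mem_closedBall, dist_comm] at hy
        nlinarith
    · rw [indicator_of_notMem hy, indicator_of_mem hy', zero_sub, enorm_neg, hann]
      · rw [hB, mem_closedBall, not_le, dist_comm] at hy
        nlinarith
      · rw [hB', mem_closedBall, dist_comm] at hy'
        have := dist_triangle x x' y
        linarith
    · simp [indicator_of_notMem hy, indicator_of_notMem hy']
  have hrow : ∫⁻ y, κ y ∂m ≤ C₁ * θ ^ (n - k).natAbs := (h₁ n k hn hkn).1 x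
  have hrow1 : ∫⁻ y, κ y ∂m ≤ C₁ := by
    refine hrow.trans (mul_le_of_le_one_right' ?_)
    exact pow_le_one' (by exact_mod_cast G.decayRate_lt_one.le) _
  have hsq : ∫⁻ y, κ y * ‖f y‖ₑ ^ 2 ∂m ≤ C₂ * sqMaxFun m δ M f w ^ 2 := by
    rw [sqMaxFun_sq]
    refine le_trans ?_ (h₂ n hn x w (by nlinarith) (closedBall x ((1 + 4 * C₀) * δ ^ n)) ?_ _)
    · rw [← lintegral_indicator (G.measurableSet_closedBall _ _),
        ← lintegral_const_mul' _ _ (by simpa using hB0)]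
      refine lintegral_mono fun y => ?_
      by_cases hy : y ∈ closedBall x ((1 + 4 * C₀) * δ ^ n)
      · rw [indicator_of_mem hy, hκ, annulusKernel]
        gcongr
        exact indicator_le_self _ _ _
      · rw [hκ, annulusKernel, indicator_of_notMem, zero_mul]
        · exact zero_le
        · rintro ⟨-, h⟩
          simp only at h
          rw [dist_comm] at h
          exact hy (mem_closedBall.2 (by linarith))
    · exact Metric.closedBall_subset_closedBall' (by linarith)
  have hasq : ‖a‖ₑ ^ 2 ≤ C₂ * sqMaxFun m δ M f w ^ 2 := by
    rw [sqMaxFun_sq]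
    refine le_trans ?_ (h₂ n hn x' w (by nlinarith) B' ?_ _)
    · rw [← G.lintegral_ballKernel hρ]
      have := lintegral_mul_rpow_le (ν := m) (k := ballKernel m (δ ^ n) x')
        ((G.measurable_ballKernel _).comp measurable_prodMk_left) hf.enorm one_le_two
      rw [show (2 : ℝ) - 1 = 1 by norm_num, ENNReal.rpow_one] at this
      simp only [ENNReal.rpow_two] at this
      refine (pow_le_pow_left' (G.enorm_ballMean_le hρ f x') 2).trans (this.trans ?_)
      refine mul_le_of_le_one_left' ?_
      have hone := G.lintegral_ballKernel hρ (fun _ => 1) x'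
      simp only [mul_one, lintegral_const, Measure.restrict_apply MeasurableSet.univ, univ_inter,
        one_mul] at hone
      rw [hone, ENNReal.inv_mul_cancel hB0' hBf']
    · exact Metric.closedBall_subset_closedBall' (by linarith)
  have hsqa : ∫⁻ y, κ y * ‖f y - a‖ₑ ^ 2 ∂m
      ≤ 2 * (C₂ + C₁ * C₂) * sqMaxFun m δ M f w ^ 2 := by
    calc _ ≤ ∫⁻ y, (2 * (κ y * ‖f y‖ₑ ^ 2) + 2 * ‖a‖ₑ ^ 2 * κ y) ∂m := by
          refine lintegral_mono fun y => ?_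
          have h3 : ‖f y - a‖ₑ ^ 2 ≤ 2 * (‖f y‖ₑ ^ 2 + ‖a‖ₑ ^ 2) :=
            (pow_le_pow_left' enorm_sub_le 2).trans (add_sq_le_ennreal _ _)
          refine (mul_le_mul' le_rfl h3).trans (le_of_eq ?_)
          ring
      _ = 2 * ∫⁻ y, κ y * ‖f y‖ₑ ^ 2 ∂m + 2 * ‖a‖ₑ ^ 2 * ∫⁻ y, κ y ∂m := by
          have hm1 : Measurable fun y => κ y * ‖f y‖ₑ ^ 2 := hκm.mul (hf.enorm.pow_const 2)
          rw [lintegral_add_left (hm1.const_mul 2), lintegral_const_mul _ hm1,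
            lintegral_const_mul _ hκm]
      _ ≤ 2 * (C₂ * sqMaxFun m δ M f w ^ 2) + 2 * (C₂ * sqMaxFun m δ M f w ^ 2) * C₁ := by
          gcongr
      _ = _ := by ring
  -- Cauchy-Schwarz: the mass of the annulus kernel supplies the decay, at the price of a square
  -- root, and the second factor is a multiple of the quadratic maximal function.
  have hCS := lintegral_mul_rpow_le (ν := m) hκm (F := fun y => ‖f y - a‖ₑ)
    (hf.sub_const a).enorm one_le_two
  rw [show (2 : ℝ) - 1 = 1 by norm_num, ENNReal.rpow_one] at hCS
  simp only [ENNReal.rpow_two] at hCS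
  refine hfirst.trans (le_of_sq_le_sq_ennreal (hCS.trans ?_))
  refine (mul_le_mul' hrow hsqa).trans (le_of_eq ?_)
  have hp : ∀ u : ℝ≥0, (u ^ (1 / 2 : ℝ)) ^ 2 = u := fun u => by
    rw [← NNReal.rpow_natCast, ← NNReal.rpow_mul]; norm_num
  have hp1 := hp (C₁ * (2 * (C₂ + C₁ * C₂)))
  have hp2 : ((θ ^ (1 / 2 : ℝ)) ^ (n - k).natAbs) ^ 2 = θ ^ (n - k).natAbs := by
    rw [← pow_mul, mul_comm, pow_mul, hp]
  rw [mul_pow, mul_pow]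
  norm_cast
  rw [hp1, hp2]
  push_cast
  ring

end CubeGrid

/-! ### Oscillation over a cube, local L² bounds and finitely many scales -/

lemma ellTwo_indicator_union_le (A B : Set ℤ) (a : ℤ → ℝ≥0∞) :
    ellTwo ((A ∪ B).indicator a) ≤ ellTwo (A.indicator a) + ellTwo (B.indicator a) := by
  refine le_trans (ellTwo_mono fun n => ?_) (ellTwo_add_le _ _)
  by_cases hA : n ∈ A
  · simp [hA]
  · by_cases hB : n ∈ B <;> simp [hA, hB]

lemma ellTwo_indicator_sq_finset (s : Finset ℤ) (a : ℤ → ℝ≥0∞) :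
    ellTwo ((s : Set ℤ).indicator a) ^ 2 = ∑ n ∈ s, a n ^ 2 := by
  rw [ellTwo_sq, tsum_eq_sum (s := s) fun n hn => by simp [hn]]
  exact Finset.sum_congr rfl fun n hn => by simp [hn]

lemma ellTwo_indicator_finset_le (s : Finset ℤ) (a : ℤ → ℝ≥0∞) :
    ellTwo ((s : Set ℤ).indicator a) ≤ ∑ n ∈ s, a n := by
  refine (ellTwo_le_tsum _).trans (le_of_eq ?_)
  rw [tsum_eq_sum (s := s) fun n hn => by simp [hn]]
  exact Finset.sum_congr rfl fun n hn => by simp [hn]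

/-- Restricting to finitely many scales exhausts the `ℓ²` norm. -/
lemma ellTwo_indicator_Ioi_eq_iSup (M : ℤ) (a : ℤ → ℝ≥0∞) :
    ellTwo ((Ioi M).indicator a) = ⨆ j : ℕ, ellTwo ((Ioc M (M + j)).indicator a) := by
  refine le_antisymm ?_ (iSup_le fun j => ellTwo_mono fun n =>
    indicator_le_indicator_of_subset (fun n hn => hn.1) (fun _ => zero_le) n)
  refine le_of_sq_le_sq_ennreal ?_
  rw [ellTwo_sq, ENNReal.tsum_eq_iSup_sum]
  refine iSup_le fun s => ?_
  obtain ⟨L, hL⟩ := s.bddAbove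
  refine le_trans ?_ (pow_le_pow_left'
    (le_iSup (fun j : ℕ => ellTwo ((Ioc M (M + j)).indicator a)) (L - M).natAbs) 2)
  rw [ellTwo_sq]
  refine le_trans (Finset.sum_le_sum fun n hn => ?_) (ENNReal.sum_le_tsum s)
  by_cases hM : n ∈ Ioi M
  · have := hL hn
    rw [mem_Ioi] at hM
    rw [indicator_of_mem (by exact hM), indicator_of_mem]
    exact ⟨hM, by lia⟩
  · simp [indicator_of_notMem hM]

namespace CubeGrid

variable {X : Type*} [PseudoMetricSpace X] [MeasurableSpace X] {m : Measure X}
  {I : ℤ → Type*} {c : ∀ k, X → I k} {z : ∀ k, I k → X} {δ c₀ C₀ ε K ρ : ℝ} {M : ℤ}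
  (G : CubeGrid m c z δ c₀ C₀ ε K ρ M)

include G

/-- The oscillation over a cube of generation `k` of the square function over scales `n ≥ k`. -/
lemma exists_squareOn_le_add : ∃ C : ℝ≥0, ∀ k, M ≤ k → ∀ A ⊆ Ici k, ∀ f : X → ℂ, Measurable f →
    BallIntegrable m f → ∀ x x' w, c k x' = c k x → c k w = c k x →
    squareOn m δ c A f x ≤ squareOn m δ c A f x' + C * sqMaxFun m δ M f w := by
  obtain ⟨C, h⟩ := G.exists_ballMean_sub_le
  set β : ℝ≥0 := decayRate δ ε ^ (1 / 2 : ℝ) with hβ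
  have hβ1 : β < 1 := NNReal.rpow_lt_one G.decayRate_lt_one (by norm_num)
  set T : ℝ≥0 := ∑' j : ℕ, β ^ j with hT
  have hTs : ((T : ℝ≥0) : ℝ≥0∞) = ∑' j : ℕ, (β : ℝ≥0∞) ^ j := by
    rw [hT, ENNReal.coe_tsum (NNReal.summable_geometric hβ1)]
    simp
  refine ⟨C * (2 * T), fun k hk A hA f hf hbi x x' w hx' hw => ?_⟩
  have hd : ∀ n, A.indicator (fun n => ‖avgDiff m δ c n f x‖ₑ) n
      ≤ A.indicator (fun n => ‖avgDiff m δ c n f x'‖ₑ) n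
        + C * (β : ℝ≥0∞) ^ (n - k).natAbs * sqMaxFun m δ M f w := by
    intro n
    by_cases hn : n ∈ A
    · have hkn : k ≤ n := hA hn
      have hcell : cellAvg m (c n) f x' = cellAvg m (c n) f x := by
        simp only [cellAvg, G.nested k n hkn x' x hx']
      rw [indicator_of_mem hn, indicator_of_mem hn]
      have e : avgDiff m δ c n f x = avgDiff m δ c n f x'
          + (ballMean m (δ ^ n) f x - ballMean m (δ ^ n) f x') := by
        simp only [avgDiff, hcell]
        ring
      rw [e]
      exact (enorm_add_le _ _).trans (add_le_add le_rfl (h n k hk hkn f hf hbi x x' w hx' hw))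
    · simp [indicator_of_notMem hn]
  refine (ellTwo_mono hd).trans ((ellTwo_add_le _ _).trans (add_le_add le_rfl ?_))
  refine (ellTwo_le_tsum _).trans ?_
  rw [ENNReal.tsum_mul_right, ENNReal.tsum_mul_left]
  push_cast
  gcongr
  rw [hTs]
  exact tsum_natAbs_sub_le (fun j => (β : ℝ≥0∞) ^ j) k

/-- The mean square over a cube of generation `k` of the square function over scales `n ≤ k`. -/
lemma exists_setLIntegral_squareOn_sq_le : ∃ C : ℝ≥0, ∀ k, M ≤ k → ∀ A ⊆ Ioc M k,
    ∀ f : X → ℂ, Measurable f → ∀ x,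
    ∫⁻ y in c k ⁻¹' {c k x}, squareOn m δ c A f y ^ 2 ∂m
      ≤ C * m (c k ⁻¹' {c k x}) * sqMaxFun m δ M f x ^ 2 := by
  have hC0 := G.C₀_pos
  obtain ⟨C, h⟩ := G.exists_squareOn_sq_le
  obtain ⟨D, hD⟩ := G.exists_setLIntegral_le_cell_mul_maxFun (1 + 8 * C₀)
  refine ⟨(C + 1) * D, fun k hk A hA f hf x => ?_⟩
  have hkp := G.zpow_pos k
  set s := closedBall x ((1 + 8 * C₀) * δ ^ k) with hs
  have hsm : MeasurableSet s := G.measurableSet_closedBall _ _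
  have hfs : Measurable (s.indicator f) := hf.indicator hsm
  have hnorm : ∫⁻ y, ‖s.indicator f y‖ₑ ^ 2 ∂m = ∫⁻ y in s, ‖f y‖ₑ ^ 2 ∂m := by
    rw [← lintegral_indicator hsm]
    refine lintegral_congr fun y => ?_
    by_cases hy : y ∈ s <;> simp [hy]
  -- At scales n ≤ k, the balls and cubes at points of the cube stay inside `s`, so truncating f to
  -- `s` changes nothing.
  have hloc : ∀ y ∈ c k ⁻¹' {c k x}, squareOn m δ c A f y
      ≤ squareOn m δ c (Ioi M) (s.indicator f) y := by
    intro y hy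
    have hyx : dist y x ≤ 4 * C₀ * δ ^ k := G.dist_le_of_eq hy
    refine ellTwo_mono fun n => ?_
    by_cases hn : n ∈ A
    · have hnk : n ≤ k := (hA hn).2
      have hnp := G.zpow_mono hnk
      rw [indicator_of_mem hn, indicator_of_mem (by exact (hA hn).1)]
      refine le_of_eq (congrArg _ ?_)
      have hb : closedBall y (δ ^ n) ⊆ s := Metric.closedBall_subset_closedBall' (by nlinarith)
      have hc : c n ⁻¹' {c n y} ⊆ s := fun u hu => by
        have h1 : c k u = c k y := G.nested n k hnk u y hu
        have h2 : dist u y ≤ 4 * C₀ * δ ^ k := G.dist_le_of_eq h1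
        have := dist_triangle u y x
        rw [hs, mem_closedBall]
        nlinarith
      simp only [avgDiff, ballMean, cellAvg]
      congr 1
      · refine setAverage_congr_fun (G.measurableSet_closedBall _ _) (.of_forall fun u hu => ?_)
        exact (indicator_of_mem (hb hu) f).symm
      · refine setAverage_congr_fun (G.measurableSet_fibre _ _) (.of_forall fun u hu => ?_)
        exact (indicator_of_mem (hc hu) f).symm
    · rw [indicator_of_notMem hn]
      exact zero_le
  have hmain : ∫⁻ y in c k ⁻¹' {c k x}, squareOn m δ c A f y ^ 2 ∂m
      ≤ (C + 1) * ∫⁻ y in s, ‖f y‖ₑ ^ 2 ∂m := by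
    -- The constant C + 1 is nonzero, so the bound is trivially ∞ when f is not square integrable on
    -- `s`.
    by_cases hfin : ∫⁻ y in s, ‖f y‖ₑ ^ 2 ∂m = ∞
    · rw [hfin, ENNReal.mul_top (by simp)]
      exact le_top
    · have hL2 : MemLp (s.indicator f) 2 m := by
        refine ⟨hfs.aestronglyMeasurable, ?_⟩
        by_contra hcon
        rw [not_lt, top_le_iff] at hcon
        rw [← hnorm, ← eLpNorm_two_sq, hcon] at hfin
        simp at hfin
      calc _ ≤ ∫⁻ y in c k ⁻¹' {c k x}, squareOn m δ c (Ioi M) (s.indicator f) y ^ 2 ∂m :=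
            setLIntegral_mono' (G.measurableSet_fibre _ _) fun y hy =>
              pow_le_pow_left' (hloc y hy) 2
        _ ≤ ∫⁻ y, squareOn m δ c (Ioi M) (s.indicator f) y ^ 2 ∂m := setLIntegral_le_lintegral _ _
        _ ≤ C * ∫⁻ y, ‖s.indicator f y‖ₑ ^ 2 ∂m := h _ hfs hL2
        _ ≤ _ := by
            rw [hnorm]
            exact mul_le_mul_left le_self_add _
  refine hmain.trans ((mul_le_mul' le_rfl (hD k hk x s subset_rfl _)).trans (le_of_eq ?_))
  rw [sqMaxFun_sq]
  push_cast
  ring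

/-- Each single scale is bounded on `L^p`. -/
lemma exists_avgDiff_rpow_le {p : ℝ} (hp : 1 ≤ p) : ∃ C : ℝ≥0, ∀ n, ρ ≤ δ ^ n → ∀ f : X → ℂ,
    Measurable f → ∫⁻ x, ‖avgDiff m δ c n f x‖ₑ ^ p ∂m ≤ C * ∫⁻ x, ‖f x‖ₑ ^ p ∂m := by
  obtain ⟨D, hD1, hD⟩ := G.exists_ballKernel_le
  refine ⟨2 ^ (p - 1) * (D + 1), fun n hn f hf => ?_⟩
  have := G.sigmaFinite
  have := G.countable n
  have hball : ∫⁻ x, ‖ballMean m (δ ^ n) f x‖ₑ ^ p ∂m ≤ D * ∫⁻ x, ‖f x‖ₑ ^ p ∂m := by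
    have h1 := lintegral_kernel_rpow_le (μ := m) (ν := m) (G.measurable_ballKernel (δ ^ n)) hp
      (hD _ hn).1 (hD _ hn).2 hf.enorm
    rw [ENNReal.one_rpow, one_mul] at h1
    exact (lintegral_mono fun x => ENNReal.rpow_le_rpow (G.enorm_ballMean_le hn f x)
      (by linarith)).trans h1
  have hcell : ∫⁻ x, ‖cellAvg m (c n) f x‖ₑ ^ p ∂m ≤ ∫⁻ x, ‖f x‖ₑ ^ p ∂m := by
    have h1 := lintegral_cellLAvg_rpow_le (m := m) (G.measurableSet_fibre n) univ hf.enorm hp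
    simp only [preimage_univ, Measure.restrict_univ] at h1
    exact (lintegral_mono fun x => ENNReal.rpow_le_rpow (enorm_cellAvg_le f x)
      (by linarith)).trans h1
  calc _ ≤ ∫⁻ x, 2 ^ (p - 1) * (‖ballMean m (δ ^ n) f x‖ₑ ^ p + ‖cellAvg m (c n) f x‖ₑ ^ p) ∂m := by
        refine lintegral_mono fun x => ?_
        exact (ENNReal.rpow_le_rpow enorm_sub_le (by linarith)).trans
          (ENNReal.rpow_add_le_mul_rpow_add_rpow _ _ hp)
    _ = 2 ^ (p - 1) * (∫⁻ x, ‖ballMean m (δ ^ n) f x‖ₑ ^ p ∂m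
          + ∫⁻ x, ‖cellAvg m (c n) f x‖ₑ ^ p ∂m) := by
        rw [lintegral_const_mul, lintegral_add_left]
        · exact (G.measurable_ballMean hf _).enorm.pow_const p
        · exact ((G.measurable_ballMean hf _).enorm.pow_const p).add
            ((measurable_cellAvg (G.measurableSet_fibre n) f).enorm.pow_const p)
    _ ≤ 2 ^ (p - 1) * (D * ∫⁻ x, ‖f x‖ₑ ^ p ∂m + ∫⁻ x, ‖f x‖ₑ ^ p ∂m) := by gcongr
    _ = _ := by
        push_cast [ENNReal.coe_rpow_of_nonneg _ (sub_nonneg.2 hp)]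
        ring

/-- Finitely many scales are bounded on `L^p`. -/
lemma exists_squareOn_finset_rpow_le {p : ℝ} (hp : 1 ≤ p) (s : Finset ℤ)
    (hs : ∀ n ∈ s, ρ ≤ δ ^ n) : ∃ C : ℝ≥0, ∀ f : X → ℂ, Measurable f →
      ∫⁻ x, squareOn m δ c s f x ^ p ∂m ≤ C * ∫⁻ x, ‖f x‖ₑ ^ p ∂m := by
  obtain ⟨C, h⟩ := G.exists_avgDiff_rpow_le hp
  refine ⟨(s.card : ℝ≥0) ^ (p - 1) * (s.card * C), fun f hf => ?_⟩
  have hm : ∀ n, Measurable fun x => ‖avgDiff m δ c n f x‖ₑ ^ p := fun n =>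
    (G.measurable_avgDiff hf n).enorm.pow_const p
  calc _ ≤ ∫⁻ x, (s.card : ℝ≥0∞) ^ (p - 1) * ∑ n ∈ s, ‖avgDiff m δ c n f x‖ₑ ^ p ∂m :=
        lintegral_mono fun x => (ENNReal.rpow_le_rpow (ellTwo_indicator_finset_le s _)
          (by linarith)).trans (ENNReal.rpow_sum_le_const_mul_sum_rpow s _ hp)
    _ = (s.card : ℝ≥0∞) ^ (p - 1) * ∑ n ∈ s, ∫⁻ x, ‖avgDiff m δ c n f x‖ₑ ^ p ∂m := by
        rw [lintegral_const_mul _ (Finset.measurable_sum _ fun n _ => hm n),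
          lintegral_finsetSum _ fun n _ => hm n]
    _ ≤ (s.card : ℝ≥0∞) ^ (p - 1) * ∑ n ∈ s, C * ∫⁻ x, ‖f x‖ₑ ^ p ∂m := by
        gcongr with n hn
        exact h n (hs n hn) f hf
    _ = _ := by
        rw [Finset.sum_const, nsmul_eq_mul]
        push_cast [ENNReal.coe_rpow_of_nonneg _ (sub_nonneg.2 hp)]
        ring

/-- The quadratic maximal function is bounded on `L^p` for `p > 2`. -/
lemma exists_sqMaxFun_rpow_le {p : ℝ} (hp : 2 < p) : ∃ C : ℝ≥0, ∀ f : X → ℂ, Measurable f →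
    ∫⁻ x, sqMaxFun m δ M f x ^ p ∂m ≤ C * ∫⁻ x, ‖f x‖ₑ ^ p ∂m := by
  obtain ⟨A, C, hA, h⟩ := G.exists_maxFun_weak
  obtain ⟨C', h'⟩ := marcinkiewicz_one_top (p := p / 2) (by linarith) (A + 1) (by positivity) C
  refine ⟨C', fun f hf => ?_⟩
  have := G.sigmaFinite
  have hf2 : Measurable fun y => ‖f y‖ₑ ^ 2 := hf.enorm.pow_const 2
  have key := h' (m := m) (G.measurable_maxFun hf2) hf2 fun t ht => ?_
  · have e1 : ∀ a : ℝ≥0∞, (a ^ 2) ^ (p / 2) = a ^ p := fun a => by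
      rw [← ENNReal.rpow_two, ← ENNReal.rpow_mul]; congr 1; ring
    have e2 : ∀ x, maxFun m δ M (fun y => ‖f y‖ₑ ^ 2) x ^ (p / 2) = sqMaxFun m δ M f x ^ p :=
      fun x => by rw [← sqMaxFun_sq, e1]
    simpa only [e1, e2] using key
  · set u : X → ℝ≥0∞ := fun y => ‖f y‖ₑ ^ 2 with hu
    have ht0 : ENNReal.ofReal t ≠ 0 := by simpa using ht
    set S := {x | ENNReal.ofReal t < u x} with hS
    have hSm : MeasurableSet S := measurableSet_lt measurable_const hf2
    -- The part of `u` below height t has averages at most t. Hence the weak bound at height A t for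
    -- the part above is read at height (A + 1)t for the whole.
    have hle : ∀ x, maxFun m δ M u x ≤ maxFun m δ M (S.indicator u) x + ENNReal.ofReal t := by
      intro x
      refine iSup_le fun n => ?_
      have hn : M ≤ n := le_of_lt n.2
      have hpw : ∀ y, u y ≤ S.indicator u y + ENNReal.ofReal t := fun y => by
        by_cases hy : y ∈ S
        · rw [indicator_of_mem hy]; exact le_self_add
        · rw [indicator_of_notMem hy, zero_add]; exact not_lt.1 hy
      refine (mul_le_mul' le_rfl (lintegral_mono hpw)).trans ?_
      rw [lintegral_add_right _ measurable_const, mul_add]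
      refine add_le_add (le_iSup (fun n : Ioi M => (m (closedBall x (δ ^ (n : ℤ))))⁻¹
          * ∫⁻ y in closedBall x (δ ^ (n : ℤ)), S.indicator u y ∂m) n) (le_of_eq ?_)
      rw [setLIntegral_const, mul_left_comm,
        ENNReal.inv_mul_cancel (G.pos_ball _ _ (G.ρ_le hn)) (G.finite_ball _ _), mul_one]
    calc _ ≤ m {x | A * ENNReal.ofReal t < maxFun m δ M (S.indicator u) x} := by
          refine measure_mono fun x hx => ?_
          rw [mem_ofPred_eq] at hx ⊢
          have h3 := hx.trans_le (hle x)
          rw [add_mul, one_mul, ENNReal.ofReal_add (by positivity) ht.le,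
            ENNReal.ofReal_mul (by positivity), ENNReal.ofReal_coe_nnreal] at h3
          exact lt_of_add_lt_add_right h3
      _ ≤ C * ((ENNReal.ofReal t)⁻¹ * ∫⁻ y, S.indicator u y ∂m) :=
          h _ _ ht0 ENNReal.ofReal_ne_top
      _ = _ := by rw [lintegral_indicator hSm, mul_assoc]

end CubeGrid

/-! ### Exponents p > 2: summation by parts and absorption -/

/-- Convexity: the graph of t^q lies above its tangent at a + u. This is Bernoulli's inequality with
increment -a/(a + u). -/
lemma ennreal_rpow_add_le {a u : ℝ≥0∞} (ha : a ≠ ∞) (hu : u ≠ ∞) {q : ℝ} (hq : 1 ≤ q) :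
    (a + u) ^ q ≤ u ^ q + ENNReal.ofReal q * (a * (a + u) ^ (q - 1)) := by
  have hq0 : 0 ≤ q := by linarith
  lift a to ℝ≥0 using ha
  lift u to ℝ≥0 using hu
  rw [← ENNReal.coe_add, ← ENNReal.coe_rpow_of_nonneg _ hq0, ← ENNReal.coe_rpow_of_nonneg _ hq0,
    ← ENNReal.coe_rpow_of_nonneg _ (sub_nonneg.2 hq), ENNReal.ofReal]
  norm_cast
  rw [← NNReal.coe_le_coe]
  push_cast
  rw [Real.coe_toNNReal _ hq0]
  have ha : (0 : ℝ) ≤ a := a.2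
  have hu : (0 : ℝ) ≤ u := u.2
  rcases eq_or_lt_of_le (add_nonneg ha hu) with h0 | h0
  · have h1 : (a : ℝ) = 0 := by linarith
    simp [h1]
  · have hB := one_add_mul_self_le_rpow_one_add (s := -((a : ℝ) / (a + u)))
      (by rw [neg_le_neg_iff, div_le_one h0]; linarith) hq
    have e1 : 1 + -((a : ℝ) / (a + u)) = u / (a + u) := by field_simp; ring
    rw [e1, Real.div_rpow hu h0.le, le_div_iff₀ (Real.rpow_pos_of_pos h0 _)] at hB
    have e2 : ((a : ℝ) + u) ^ q = (a + u) * (a + u) ^ (q - 1) := by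
      rw [Real.rpow_sub_one h0.ne']; field_simp
    have e3 : (1 + q * -((a : ℝ) / (a + u))) * (a + u) ^ q
        = (a + u) ^ q - q * (a * (a + u) ^ (q - 1)) := by
      rw [e2]; field_simp; ring
    rw [e3] at hB
    linarith

/-- A discrete form of `(U ^ q)' = q U' U ^ (q - 1)`. -/
lemma sum_range_rpow_le {a : ℕ → ℝ≥0∞} (ha : ∀ i, a i ≠ ∞) {q : ℝ} (hq : 1 ≤ q) (j : ℕ) :
    (∑ l ∈ Finset.range j, a l) ^ q
      ≤ ENNReal.ofReal q * ∑ i ∈ Finset.range j, a i * (∑ l ∈ Finset.Ico i j, a l) ^ (q - 1) := by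
  have key : ∀ d i, i + d = j → (∑ l ∈ Finset.Ico i j, a l) ^ q
      ≤ ENNReal.ofReal q * ∑ i ∈ Finset.Ico i j, a i * (∑ l ∈ Finset.Ico i j, a l) ^ (q - 1) := by
    intro d
    induction d with
    | zero =>
      intro i hi
      rw [← hi, add_zero, Finset.Ico_self, Finset.sum_empty,
        ENNReal.zero_rpow_of_pos (by linarith)]
      exact zero_le
    | succ d ih =>
      intro i hi
      have hij : i < j := by lia
      have h1 := ih (i + 1) (by lia)
      have hfin : ∑ l ∈ Finset.Ico (i + 1) j, a l ≠ ∞ := by simp [ENNReal.sum_eq_top, ha]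
      have h2 := ennreal_rpow_add_le (ha i) hfin hq
      rw [← Finset.sum_eq_sum_Ico_succ_bot hij] at h2
      rw [Finset.sum_eq_sum_Ico_succ_bot hij (fun i => a i * (∑ l ∈ Finset.Ico i j, a l) ^ (q - 1)),
        mul_add, add_comm]
      exact h2.trans (add_le_add h1 le_rfl)
  simpa only [Finset.range_eq_Ico] using key j 0 (by lia)

/-- Summation by parts. -/
lemma sum_range_mul_le (a V : ℕ → ℝ≥0∞) (j : ℕ) :
    ∑ i ∈ Finset.range j, a i * V i
      ≤ ∑ n ∈ Finset.range j, (V n - V (n + 1)) * ∑ i ∈ Finset.range (n + 1), a i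
        + V j * ∑ i ∈ Finset.range j, a i := by
  induction j with
  | zero => simp
  | succ j ih =>
    have h1 : V j * ∑ i ∈ Finset.range (j + 1), a i
        ≤ (V j - V (j + 1) + V (j + 1)) * ∑ i ∈ Finset.range (j + 1), a i := by
      gcongr
      exact le_tsub_add
    calc _ = ∑ i ∈ Finset.range j, a i * V i + a j * V j := Finset.sum_range_succ _ _
      _ ≤ ∑ n ∈ Finset.range j, (V n - V (n + 1)) * ∑ i ∈ Finset.range (n + 1), a i
          + (V j * ∑ i ∈ Finset.range j, a i + a j * V j) := by
          rw [← add_assoc]; gcongr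
      _ = ∑ n ∈ Finset.range j, (V n - V (n + 1)) * ∑ i ∈ Finset.range (n + 1), a i
          + V j * ∑ i ∈ Finset.range (j + 1), a i := by
          rw [Finset.sum_range_succ, mul_add, mul_comm (a j)]
      _ ≤ _ := by
          rw [Finset.sum_range_succ (fun n => (V n - V (n + 1)) * ∑ i ∈ Finset.range (n + 1), a i),
            add_assoc, ← add_mul]
          gcongr

lemma sum_range_tsub_add_le {V : ℕ → ℝ≥0∞} (hV : Antitone V) (j : ℕ) :
    ∑ n ∈ Finset.range j, (V n - V (n + 1)) + V j ≤ V 0 := by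
  induction j with
  | zero => simp
  | succ j ih =>
    rw [Finset.sum_range_succ, add_assoc, tsub_add_cancel_of_le (hV (Nat.le_succ j))]
    exact ih

/-- Absorption: the final step in estimating a function by its quadratic maximal function. -/
lemma exists_absorb {p : ℝ} (hp : 2 < p) (B C : ℝ≥0) : ∃ C' : ℝ≥0, ∀ {X : Type*}
    [MeasurableSpace X] {m : Measure X} {S H : X → ℝ≥0∞}, Measurable S → Measurable H →
    ∫⁻ x, S x ^ p ∂m ≠ ∞ →
    ∫⁻ x, S x ^ p ∂m ≤ C * ∫⁻ x, (S x + B * H x) ^ (p - 2) * H x ^ 2 ∂m →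
    ∫⁻ x, S x ^ p ∂m ≤ C' * ∫⁻ x, H x ^ p ∂m := by
  set A : ℝ≥0 := C * 2 ^ (p - 1) with hA
  set η : ℝ≥0 := (2 * (A + 1))⁻¹ with hη
  have hη0 : η ≠ 0 := by positivity
  have hη1 : η ≤ 1 := by
    rw [hη]
    apply inv_le_one_of_one_le₀
    nlinarith [A.2, show (0 : ℝ≥0) ≤ A from zero_le]
  have hAη : A * η ^ 2 ≤ 2⁻¹ := by
    calc A * η ^ 2 ≤ (A + 1) * η := by
          rw [sq]
          gcongr
          · exact le_self_add
          · exact mul_le_of_le_one_left' hη1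
      _ = 2⁻¹ := by rw [hη]; field_simp
  set D : ℝ≥0 := A * η ^ 2 * B ^ p + C * (η⁻¹) ^ (p - 2) with hD
  refine ⟨2 * D, fun {X} _ {m S H} hS hH hfin hle => ?_⟩
  have hsplit : ∀ (E h : ℝ≥0∞), E ^ (p - 2) * h ^ 2
      ≤ (η : ℝ≥0∞) ^ 2 * E ^ p + ((η⁻¹ : ℝ≥0) ^ (p - 2) : ℝ≥0) * h ^ p := by
    intro E h
    have hexp : ∀ u : ℝ≥0∞, u ^ (p - 2) * u ^ 2 = u ^ p := fun u => by
      rw [← ENNReal.rpow_two, ← ENNReal.rpow_add_of_nonneg _ _ (by linarith) (by norm_num)]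
      congr 1; ring
    -- Where h is small compared with E the factor η² makes the term absorbable; elsewhere E is at
    -- most a multiple of h.
    rcases le_total h (η * E) with h1 | h1
    · refine le_trans ?_ le_self_add
      calc E ^ (p - 2) * h ^ 2 ≤ E ^ (p - 2) * (η * E) ^ 2 := by gcongr
        _ = η ^ 2 * (E ^ (p - 2) * E ^ 2) := by ring
        _ = _ := by rw [hexp]
    · refine le_trans ?_ le_add_self
      have h2 : E ≤ (η⁻¹ : ℝ≥0) * h := by
        calc E = ((η⁻¹ * η : ℝ≥0) : ℝ≥0∞) * E := by rw [inv_mul_cancel₀ hη0]; simp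
          _ = (η⁻¹ : ℝ≥0) * (η * E) := by push_cast; ring
          _ ≤ _ := by gcongr
      calc E ^ (p - 2) * h ^ 2 ≤ ((η⁻¹ : ℝ≥0) * h) ^ (p - 2) * h ^ 2 :=
            mul_le_mul' (ENNReal.rpow_le_rpow h2 (by linarith)) le_rfl
        _ = ((η⁻¹ : ℝ≥0) ^ (p - 2) : ℝ≥0) * (h ^ (p - 2) * h ^ 2) := by
            rw [ENNReal.mul_rpow_of_nonneg _ _ (by linarith),
              ENNReal.coe_rpow_of_nonneg _ (by linarith), mul_assoc]
        _ = _ := by rw [hexp]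
  have hpt : ∀ x, C * ((S x + B * H x) ^ (p - 2) * H x ^ 2)
      ≤ 2⁻¹ * S x ^ p + D * H x ^ p := by
    intro x
    have h1 : (S x + B * H x) ^ p ≤ 2 ^ (p - 1) * (S x ^ p + (B ^ p : ℝ≥0) * H x ^ p) := by
      refine (ENNReal.rpow_add_le_mul_rpow_add_rpow _ _ (by linarith)).trans (le_of_eq ?_)
      rw [ENNReal.mul_rpow_of_nonneg _ _ (by linarith),
        ENNReal.coe_rpow_of_nonneg _ (by linarith)]
    have hAη' : (A : ℝ≥0∞) * η ^ 2 ≤ 2⁻¹ := by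
      have : ((2⁻¹ : ℝ≥0) : ℝ≥0∞) = 2⁻¹ := by simp
      rw [← this]
      exact_mod_cast hAη
    calc _ ≤ C * ((η : ℝ≥0∞) ^ 2 * (2 ^ (p - 1) * (S x ^ p + (B ^ p : ℝ≥0) * H x ^ p))
            + ((η⁻¹ : ℝ≥0) ^ (p - 2) : ℝ≥0) * H x ^ p) := by
          gcongr
          exact (hsplit _ _).trans (by gcongr)
      _ = A * η ^ 2 * S x ^ p + D * H x ^ p := by
          rw [hD, hA]
          push_cast [ENNReal.coe_rpow_of_nonneg _ (show 0 ≤ p - 1 by linarith)]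
          ring
      _ ≤ _ := by gcongr
  have hint : ∫⁻ x, S x ^ p ∂m ≤ 2⁻¹ * ∫⁻ x, S x ^ p ∂m + D * ∫⁻ x, H x ^ p ∂m := by
    refine hle.trans ?_
    rw [← lintegral_const_mul' _ _ ENNReal.coe_ne_top]
    refine (lintegral_mono hpt).trans (le_of_eq ?_)
    rw [lintegral_add_left ((hS.pow_const p).const_mul _), lintegral_const_mul _ (hS.pow_const p),
      lintegral_const_mul _ (hH.pow_const p)]
  set J := ∫⁻ x, S x ^ p ∂m with hJ
  -- Half of J is cancelled from both sides, which requires J to be finite.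
  have h2 : 2⁻¹ * J ≤ D * ∫⁻ x, H x ^ p ∂m := by
    have h3 : 2⁻¹ * J + 2⁻¹ * J = J := by
      rw [← add_mul, ENNReal.inv_two_add_inv_two, one_mul]
    exact (ENNReal.add_le_add_iff_left (a := 2⁻¹ * J) (by finiteness)).1 (h3.le.trans hint)
  calc J = 2 * (2⁻¹ * J) := by
        rw [← mul_assoc, ENNReal.mul_inv_cancel (by norm_num) (by norm_num), one_mul]
    _ ≤ 2 * (D * ∫⁻ x, H x ^ p ∂m) := by gcongr
    _ = _ := by push_cast; ring

namespace CubeGrid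

variable {X : Type*} [PseudoMetricSpace X] [MeasurableSpace X] {m : Measure X}
  {I : ℤ → Type*} {c : ∀ k, X → I k} {z : ∀ k, I k → X} {δ c₀ C₀ ε K ρ : ℝ} {M : ℤ}
  (G : CubeGrid m c z δ c₀ C₀ ε K ρ M)

include G

/-- The mean square over a cube is controlled by the maximal function at any point x of the cube, so
one may average over x; weights constant on the cubes pass through. -/
lemma exists_lintegral_const_mul_squareOn_sq_le : ∃ C : ℝ≥0, ∀ k, M ≤ k → ∀ A ⊆ Ioc M k,
    ∀ f : X → ℂ, Measurable f → ∀ φ : I k → ℝ≥0∞,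
    ∫⁻ y, φ (c k y) * squareOn m δ c A f y ^ 2 ∂m
      ≤ C * ∫⁻ y, φ (c k y) * sqMaxFun m δ M f y ^ 2 ∂m := by
  obtain ⟨C, h⟩ := G.exists_setLIntegral_squareOn_sq_le
  refine ⟨C, fun k hk A hA f hf φ => ?_⟩
  have := G.countable k
  have hS2 : Measurable fun y => squareOn m δ c A f y ^ 2 :=
    (G.measurable_squareOn hf A).pow_const 2
  have hH2 : Measurable fun y => sqMaxFun m δ M f y ^ 2 :=
    (G.measurable_sqMaxFun hf).pow_const 2
  rw [lintegral_eq_tsum_fibres (G.measurableSet_fibre k),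
    lintegral_eq_tsum_fibres (G.measurableSet_fibre k), ← ENNReal.tsum_mul_left]
  refine ENNReal.tsum_le_tsum fun i => ?_
  have hsplit : ∀ {u : X → ℝ≥0∞}, Measurable u → ∫⁻ y in c k ⁻¹' {i}, φ (c k y) * u y ∂m
      = φ i * ∫⁻ y in c k ⁻¹' {i}, u y ∂m := fun {u} hu => by
    rw [← lintegral_const_mul _ hu]
    refine setLIntegral_congr_fun (G.measurableSet_fibre k i) fun y hy => ?_
    simp only [show c k y = i from hy]
  rw [hsplit hS2, hsplit hH2, mul_left_comm]
  gcongr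
  set P := c k ⁻¹' {i} with hP
  have hi : c k (z k i) = i := G.c_centre k i
  have hP0 : m P ≠ 0 := by have := G.pos_cell hk (z k i); rwa [hi] at this
  have hPf : m P ≠ ∞ := G.finite_cell k i
  have hx : ∀ x ∈ P, (m P)⁻¹ * ∫⁻ y in P, squareOn m δ c A f y ^ 2 ∂m
      ≤ C * sqMaxFun m δ M f x ^ 2 := by
    intro x hx
    have h1 := h k hk A hA f hf x
    rw [show c k x = i from hx] at h1
    calc _ ≤ (m P)⁻¹ * (C * m P * sqMaxFun m δ M f x ^ 2) := by gcongr
      _ = ((m P)⁻¹ * m P) * (C * sqMaxFun m δ M f x ^ 2) := by ring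
      _ = _ := by rw [ENNReal.inv_mul_cancel hP0 hPf, one_mul]
  calc ∫⁻ y in P, squareOn m δ c A f y ^ 2 ∂m
      = ∫⁻ _ in P, (m P)⁻¹ * ∫⁻ y in P, squareOn m δ c A f y ^ 2 ∂m ∂m := by
        rw [setLIntegral_const, mul_right_comm, ENNReal.inv_mul_cancel hP0 hPf, one_mul]
    _ ≤ ∫⁻ x in P, C * sqMaxFun m δ M f x ^ 2 ∂m :=
        setLIntegral_mono' (G.measurableSet_fibre k i) hx
    _ = _ := lintegral_const_mul _ hH2

omit G in
lemma squareOn_sq_eq_sum (f : X → ℂ) (i j : ℕ) (x : X) :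
    squareOn m δ c (Ico (M + 1 + i) (M + 1 + j)) f x ^ 2
      = ∑ l ∈ Finset.Ico i j, ‖avgDiff m δ c (M + 1 + l) f x‖ₑ ^ 2 := by
  rw [squareOn, show (Ico (M + 1 + (i : ℤ)) (M + 1 + j))
    = (((Finset.Ico i j).image fun l : ℕ => M + 1 + (l : ℤ) : Finset ℤ) : Set ℤ) from ?_,
    ellTwo_indicator_sq_finset, Finset.sum_image]
  · intro a _ b _ h
    simpa using h
  · ext n
    simp only [mem_Ico, Finset.coe_image, mem_image, Finset.coe_Ico]
    constructor
    · rintro ⟨h1, h2⟩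
      exact ⟨(n - (M + 1)).toNat, by lia, by lia⟩
    · rintro ⟨l, ⟨h1, h2⟩, rfl⟩
      lia

/-- Comparison of the square function over finitely many scales with the quadratic maximal
function, before absorption. -/
lemma exists_squareOn_rpow_le_mixed {p : ℝ} (hp : 2 < p) : ∃ B C : ℝ≥0, ∀ f : X → ℂ,
    Measurable f → BallIntegrable m f → ∀ j : ℕ,
    ∫⁻ x, squareOn m δ c (Ioc M (M + j)) f x ^ p ∂m
      ≤ C * ∫⁻ x, (squareOn m δ c (Ioc M (M + j)) f x + B * sqMaxFun m δ M f x) ^ (p - 2)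
        * sqMaxFun m δ M f x ^ 2 ∂m := by
  obtain ⟨B, hB⟩ := G.exists_squareOn_le_add
  obtain ⟨C, hC⟩ := G.exists_lintegral_const_mul_squareOn_sq_le
  refine ⟨B, (p / 2).toNNReal * C, fun f hf hbi j => ?_⟩
  have hIoc : Ioc M (M + (j : ℤ)) = Ico (M + 1 + ((0 : ℕ) : ℤ)) (M + 1 + j) := by
    ext n; simp only [mem_Ioc, mem_Ico]; lia
  rw [hIoc]
  set H := sqMaxFun m δ M f with hH
  have hHm : Measurable H := G.measurable_sqMaxFun hf
  let W : ℕ → X → ℝ≥0∞ := fun i => squareOn m δ c (Ico (M + 1 + (i : ℤ)) (M + 1 + j)) f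
  -- A majorant of the tail W i that is constant on cubes of generation M + 1 + i. By the
  -- oscillation estimate it lies between W i and W i + BH, and it decreases in i like the tails.
  let ψ : ∀ i : ℕ, I (M + 1 + i) → ℝ≥0∞ := fun i α =>
    ⨅ y ∈ c (M + 1 + i) ⁻¹' {α}, (W i y + B * H y)
  let V : ℕ → X → ℝ≥0∞ := fun i x => ψ i (c (M + 1 + i) x) ^ (p - 2)
  let a : ℕ → X → ℝ≥0∞ := fun l x => ‖avgDiff m δ c (M + 1 + l) f x‖ₑ ^ 2
  have ham : ∀ l, Measurable (a l) := fun l => (G.measurable_avgDiff hf _).enorm.pow_const 2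
  have hWsq : ∀ i x, W i x ^ 2 = ∑ l ∈ Finset.Ico i j, a l x := fun i x =>
    squareOn_sq_eq_sum f i j x
  have hWψ : ∀ i x, W i x ≤ ψ i (c (M + 1 + i) x) := fun i x =>
    le_iInf₂ fun y hy => hB (M + 1 + i) (by lia) _ (fun n hn => hn.1) f hf hbi x y y hy hy
  have hψW : ∀ i x, ψ i (c (M + 1 + i) x) ≤ W i x + B * H x := fun i x =>
    iInf₂_le (f := fun y (_ : y ∈ c (M + 1 + i) ⁻¹' {c (M + 1 + i) x}) => W i y + B * H y) x rfl
  have hVanti : ∀ x, Antitone fun i => V i x := fun x => by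
    refine antitone_nat_of_succ_le fun i => ENNReal.rpow_le_rpow ?_ (by linarith)
    refine le_iInf₂ fun y hy => ?_
    have hy' : c (M + 1 + (i + 1 : ℕ)) y = c (M + 1 + (i + 1 : ℕ)) x :=
      G.nested _ _ (by lia) y x hy
    refine (iInf₂_le y hy').trans (add_le_add (ellTwo_mono fun n => ?_) le_rfl)
    exact indicator_le_indicator_of_subset (Ico_subset_Ico_left (by lia)) (fun _ => zero_le) n
  have hVm : ∀ i, Measurable (V i) := fun i => by
    have := G.countable (M + 1 + i)
    exact measurable_comp_cells (G.measurableSet_fibre _) fun α => ψ i α ^ (p - 2)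
  have hW0 : ∀ x, W 0 x ^ p = (∑ l ∈ Finset.range j, a l x) ^ (p / 2) := fun x => by
    rw [Finset.range_eq_Ico, ← hWsq 0 x, ← ENNReal.rpow_two, ← ENNReal.rpow_mul]
    congr 1; ring
  have hpt : ∀ x, W 0 x ^ p ≤ ENNReal.ofReal (p / 2)
      * (∑ n ∈ Finset.range j, (V n x - V (n + 1) x) * ∑ i ∈ Finset.range (n + 1), a i x
        + V j x * ∑ i ∈ Finset.range j, a i x) := by
    intro x
    rw [hW0]
    -- The chain rule with q = p/2 weights each square by a tail to the power p - 2, and V i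
    -- dominates that weight. Summation by parts then pairs the decrements of V with square
    -- functions over the scales up to that generation, where the local L² bound applies.
    refine (sum_range_rpow_le (fun i => by simp [a]) (by linarith) j).trans ?_
    gcongr
    refine le_trans (Finset.sum_le_sum fun i _ => ?_)
      (sum_range_mul_le (fun i => a i x) (fun i => V i x) j)
    gcongr
    rw [← hWsq, ← ENNReal.rpow_two, ← ENNReal.rpow_mul,
      show 2 * (p / 2 - 1) = p - 2 by ring]
    exact ENNReal.rpow_le_rpow (hWψ i x) (by linarith)
  have hsum : ∀ n x, ∑ i ∈ Finset.range n, a i x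
      = squareOn m δ c (Ico (M + 1 + ((0 : ℕ) : ℤ)) (M + 1 + n)) f x ^ 2 := fun n x => by
    rw [squareOn_sq_eq_sum f 0 n x, Finset.range_eq_Ico]
  have hD : ∀ n, ∫⁻ x, (V n x - V (n + 1) x) * ∑ i ∈ Finset.range (n + 1), a i x ∂m
      ≤ C * ∫⁻ x, (V n x - V (n + 1) x) * H x ^ 2 ∂m := by
    intro n
    simp only [hsum]
    let φ : I (M + 1 + (n + 1 : ℕ)) → ℝ≥0∞ := fun α => ψ (n + 1) α ^ (p - 2)
    -- V (n + 1) is constant on the coarser cubes of the next generation, so it can be read off at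
    -- the centre of the finer cube.
    let φ' : I (M + 1 + n) → ℝ≥0∞ := fun α =>
      ψ n α ^ (p - 2) - φ (c (M + 1 + (n + 1 : ℕ)) (z (M + 1 + n) α))
    have hφ : ∀ x, φ' (c (M + 1 + n) x) = V n x - V (n + 1) x := fun x => by
      have : c (M + 1 + (n + 1 : ℕ)) (z (M + 1 + n) (c (M + 1 + n) x))
          = c (M + 1 + (n + 1 : ℕ)) x :=
        G.nested (M + 1 + n) _ (by lia) _ _ (G.c_centre _ _)
      simp only [φ', φ, this, V]
    simp only [← hφ]
    exact hC (M + 1 + n) (by lia) _ (fun l hl => by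
      simp only [mem_Ico] at hl; simp only [mem_Ioc]; lia) f hf φ'
  have hE : ∫⁻ x, V j x * ∑ i ∈ Finset.range j, a i x ∂m ≤ C * ∫⁻ x, V j x * H x ^ 2 ∂m := by
    simp only [hsum]
    exact hC (M + 1 + j) (by lia) _ (fun l hl => by
      simp only [mem_Ico] at hl; simp only [mem_Ioc]; lia) f hf fun α => ψ j α ^ (p - 2)
  have hDm : ∀ n, Measurable fun x => V n x - V (n + 1) x := fun n => (hVm n).sub (hVm (n + 1))
  have hH2 : Measurable fun x => H x ^ 2 := hHm.pow_const 2
  have hPm : ∀ n, Measurable fun x => ∑ i ∈ Finset.range n, a i x := fun n =>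
    Finset.measurable_sum _ fun i _ => ham i
  have hVP : Measurable fun x => V j x * ∑ i ∈ Finset.range j, a i x := (hVm j).mul (hPm j)
  have hDP : ∀ n, Measurable fun x =>
      (V n x - V (n + 1) x) * ∑ i ∈ Finset.range (n + 1), a i x := fun n => (hDm n).mul (hPm (n + 1))
  have hVH : Measurable fun x => V j x * H x ^ 2 := (hVm j).mul hH2
  have hDH : ∀ n, Measurable fun x => (V n x - V (n + 1) x) * H x ^ 2 := fun n => (hDm n).mul hH2
  calc ∫⁻ x, W 0 x ^ p ∂m
      ≤ ∫⁻ x, ENNReal.ofReal (p / 2)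
        * (∑ n ∈ Finset.range j, (V n x - V (n + 1) x) * ∑ i ∈ Finset.range (n + 1), a i x
          + V j x * ∑ i ∈ Finset.range j, a i x) ∂m := lintegral_mono hpt
    _ = ENNReal.ofReal (p / 2)
        * (∑ n ∈ Finset.range j, ∫⁻ x, (V n x - V (n + 1) x) * ∑ i ∈ Finset.range (n + 1), a i x ∂m
          + ∫⁻ x, V j x * ∑ i ∈ Finset.range j, a i x ∂m) := by
        rw [lintegral_const_mul' _ _ ENNReal.ofReal_ne_top,
          lintegral_add_right _ hVP,
          lintegral_finsetSum _ fun n _ => hDP n]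
    _ ≤ ENNReal.ofReal (p / 2)
        * (∑ n ∈ Finset.range j, C * ∫⁻ x, (V n x - V (n + 1) x) * H x ^ 2 ∂m
          + C * ∫⁻ x, V j x * H x ^ 2 ∂m) := by
        gcongr with n
        · exact hD n
    _ = ENNReal.ofReal (p / 2) * (C * ∫⁻ x, (∑ n ∈ Finset.range j, (V n x - V (n + 1) x) + V j x)
          * H x ^ 2 ∂m) := by
        simp only [add_mul, Finset.sum_mul]
        rw [lintegral_add_right _ hVH,
          lintegral_finsetSum _ fun n _ => hDH n, mul_add (C : ℝ≥0∞), Finset.mul_sum]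
    _ ≤ ENNReal.ofReal (p / 2) * (C * ∫⁻ x, V 0 x * H x ^ 2 ∂m) := by
        gcongr with x
        exact sum_range_tsub_add_le (hVanti x) j
    _ ≤ ENNReal.ofReal (p / 2) * (C * ∫⁻ x, (W 0 x + B * H x) ^ (p - 2) * H x ^ 2 ∂m) := by
        gcongr with x
        exact ENNReal.rpow_le_rpow (hψW 0 x) (by linarith)
    _ = _ := by
        rw [← mul_assoc]
        push_cast
        rfl

/-- The square function over large scales is bounded on `L^p` for `p > 2`. -/
theorem exists_squareOn_rpow_le_of_two_lt {p : ℝ} (hp : 2 < p) : ∃ C : ℝ≥0, ∀ f : X → ℂ,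
    Measurable f → BallIntegrable m f → ∫⁻ x, ‖f x‖ₑ ^ p ∂m ≠ ∞ →
    ∫⁻ x, squareOn m δ c (Ioi M) f x ^ p ∂m ≤ C * ∫⁻ x, ‖f x‖ₑ ^ p ∂m := by
  obtain ⟨B, C₁, h₁⟩ := G.exists_squareOn_rpow_le_mixed hp
  obtain ⟨C₂, h₂⟩ := exists_absorb hp B C₁
  obtain ⟨C₃, h₃⟩ := G.exists_sqMaxFun_rpow_le hp
  refine ⟨C₂ * C₃, fun f hf hbi hfin => ?_⟩
  have hsup : ∀ x, squareOn m δ c (Ioi M) f x ^ p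
      = ⨆ j : ℕ, squareOn m δ c (Ioc M (M + j)) f x ^ p := fun x => by
    rw [squareOn, ellTwo_indicator_Ioi_eq_iSup]
    exact (ENNReal.orderIsoRpow p (by linarith)).map_iSup _
  simp only [hsup]
  rw [lintegral_iSup (fun j => (G.measurable_squareOn hf _).pow_const p)]
  · refine iSup_le fun j => ?_
    obtain ⟨D, hD⟩ := G.exists_squareOn_finset_rpow_le (p := p) (by linarith)
      (Finset.Ioc M (M + j)) fun n hn => G.ρ_le (Finset.mem_Ioc.1 hn).1.le
    -- Absorption needs finiteness, which is known a priori only for finitely many scales; monotone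
    -- convergence then removes the restriction.
    have hSfin : ∫⁻ x, squareOn m δ c (Ioc M (M + j)) f x ^ p ∂m ≠ ∞ := by
      have := hD f hf
      rw [Finset.coe_Ioc] at this
      exact ne_top_of_le_ne_top (by finiteness) this
    refine (h₂ (G.measurable_squareOn hf _) (G.measurable_sqMaxFun hf) hSfin
      (h₁ f hf hbi j)).trans ?_
    push_cast
    rw [mul_assoc]
    gcongr
    exact h₃ f hf
  · intro i j hij x
    refine ENNReal.rpow_le_rpow (ellTwo_mono fun n => ?_) (by linarith)
    exact indicator_le_indicator_of_subset (Ioc_subset_Ioc_right (by lia)) (fun _ => zero_le) n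

end CubeGrid

/-! ### Interpolation, the remaining small scales and mean oscillation -/

lemma enorm_sub_le_of_le_add {s t : ℝ} {u : ℝ≥0∞} (hs : 0 ≤ s) (ht : 0 ≤ t)
    (h1 : ENNReal.ofReal s ≤ ENNReal.ofReal t + u) (h2 : ENNReal.ofReal t ≤ ENNReal.ofReal s + u) :
    ‖s - t‖ₑ ≤ u := by
  rcases le_total s t with h | h
  · rw [← enorm_neg, neg_sub, Real.enorm_of_nonneg (by linarith), ENNReal.ofReal_sub _ hs]
    exact tsub_le_iff_left.2 h2
  · rw [Real.enorm_of_nonneg (by linarith), ENNReal.ofReal_sub _ ht]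
    exact tsub_le_iff_left.2 h1

namespace CubeGrid

variable {X : Type*} [PseudoMetricSpace X] [MeasurableSpace X] {m : Measure X}
  {I : ℤ → Type*} {c : ∀ k, X → I k} {z : ∀ k, I k → X} {δ c₀ C₀ ε K ρ : ℝ} {M : ℤ}
  (G : CubeGrid m c z δ c₀ C₀ ε K ρ M)

include G

/-- The square function over large scales is bounded on `L^p` for `1 < p < 2`. -/
theorem exists_squareOn_rpow_le_of_lt_two {p : ℝ} (hp : 1 < p) (hp2 : p < 2) : ∃ C : ℝ≥0,
    ∀ f : X → ℂ, Measurable f → BallIntegrable m f →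
    ∫⁻ x, squareOn m δ c (Ioi M) f x ^ p ∂m ≤ C * ∫⁻ x, ‖f x‖ₑ ^ p ∂m := by
  obtain ⟨C₁, h₁⟩ := G.exists_squareOn_weak
  obtain ⟨C₂, h₂⟩ := G.exists_squareOn_sq_le
  -- The height 3γ splits as 2γ for the weak type bound on the large part of f and γ for Chebyshev
  -- on the small part. The `+ 1` keeps the constant nonzero, so infinite integrals give a trivial
  -- bound.
  obtain ⟨C, h⟩ := marcinkiewicz_one_two hp hp2 3 (by norm_num) (C₁ + C₂ + 1)
  refine ⟨C, fun f hf hbi => ?_⟩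
  have := G.sigmaFinite
  refine h (G.measurable_squareOn hf _) hf.enorm (fun x => enorm_ne_top) fun t ht => ?_
  set γ := ENNReal.ofReal t with hγ
  have hγ0 : γ ≠ 0 := by simpa [hγ] using ht
  have hγt : γ ≠ ∞ := ENNReal.ofReal_ne_top
  set s := {x | γ < ‖f x‖ₑ} with hs
  have hsm : MeasurableSet s := measurableSet_lt measurable_const hf.enorm
  have hsc : {x | ‖f x‖ₑ ≤ γ} = sᶜ := by ext x; simp [hs]
  rw [hsc, ENNReal.ofReal_mul (by norm_num), ENNReal.ofReal_ofNat]
  have hC0 : ((C₁ + C₂ + 1 : ℝ≥0) : ℝ≥0∞) ≠ 0 := by positivity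
  have hγi : γ⁻¹ ≠ 0 := by simpa using hγt
  by_cases hi1 : ∫⁻ x in s, ‖f x‖ₑ ∂m = ∞
  · rw [hi1, ENNReal.mul_top (mul_ne_zero hC0 hγi), top_add]
    exact le_top
  by_cases hi2 : ∫⁻ x in sᶜ, ‖f x‖ₑ ^ 2 ∂m = ∞
  · rw [hi2, ENNReal.mul_top (mul_ne_zero hC0 (pow_ne_zero _ hγi)), add_top]
    exact le_top
  have hf1 : Measurable (s.indicator f) := hf.indicator hsm
  have hf2 : Measurable (sᶜ.indicator f) := hf.indicator hsm.compl
  have hb1 : BallIntegrable m (s.indicator f) := fun x r => (hbi x r).indicator hsm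
  have hb2 : BallIntegrable m (sᶜ.indicator f) := fun x r => (hbi x r).indicator hsm.compl
  have hn1 : ∫⁻ x, ‖s.indicator f x‖ₑ ∂m = ∫⁻ x in s, ‖f x‖ₑ ∂m := by
    rw [← lintegral_indicator hsm]
    refine lintegral_congr fun x => ?_
    by_cases hx : x ∈ s <;> simp [hx]
  have hn2 : ∫⁻ x, ‖sᶜ.indicator f x‖ₑ ^ 2 ∂m = ∫⁻ x in sᶜ, ‖f x‖ₑ ^ 2 ∂m := by
    rw [← lintegral_indicator hsm.compl]
    refine lintegral_congr fun x => ?_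
    by_cases hx : x ∈ s <;> simp [hx]
  have hL1 : Integrable (s.indicator f) m := by
    refine ⟨hf1.aestronglyMeasurable, ?_⟩
    rw [HasFiniteIntegral, hn1]
    exact Ne.lt_top hi1
  have hL2 : MemLp (sᶜ.indicator f) 2 m := by
    refine ⟨hf2.aestronglyMeasurable, ?_⟩
    by_contra hcon
    rw [not_lt, top_le_iff] at hcon
    rw [← hn2, ← eLpNorm_two_sq, hcon] at hi2
    simp at hi2
  have hle : ∀ x, squareOn m δ c (Ioi M) f x ≤ squareOn m δ c (Ioi M) (s.indicator f) x
      + squareOn m δ c (Ioi M) (sᶜ.indicator f) x := fun x => by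
    refine le_of_eq_of_le ?_ (G.squareOn_add_le hb1 hb2 (Ioi M) x)
    congr 1
    funext y
    exact (congrFun (indicator_self_add_compl s f) y).symm
  have hsub : {x | 3 * γ < squareOn m δ c (Ioi M) f x}
      ⊆ {x | 2 * γ < squareOn m δ c (Ioi M) (s.indicator f) x}
        ∪ {x | γ ^ 2 ≤ squareOn m δ c (Ioi M) (sᶜ.indicator f) x ^ 2} := by
    intro x hx
    by_contra hcon
    simp only [mem_union, mem_ofPred_eq, not_or, not_lt, not_le] at hcon hx
    have h3 := lt_of_not_ge fun h => absurd hcon.2 (not_lt.2 (pow_le_pow_left' h 2))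
    refine absurd hx (not_lt.2 ((hle x).trans ?_))
    calc _ ≤ 2 * γ + γ := add_le_add hcon.1 h3.le
      _ = 3 * γ := by ring
  refine (measure_mono hsub).trans ((measure_union_le _ _).trans (add_le_add ?_ ?_))
  · refine (h₁ _ hf1 hL1 γ hγ0 hγt).trans ?_
    rw [hn1, ← mul_assoc]
    gcongr
    exact le_self_add.trans le_self_add
  · have hmk := (mul_meas_ge_le_lintegral (μ := m)
      ((G.measurable_squareOn hf2 (Ioi M)).pow_const 2) (γ ^ 2)).trans (h₂ _ hf2 hL2)
    rw [hn2] at hmk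
    calc _ = γ⁻¹ ^ 2 * (γ ^ 2 * m {x | γ ^ 2 ≤ squareOn m δ c (Ioi M) (sᶜ.indicator f) x ^ 2}) := by
          rw [← mul_assoc, ← mul_pow, ENNReal.inv_mul_cancel hγ0 hγt, one_pow, one_mul]
      _ ≤ γ⁻¹ ^ 2 * (C₂ * ∫⁻ x in sᶜ, ‖f x‖ₑ ^ 2 ∂m) := by gcongr
      _ = C₂ * γ⁻¹ ^ 2 * ∫⁻ x in sᶜ, ‖f x‖ₑ ^ 2 ∂m := by ring
      _ ≤ _ := by
          gcongr
          exact le_add_self.trans le_self_add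

omit G in
lemma squareOn_Ioi_le {N M : ℤ} (f : X → ℂ) (x : X) :
    squareOn m δ c (Ioi N) f x
      ≤ squareOn m δ c (Finset.Ioc N M : Finset ℤ) f x + squareOn m δ c (Ioi M) f x := by
  refine le_trans (ellTwo_mono fun n => ?_) (ellTwo_indicator_union_le _ _ _)
  refine indicator_le_indicator_of_subset (fun n hn => ?_) (fun _ => zero_le) n
  simp only [Finset.coe_Ioc, mem_union, mem_Ioc, mem_Ioi] at hn ⊢
  lia

/-- The square function over all scales `n > N` is bounded on `L^p`. -/
theorem exists_squareOn_rpow_le {p : ℝ} (hp : 1 < p) {N : ℤ} (hN : ρ ≤ δ ^ (N + 1)) : ∃ C : ℝ≥0,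
    ∀ f : X → ℂ, Measurable f → MemLp f (ENNReal.ofReal p) m →
    ∫⁻ x, squareOn m δ c (Ioi N) f x ^ p ∂m ≤ C * ∫⁻ x, ‖f x‖ₑ ^ p ∂m := by
  have hlarge : ∃ C : ℝ≥0, ∀ f : X → ℂ, Measurable f → MemLp f (ENNReal.ofReal p) m →
      ∫⁻ x, squareOn m δ c (Ioi M) f x ^ p ∂m ≤ C * ∫⁻ x, ‖f x‖ₑ ^ p ∂m := by
    have hbi : ∀ f : X → ℂ, MemLp f (ENNReal.ofReal p) m → BallIntegrable m f := fun f hfp =>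
      G.memLp_two_ballIntegrable (by rw [ENNReal.one_le_ofReal]; exact hp.le) hfp
    rcases lt_trichotomy p 2 with h | h | h
    · obtain ⟨C, hC⟩ := G.exists_squareOn_rpow_le_of_lt_two hp h
      exact ⟨C, fun f hf hfp => hC f hf (hbi f hfp)⟩
    · obtain ⟨C, hC⟩ := G.exists_squareOn_sq_le
      refine ⟨C, fun f hf hfp => ?_⟩
      subst h
      simp only [ENNReal.rpow_two]
      exact hC f hf (by simpa using hfp)
    · obtain ⟨C, hC⟩ := G.exists_squareOn_rpow_le_of_two_lt h
      refine ⟨C, fun f hf hfp => hC f hf (hbi f hfp) ?_⟩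
      have := lintegral_rpow_enorm_lt_top_of_eLpNorm_lt_top (by simpa using by linarith) (by simp) hfp.2
      rw [ENNReal.toReal_ofReal (by linarith)] at this
      exact this.ne
  obtain ⟨C, hC⟩ := hlarge
  -- The scales N < n ≤ M lie below the range of the cube estimates, but their balls still have
  -- radius at least ρ.
  obtain ⟨D, hD⟩ := G.exists_squareOn_finset_rpow_le hp.le (Finset.Ioc N M) fun n hn =>
    hN.trans (G.zpow_mono (by have := (Finset.mem_Ioc.1 hn).1; lia))
  refine ⟨2 ^ (p - 1) * (D + C), fun f hf hfp => ?_⟩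
  calc _ ≤ ∫⁻ x, 2 ^ (p - 1) * (squareOn m δ c (Finset.Ioc N M : Finset ℤ) f x ^ p
        + squareOn m δ c (Ioi M) f x ^ p) ∂m := lintegral_mono fun x =>
        (ENNReal.rpow_le_rpow (squareOn_Ioi_le f x) (by linarith)).trans
          (ENNReal.rpow_add_le_mul_rpow_add_rpow _ _ hp.le)
    _ = 2 ^ (p - 1) * (∫⁻ x, squareOn m δ c (Finset.Ioc N M : Finset ℤ) f x ^ p ∂m
        + ∫⁻ x, squareOn m δ c (Ioi M) f x ^ p ∂m) := by
        have h1 := (G.measurable_squareOn hf (Finset.Ioc N M : Finset ℤ)).pow_const p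
        have h2 := (G.measurable_squareOn hf (Ioi M)).pow_const p
        have h12 : Measurable fun x => squareOn m δ c (Finset.Ioc N M : Finset ℤ) f x ^ p
          + squareOn m δ c (Ioi M) f x ^ p := h1.add h2
        rw [lintegral_const_mul _ h12, lintegral_add_left h1]
    _ ≤ 2 ^ (p - 1) * (D * ∫⁻ x, ‖f x‖ₑ ^ p ∂m + C * ∫⁻ x, ‖f x‖ₑ ^ p ∂m) := by
        gcongr
        · exact hD f hf
        · exact hC f hf hfp
    _ = _ := by
        push_cast [ENNReal.coe_rpow_of_nonneg _ (sub_nonneg.2 hp.le)]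
        ring

/-- The square function over all scales `n > N` is of weak type `(1, 1)`. -/
theorem exists_squareOn_weak_type {N : ℤ} (hN : ρ ≤ δ ^ (N + 1)) : ∃ C : ℝ≥0, ∀ f : X → ℂ,
    Measurable f → Integrable f m → ∀ γ : ℝ≥0∞, γ ≠ 0 → γ ≠ ∞ →
      m {x | γ < squareOn m δ c (Ioi N) f x} ≤ C * (γ⁻¹ * ∫⁻ y, ‖f y‖ₑ ∂m) := by
  obtain ⟨C, hC⟩ := G.exists_squareOn_weak
  obtain ⟨D, hD⟩ := G.exists_squareOn_finset_rpow_le le_rfl (Finset.Ioc N M) fun n hn =>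
    hN.trans (G.zpow_mono (by have := (Finset.mem_Ioc.1 hn).1; lia))
  simp only [ENNReal.rpow_one] at hD
  refine ⟨3 * (D + C), fun f hf hfi γ' hγ0' hγt' => ?_⟩
  set γ := γ' / 3 with hγ
  have hγ0 : γ ≠ 0 := by simp [hγ, hγ0']
  have hγt : γ ≠ ∞ := ENNReal.div_ne_top hγt' (by norm_num)
  have h3 : γ' = 3 * γ := by
    rw [hγ, ENNReal.mul_div_cancel (by norm_num) (by norm_num)]
  have hinv : γ⁻¹ = 3 * γ'⁻¹ := by
    rw [hγ, div_eq_mul_inv, ENNReal.mul_inv (Or.inl hγ0') (Or.inl hγt'), inv_inv, mul_comm]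
  have hsub : {x | γ' < squareOn m δ c (Ioi N) f x}
      ⊆ {x | γ ≤ squareOn m δ c (Finset.Ioc N M : Finset ℤ) f x}
        ∪ {x | 2 * γ < squareOn m δ c (Ioi M) f x} := by
    intro x hx
    by_contra hcon
    simp only [mem_union, mem_ofPred_eq, not_or, not_lt, not_le] at hcon hx
    refine absurd hx (not_lt.2 ((squareOn_Ioi_le (M := M) f x).trans ?_))
    calc _ ≤ γ + 2 * γ := add_le_add hcon.1.le hcon.2
      _ = γ' := by rw [h3]; ring
  have h1 : m {x | γ ≤ squareOn m δ c (Finset.Ioc N M : Finset ℤ) f x}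
      ≤ D * (γ⁻¹ * ∫⁻ y, ‖f y‖ₑ ∂m) := by
    have hmk := (mul_meas_ge_le_lintegral (μ := m)
      (G.measurable_squareOn hf (Finset.Ioc N M : Finset ℤ)) γ).trans (hD f hf)
    calc _ = γ⁻¹ * (γ * m {x | γ ≤ squareOn m δ c (Finset.Ioc N M : Finset ℤ) f x}) := by
          rw [← mul_assoc, ENNReal.inv_mul_cancel hγ0 hγt, one_mul]
      _ ≤ γ⁻¹ * (D * ∫⁻ y, ‖f y‖ₑ ∂m) := by gcongr
      _ = _ := by ring
  refine (measure_mono hsub).trans ((measure_union_le _ _).trans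
    ((add_le_add h1 (hC f hf hfi γ hγ0 hγt)).trans (le_of_eq ?_)))
  rw [hinv]
  push_cast
  ring

omit G in
lemma enorm_avgDiff_le_of_le {f : X → ℂ} {a : ℝ≥0∞} (ha : ∀ᵐ y ∂m, ‖f y‖ₑ ≤ a) (n : ℤ) (x : X) :
    ‖avgDiff m δ c n f x‖ₑ ≤ 2 * a := by
  have key : ∀ s : Set X, ‖⨍ y in s, f y ∂m‖ₑ ≤ a := fun s => by
    refine (enorm_setAverage_le m s f).trans ?_
    calc _ ≤ (m s)⁻¹ * ∫⁻ _ in s, a ∂m :=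
          mul_le_mul' le_rfl (lintegral_mono_ae (ae_restrict_of_ae ha))
      _ = (m s)⁻¹ * m s * a := by rw [setLIntegral_const]; ring
      _ ≤ a := mul_le_of_le_one_left' (ENNReal.inv_mul_le_one _)
  rw [two_mul]
  exact enorm_sub_le.trans (add_le_add (key _) (key _))

/-- Mean oscillation of the square function over cubes. -/
theorem exists_oscillation_le {N : ℤ} (hNM : N ≤ M) : ∃ C : ℝ≥0, ∀ f : X → ℂ, Measurable f →
    BallIntegrable m f → ∀ a : ℝ≥0∞, (∀ᵐ y ∂m, ‖f y‖ₑ ≤ a) →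
    (∀ᵐ x ∂m, squareOn m δ c (Ioi N) f x < ∞) → ∀ k (i : I k), ∃ t : ℝ,
      ∫⁻ y in c k ⁻¹' {i}, ‖(squareOn m δ c (Ioi N) f y).toReal - t‖ₑ ∂m
        ≤ C * a * m (c k ⁻¹' {i}) := by
  obtain ⟨B, hB⟩ := G.exists_squareOn_le_add
  obtain ⟨C, hC⟩ := G.exists_setLIntegral_squareOn_sq_le
  refine ⟨(Finset.Ioc N M).card * 2 + C ^ (1 / 2 : ℝ) + B,
    fun f hf hbi a ha hfin k i => ?_⟩
  set P := c k ⁻¹' {i} with hP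
  have hPm : MeasurableSet P := G.measurableSet_fibre k i
  by_cases hP0 : m P = 0
  · refine ⟨0, ?_⟩
    rw [setLIntegral_measure_zero _ _ hP0]
    exact zero_le
  obtain ⟨x₀, hx₀P, hx₀⟩ : ∃ x ∈ P, squareOn m δ c (Ioi N) f x < ∞ := by
    by_contra hcon
    push Not at hcon
    refine hP0 (measure_mono_null (fun x hx => ?_) hfin)
    exact not_lt.2 (hcon x hx)
  have hH : ∀ x, sqMaxFun m δ M f x ≤ a := G.sqMaxFun_le_of_le ha
  -- Three ranges of scales: up to M each term is at most 2a; from M to L, empty if k ≤ M, the local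
  -- L² bound applies; above L the square function is almost constant on the cube, and its value at
  -- x₀ is the constant t.
  set L := max k M with hL
  have hML : M ≤ L := le_max_right _ _
  have hkL : k ≤ L := le_max_left _ _
  have hNL : N ≤ L := hNM.trans hML
  have hmono : ∀ x, squareOn m δ c (Ioi L) f x ≤ squareOn m δ c (Ioi N) f x := fun x =>
    ellTwo_mono fun n => indicator_le_indicator_of_subset (Ioi_subset_Ioi hNL) (fun _ => zero_le) n
  set t := squareOn m δ c (Ioi L) f x₀ with ht
  have htt : t ≠ ∞ := ((hmono x₀).trans_lt hx₀).ne
  have hosc : ∀ x ∈ P, ∀ y ∈ P,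
      squareOn m δ c (Ioi L) f x ≤ squareOn m δ c (Ioi L) f y + B * a := fun x hx y hy => by
    have hxy : c L y = c L x := G.nested k L hkL y x (hy.trans hx.symm)
    exact (hB L hML _ Ioi_subset_Ici_self f hf hbi x y y hxy hxy).trans
      (add_le_add le_rfl (mul_le_mul' le_rfl (hH y)))
  set D : ℝ≥0∞ := (Finset.Ioc N M).card * 2 with hD
  have hlow : ∀ x, squareOn m δ c (Finset.Ioc N M : Finset ℤ) f x ≤ D * a := fun x => by
    refine (ellTwo_indicator_finset_le _ _).trans ?_
    refine (Finset.sum_le_card_nsmul _ _ (2 * a) fun n _ =>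
      enorm_avgDiff_le_of_le ha n x).trans (le_of_eq ?_)
    rw [nsmul_eq_mul, hD, mul_assoc]
  have hsplit : ∀ x, squareOn m δ c (Ioi N) f x
      ≤ D * a + (squareOn m δ c (Ioc M L) f x + squareOn m δ c (Ioi L) f x) := fun x => by
    refine (squareOn_Ioi_le (M := M) f x).trans (add_le_add (hlow x) ?_)
    rw [squareOn, ← Ioc_union_Ioi_eq_Ioi hML]
    exact ellTwo_indicator_union_le _ _ _
  have hmid : ∫⁻ y in P, squareOn m δ c (Ioc M L) f y ^ 2 ∂m ≤ C * m P * a ^ 2 := by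
    rcases le_total M k with h | h
    · have hLk : L = k := max_eq_left h
      have h1 := hC k h (Ioc M L) (by rw [hLk]) f hf x₀
      rw [show c k x₀ = i from hx₀P] at h1
      exact h1.trans (mul_le_mul' le_rfl (pow_le_pow_left' (hH x₀) 2))
    · have hLM : L = M := max_eq_right h
      have h0 : ∀ y, squareOn m δ c (Ioc M L) f y ^ 2 = 0 := fun y => by
        rw [hLM, Ioc_self, squareOn, indicator_empty, ellTwo_sq]
        simp
      simp only [h0, lintegral_zero]
      exact zero_le
  have hmid1 : ∫⁻ y in P, squareOn m δ c (Ioc M L) f y ∂m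
      ≤ (C ^ (1 / 2 : ℝ) : ℝ≥0) * a * m P := by
    have h1 := lintegral_mul_rpow_le (ν := m.restrict P) (k := fun _ => 1) measurable_const
      (G.measurable_squareOn hf (Ioc M L)) one_le_two
    rw [show (2 : ℝ) - 1 = 1 by norm_num] at h1
    simp only [one_mul, ENNReal.rpow_one, ENNReal.rpow_two, lintegral_const,
      Measure.restrict_apply_univ] at h1
    refine le_of_sq_le_sq_ennreal (h1.trans ((mul_le_mul' le_rfl hmid).trans (le_of_eq ?_)))
    have hp : ((C ^ (1 / 2 : ℝ) : ℝ≥0) : ℝ≥0∞) ^ 2 = C := by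
      rw [ENNReal.coe_rpow_of_nonneg _ (by norm_num), sqrt_sq_ennreal]
    rw [mul_pow, mul_pow, hp]
    ring
  refine ⟨t.toReal, ?_⟩
  have hpt : ∀ᵐ y ∂m.restrict P, ‖(squareOn m δ c (Ioi N) f y).toReal - t.toReal‖ₑ
      ≤ squareOn m δ c (Ioc M L) f y + (D + B) * a := by
    filter_upwards [ae_restrict_of_ae hfin, ae_restrict_mem hPm] with y hy hyP
    refine enorm_sub_le_of_le_add ENNReal.toReal_nonneg ENNReal.toReal_nonneg ?_ ?_
    · rw [ENNReal.ofReal_toReal hy.ne, ENNReal.ofReal_toReal htt]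
      calc _ ≤ D * a + (squareOn m δ c (Ioc M L) f y + (t + B * a)) :=
            (hsplit y).trans (by gcongr; exact hosc y hyP x₀ hx₀P)
        _ = _ := by ring
    · rw [ENNReal.ofReal_toReal hy.ne, ENNReal.ofReal_toReal htt]
      calc t ≤ squareOn m δ c (Ioi N) f y + B * a :=
            (hosc x₀ hx₀P y hyP).trans (add_le_add (hmono y) le_rfl)
        _ ≤ _ := by
            gcongr
            rw [add_mul]
            exact le_add_self.trans le_add_self
  calc _ ≤ ∫⁻ y in P, (squareOn m δ c (Ioc M L) f y + (D + B) * a) ∂m := lintegral_mono_ae hpt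
    _ = ∫⁻ y in P, squareOn m δ c (Ioc M L) f y ∂m + (D + B) * a * m P := by
        rw [lintegral_add_right _ measurable_const, setLIntegral_const]
    _ ≤ (C ^ (1 / 2 : ℝ) : ℝ≥0) * a * m P + (D + B) * a * m P := by gcongr
    _ = _ := by rw [hD]; push_cast; ring

end CubeGrid

/-! ### Annular decay, countable nets and measurability of the metric -/

section Geometry

variable {X : Type*} [PseudoMetricSpace X] [MeasurableSpace X] {m : Measure X}

/-- Annular decay passes to the endpoint `r = r₀`. -/
lemma AnnularDecay.exists_measureReal_le {ε r₀ : ℝ} (hr₀ : 0 < r₀)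
    (h : AnnularDecay (dist : X → X → ℝ) m ε r₀)
    (hmeas : ∀ (x : X) r, MeasurableSet (closedBall x r))
    (hfin : ∀ (x : X) r, m (closedBall x r) ≠ ∞) :
    ∃ K : ℝ, 0 < K ∧ ∀ (x : X) r, r₀ ≤ r → ∀ s, 0 < s → s ≤ r →
      m.real (closedBall x (r + s)) ≤ (1 + K * (s / r) ^ ε) * m.real (closedBall x r) := by
  obtain ⟨K, hK, h⟩ := h
  refine ⟨K, hK, fun x r hr s hs hsr => ?_⟩
  have h1 : ∀ r, r₀ < r → ∀ s, 0 < s → s ≤ r →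
      m.real (closedBall x (r + s)) ≤ (1 + K * (s / r) ^ ε) * m.real (closedBall x r) :=
    fun r hr s hs hsr => by
      have h3 : m.real (closedBall x (r + s)) - m.real (closedBall x r)
        ≤ K * (s / r) ^ ε * m.real (closedBall x r) := h x r hr s hs hsr
      linarith
  have hrpos : 0 < r := hr₀.trans_le hr
  have hlim : Filter.Tendsto (fun n : ℕ => r + 1 / ((n : ℝ) + 1)) Filter.atTop (nhds r) := by
    simpa using tendsto_one_div_add_atTop_nhds_zero_nat.const_add r
  have hball : Filter.Tendsto (fun n : ℕ => m.real (closedBall x (r + 1 / ((n : ℝ) + 1))))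
      Filter.atTop (nhds (m.real (closedBall x r))) := by
    have h2 := tendsto_measure_iInter_atTop (μ := m)
      (s := fun n : ℕ => closedBall x (r + 1 / ((n : ℝ) + 1)))
      (fun n => (hmeas _ _).nullMeasurableSet)
      (fun i j hij => Metric.closedBall_subset_closedBall (by gcongr)) ⟨0, hfin _ _⟩
    have h3 : ⋂ n : ℕ, closedBall x (r + 1 / ((n : ℝ) + 1)) = closedBall x r := by
      ext y
      simp only [mem_iInter, mem_closedBall]
      refine ⟨fun hy => ge_of_tendsto' hlim hy, fun hy n => hy.trans ?_⟩
      have : (0 : ℝ) < 1 / ((n : ℝ) + 1) := by positivity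
      linarith
    rw [h3] at h2
    exact (ENNReal.tendsto_toReal (hfin _ _)).comp h2
  have hrhs : Filter.Tendsto (fun n : ℕ => (1 + K * (s / (r + 1 / ((n : ℝ) + 1))) ^ ε)
      * m.real (closedBall x (r + 1 / ((n : ℝ) + 1)))) Filter.atTop
      (nhds ((1 + K * (s / r) ^ ε) * m.real (closedBall x r))) := by
    have h4 : Filter.Tendsto (fun n : ℕ => s / (r + 1 / ((n : ℝ) + 1))) Filter.atTop
        (nhds (s / r)) := tendsto_const_nhds.div hlim hrpos.ne'
    exact (((h4.rpow_const (Or.inl (by positivity))).const_mul K).const_add 1).mul hball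
  refine ge_of_tendsto' hrhs fun n => ?_
  have hn : (0 : ℝ) < 1 / ((n : ℝ) + 1) := by positivity
  refine le_trans ?_ (h1 (r + 1 / ((n : ℝ) + 1)) (by linarith) s hs (by linarith))
  exact measureReal_mono (Metric.closedBall_subset_closedBall (by linarith)) (hfin _ _)

/-- A nonzero measure with annular decay is positive on large balls. -/
lemma measure_closedBall_ne_zero_of_decay {ε r₀ K : ℝ} (hr₀ : 0 < r₀) (hm : m ≠ 0)
    (hfin : ∀ (x : X) r, m (closedBall x r) ≠ ∞)
    (h : ∀ (x : X) r, r₀ ≤ r → ∀ s, 0 < s → s ≤ r →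
      m.real (closedBall x (r + s)) ≤ (1 + K * (s / r) ^ ε) * m.real (closedBall x r))
    (x : X) {r : ℝ} (hr : r₀ ≤ r) : m (closedBall x r) ≠ 0 := by
  intro h0
  have hr0 : 0 < r := hr₀.trans_le hr
  -- Doubling spreads a null ball to all its dilates, hence to the whole space.
  have key : ∀ j : ℕ, m (closedBall x (2 ^ j * r)) = 0 := by
    intro j
    induction j with
    | zero => simpa using h0
    | succ j ih =>
      have hj : r ≤ 2 ^ j * r := le_mul_of_one_le_left hr0.le (one_le_pow₀ (by norm_num))
      have h1 := h x (2 ^ j * r) (hr.trans hj) (2 ^ j * r) (by positivity) le_rfl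
      rw [measureReal_def, measureReal_def, ih, ENNReal.toReal_zero, mul_zero] at h1
      have h2 : (m (closedBall x (2 ^ j * r + 2 ^ j * r))).toReal = 0 :=
        le_antisymm h1 ENNReal.toReal_nonneg
      rw [show (2 : ℝ) ^ (j + 1) * r = 2 ^ j * r + 2 ^ j * r by ring]
      exact ((ENNReal.toReal_eq_zero_iff _).1 h2).resolve_right (hfin _ _)
  have huniv : ⋃ j : ℕ, closedBall x (2 ^ j * r) = univ := by
    refine eq_univ_of_forall fun y => mem_iUnion.2 ?_
    obtain ⟨j, hj⟩ := pow_unbounded_of_one_lt (dist y x / r) (one_lt_two (α := ℝ))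
    exact ⟨j, mem_closedBall.2 (by rw [div_lt_iff₀ hr0] at hj; exact hj.le)⟩
  refine hm (Measure.measure_univ_eq_zero.1 ?_)
  rw [← huniv]
  exact measure_iUnion_null key

/-- A maximal disjoint family of balls of radius r is countable, since an s-finite measure charges
only countably many disjoint sets. By maximality its centres are 2r-dense. -/
lemma exists_countable_net_of_measure_pos [SFinite m] {r : ℝ}
    (hmeas : ∀ x : X, MeasurableSet (closedBall x r)) (hpos : ∀ x : X, m (closedBall x r) ≠ 0)
    (hr : 0 ≤ r) : ∃ D : Set X, D.Countable ∧ ∀ x, ∃ y ∈ D, dist x y ≤ 2 * r := by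
  obtain ⟨D, hD⟩ := zorn_subset {A : Set X | A.PairwiseDisjoint fun x => closedBall x r}
    fun 𝒞 h𝒞 hchain => ⟨⋃₀ 𝒞, (pairwiseDisjoint_sUnion hchain.directedOn).2 fun A hA => h𝒞 hA,
      fun A hA => subset_sUnion_of_mem hA⟩
  refine ⟨D, ?_, fun x => ?_⟩
  · have h1 := Measure.countable_meas_pos_of_disjoint_iUnion (μ := m)
      (As := fun x : D => closedBall (x : X) r) (fun x => hmeas x)
      fun x y hxy => hD.prop x.2 y.2 (Subtype.coe_injective.ne hxy)
    have h2 : {x : D | 0 < m (closedBall (x : X) r)} = univ :=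
      eq_univ_of_forall fun x => (pos_iff_ne_zero.2 (hpos x) :)
    rw [h2, countable_univ_iff] at h1
    exact h1
  · by_contra hcon
    push Not at hcon
    have hins : insert x D ∈ {A : Set X | A.PairwiseDisjoint fun x => closedBall x r} := by
      refine hD.prop.insert fun y hy _ => ?_
      have := hcon y hy
      exact Metric.closedBall_disjoint_closedBall (by linarith)
    have hx : x ∈ D := hD.le_of_ge hins (subset_insert x D) (mem_insert x D)
    have := hcon x hx
    rw [dist_self] at this
    linarith

omit [MeasurableSpace X] in
/-- Geometric doubling refines a countable net. -/
lemma GeomDoubling.exists_countable_net {D₀ : ℕ} {R : ℝ} (hR : 0 < R)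
    (h : GeomDoubling (dist : X → X → ℝ) D₀ R)
    (h₀ : ∃ D : Set X, D.Countable ∧ ∀ x, ∃ y ∈ D, dist x y ≤ R) (j : ℕ) :
    ∃ D : Set X, D.Countable ∧ ∀ x, ∃ y ∈ D, dist x y ≤ R / 2 ^ j := by
  induction j with
  | zero => simpa using h₀
  | succ j ih =>
    obtain ⟨D, hDc, hD⟩ := ih
    choose t _ ht using h (R / 2 ^ j) (by positivity) (div_le_self hR.le (one_le_pow₀ (by norm_num)))
    refine ⟨⋃ y ∈ D, (t y : Set X), hDc.biUnion fun y _ => (t y).countable_toSet, fun x => ?_⟩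
    obtain ⟨y, hy, hxy⟩ := hD x
    have hx := ht y (show x ∈ dBall dist y (R / 2 ^ j) from hxy)
    simp only [mem_iUnion] at hx
    obtain ⟨w, hw, hxw⟩ := hx
    refine ⟨w, mem_biUnion hy hw, (show dist x w ≤ R / 2 ^ j / 2 from hxw).trans (le_of_eq ?_)⟩
    rw [pow_succ, div_div]

lemma exists_two_mul_div_pow_lt {R η : ℝ} (hη : 0 < η) : ∃ j : ℕ, 2 * (R / 2 ^ j) < η := by
  obtain ⟨j, hj⟩ := pow_unbounded_of_one_lt (2 * R / η) (one_lt_two (α := ℝ))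
  refine ⟨j, ?_⟩
  rw [div_lt_iff₀ hη] at hj
  rw [← mul_div_assoc, div_lt_iff₀ (by positivity)]
  linarith

/-- The distance is measurable if balls are and there are countable nets of all scales. -/
lemma measurable_dist_of_nets {R : ℝ} (hmeas : ∀ (x : X) r, MeasurableSet (closedBall x r))
    (hnet : ∀ j : ℕ, ∃ D : Set X, D.Countable ∧ ∀ x, ∃ y ∈ D, dist x y ≤ R / 2 ^ j) :
    Measurable fun p : X × X => dist p.1 p.2 := by
  choose D hDc hD using hnet
  refine measurable_of_Iic fun r => ?_
  -- Countable unions of measurable rectangles approximate the sublevel set from outside, so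
  -- measurability holds in the product σ-algebra without any topology.
  have : (fun p : X × X => dist p.1 p.2) ⁻¹' Iic r
      = ⋂ j : ℕ, ⋃ x ∈ D j, closedBall x (R / 2 ^ j) ×ˢ closedBall x (r + R / 2 ^ j) := by
    ext ⟨u, v⟩
    simp only [mem_preimage, mem_Iic, mem_iInter, mem_iUnion, mem_prod, mem_closedBall]
    constructor
    · intro huv j
      obtain ⟨x, hx, hux⟩ := hD j u
      refine ⟨x, hx, hux, ?_⟩
      have := dist_triangle_left v x u
      linarith
    · intro h
      by_contra hcon
      push Not at hcon
      obtain ⟨j, hj⟩ := exists_two_mul_div_pow_lt (R := R) (sub_pos.2 hcon)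
      obtain ⟨x, hx, hux, hvx⟩ := h j
      have := dist_triangle_right u v x
      linarith
  rw [this]
  exact MeasurableSet.iInter fun j => MeasurableSet.biUnion (hDc j) fun x _ =>
    (hmeas _ _).prod (hmeas _ _)

end Geometry

/-! ### From dyadic systems to cube grids -/

namespace IsDyadicSystem

section Disjoint

variable {X : Type*} [MeasurableSpace X] {d : X → X → ℝ} {c₀ C₀ δ : ℝ} {I : ℤ → Type*}
  {z : ∀ k, I k → X} {Q : ∀ k, I k → Set X} (h : IsDyadicSystem d c₀ C₀ δ z Q)

include h

/-- Within one generation the nesting axiom alone would allow one cube to contain another. A cube of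
generation k - 1 through the centre of the first would then lie in both, against uniqueness of its
ancestor. -/
lemma eq_of_mem_of_mem (hd : ∀ x, d x x = 0) {k : ℤ} {α β : I k} {x : X} (hα : x ∈ Q k α)
    (hβ : x ∈ Q k β) : α = β := by
  have hsub : ∀ {k l : ℤ}, k ≤ l → ∀ {α : I k} {β : I l} {x}, x ∈ Q k α → x ∈ Q l β →
      Q k α ⊆ Q l β := fun hkl α β x hα hβ =>
    (h.nested _ _ hkl α β).resolve_right (nonempty_iff_ne_empty.1 ⟨x, hα, hβ⟩)
  have hzα : z k α ∈ Q k α := by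
    have h0 : 0 < δ := zero_lt_one.trans h.one_lt
    have h1 : 0 ≤ c₀ / 3 * δ ^ k := by
      have := h.c₀_pos
      positivity
    exact h.ball_subset k α (show d (z k α) (z k α) ≤ _ by rw [hd]; exact h1)
  obtain ⟨γ, hγ⟩ : ∃ γ, z k α ∈ Q (k - 1) γ := by
    rw [← mem_iUnion, h.iUnion_eq]; trivial
  have hγα : Q (k - 1) γ ⊆ Q k α := hsub (by lia) hγ hzα
  exact (h.existsUnique_ancestor (k - 1) k (by lia) γ).unique hγα
    (hγα.trans (hsub le_rfl hα hβ))

end Disjoint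

variable {X : Type*} [PseudoMetricSpace X] [MeasurableSpace X] {m : Measure X}
  {c₀ C₀ δ : ℝ} {I : ℤ → Type*} {z : ∀ k, I k → X} {Q : ∀ k, I k → Set X}

/-- The cubes of a dyadic system form a `CubeGrid`. -/
theorem exists_cubeGrid (h : IsDyadicSystem (dist : X → X → ℝ) c₀ C₀ δ z Q) (hm : m ≠ 0)
    (hmeas : ∀ (x : X) r, MeasurableSet (closedBall x r))
    (hfin : ∀ (x : X) r, m (closedBall x r) ≠ ∞) {r₀ ε : ℝ} (hr₀ : 0 < r₀) (hε : 0 < ε)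
    {D₀ : ℕ} (hdecay : AnnularDecay (dist : X → X → ℝ) m ε r₀)
    (hdoubling : GeomDoubling (dist : X → X → ℝ) D₀ (4 * r₀)) (N : ℤ) :
    ∃ (c : ∀ k, X → I k) (K : ℝ) (M : ℤ), N ≤ M ∧ (∀ k α, c k ⁻¹' {α} = Q k α) ∧
      CubeGrid m c z δ c₀ C₀ ε K r₀ M := by
  have hc₀ := h.c₀_pos
  have hδ0 : 0 < δ := zero_lt_one.trans h.one_lt
  have hex : ∀ k x, ∃ α, x ∈ Q k α := fun k x => by
    rw [← mem_iUnion, h.iUnion_eq]; trivial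
  choose c hc using hex
  have hcQ : ∀ k α, c k ⁻¹' {α} = Q k α := fun k α => by
    ext x
    refine ⟨fun hx => hx ▸ hc k x, fun hx => h.eq_of_mem_of_mem dist_self (hc k x) hx⟩
  obtain ⟨K, hK, hdec⟩ := hdecay.exists_measureReal_le hr₀ hmeas hfin
  have hpos : ∀ (x : X) r, r₀ ≤ r → m (closedBall x r) ≠ 0 := fun x r hr =>
    measure_closedBall_ne_zero_of_decay hr₀ hm hfin hdec x hr
  have hσ : SigmaFinite m := by
    rcases isEmpty_or_nonempty X with hX | ⟨⟨x⟩⟩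
    · exact absurd (Measure.eq_zero_of_isEmpty m) hm
    · exact ⟨⟨⟨fun n => closedBall x n, fun _ => trivial, fun n => (hfin x n).lt_top,
        Metric.iUnion_closedBall_nat x⟩⟩⟩
  have hnet : ∀ j : ℕ, ∃ D : Set X, D.Countable ∧ ∀ x, ∃ y ∈ D, dist x y ≤ 4 * r₀ / 2 ^ j := by
    refine hdoubling.exists_countable_net (by positivity) ?_
    obtain ⟨D, hD, hD'⟩ := exists_countable_net_of_measure_pos (m := m) (fun x => hmeas x r₀)
      (fun x => hpos x r₀ le_rfl) hr₀.le
    refine ⟨D, hD, fun x => ?_⟩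
    obtain ⟨y, hy, hxy⟩ := hD' x
    exact ⟨y, hy, by linarith⟩
  -- The centres are separated, so on a net finer than half the separation distinct centres have
  -- distinct nearby net points.
  have hcount : ∀ k, Countable (I k) := fun k => by
    obtain ⟨j, hj⟩ := exists_two_mul_div_pow_lt (R := 4 * r₀) (show 0 < c₀ * δ ^ k by positivity)
    obtain ⟨D, hDc, hD⟩ := hnet j
    choose y hy hzy using fun α : I k => hD (z k α)
    have := hDc.to_subtype
    refine Function.Injective.countable (f := fun α => (⟨y α, hy α⟩ : D)) fun α β hαβ => ?_
    by_contra hne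
    have h1 := h.separated k α β hne
    have h2 : y α = y β := congrArg Subtype.val hαβ
    have h3 := hzy α
    have h4 := hzy β
    rw [h2] at h3
    have := dist_triangle_right (z k α) (z k β) (y β)
    linarith
  -- The two entries give `scale_le` and `scale_le'`: the cores of the cubes and the balls of radius
  -- δ^M/2 are large enough for annular decay.
  obtain ⟨j, hj⟩ := pow_unbounded_of_one_lt (max (18 * r₀ / c₀) (2 * r₀)) h.one_lt
  have hjM : δ ^ j ≤ δ ^ max N (j : ℤ) := by
    rw [← zpow_natCast]
    exact zpow_le_zpow_right₀ h.one_lt.le (le_max_right _ _)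
  refine ⟨c, K, max N j, le_max_left _ _, hcQ, ?_⟩
  exact {
    one_lt := h.one_lt
    c₀_pos := hc₀
    C₀_pos := hc₀.trans h.c₀_lt
    small := by
      have := h.small
      rwa [← div_eq_mul_inv, div_le_iff₀ hδ0] at this
    ε_pos := hε
    K_pos := hK
    ρ_pos := hr₀
    measurable_dist := measurable_dist_of_nets hmeas hnet
    countable := hcount
    measurableSet_fibre := fun k α => by rw [hcQ]; exact h.measurableSet k α
    nested := fun k l hkl x y hxy => by
      have hx := hc k x
      have hy := hc k y
      rw [← hxy] at hy
      have hsub := (h.nested k l hkl (c k x) (c l x)).resolve_right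
        (nonempty_iff_ne_empty.1 ⟨x, hx, hc l x⟩)
      exact h.eq_of_mem_of_mem dist_self (hsub hy) (hc l y)
    ball_subset := fun k α y hy => by
      have : y ∈ c k ⁻¹' {α} := by rw [hcQ]; exact h.ball_subset k α hy
      exact this
    dist_centre := fun k x => h.subset_ball k _ (hc k x)
    finite_ball := hfin
    pos_ball := hpos
    decay := fun x r hr s hs hsr => by
      have hr0 : 0 < r := hr₀.trans_le hr
      have h1 : 0 ≤ 1 + K * (s / r) ^ ε := by positivity
      rw [← ENNReal.ofReal_toReal (hfin x (r + s)), ← ENNReal.ofReal_toReal (hfin x r),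
        ← ENNReal.ofReal_mul h1]
      exact ENNReal.ofReal_le_ofReal (hdec x r hr s hs hsr)
    scale_le := by
      have h1 := (le_max_left _ _).trans (hj.le.trans hjM)
      rw [div_le_iff₀ hc₀] at h1
      linarith
    scale_le' := by
      have h1 := (le_max_right _ _).trans (hj.le.trans hjM)
      linarith }

lemma squareFun_eq_squareOn {c : ∀ k, X → I k} (hcQ : ∀ k α, c k ⁻¹' {α} = Q k α) (N : ℤ)
    (f : X → ℂ) (x : X) :
    squareFun (dist : X → X → ℝ) m δ Q N f x = squareOn m δ c (Ioi N) f x := by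
  have hE : ∀ k, dyadicExp m Q k f x = cellAvg m (c k) f x := fun k => by
    have h0 : ∀ α, α ≠ c k x → (Q k α).indicator (fun _ => ⨍ y in Q k α, f y ∂m) x = 0 :=
      fun α hα => indicator_of_notMem (by rw [← hcQ]; exact fun h => hα h.symm) _
    rw [dyadicExp, tsum_eq_single (c k x) h0, indicator_of_mem (by rw [← hcQ]; rfl), ← hcQ, cellAvg]
  rw [squareFun, squareOn, ellTwo,
    tsum_subtype (Ioi N) fun n => ‖ballAvg dist m (δ ^ n) f x - dyadicExp m Q n f x‖ₑ ^ 2]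
  congr 1
  refine tsum_congr fun n => ?_
  by_cases hn : n ∈ Ioi N
  · rw [indicator_of_mem hn, indicator_of_mem hn, hE]
    rfl
  · simp [indicator_of_notMem hn]

end IsDyadicSystem

/-! ### Assembling the theorem -/

/-- The square function depends only on the almost everywhere class of `f`. -/
lemma squareFun_congr_ae {X : Type*} [MeasurableSpace X] {d : X → X → ℝ} {m : Measure X} {δ : ℝ}
    {I : ℤ → Type*} {Q : ∀ k, I k → Set X} {N : ℤ} {f g : X → ℂ} (h : f =ᵐ[m] g) :
    squareFun d m δ Q N f = squareFun d m δ Q N g := by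
  have key : ∀ s : Set X, ⨍ y in s, f y ∂m = ⨍ y in s, g y ∂m := fun s =>
    average_congr (ae_restrict_of_ae h)
  funext x
  simp only [squareFun, ballAvg, dyadicExp, key]

/-- The pseudometric space defined by a metric. -/
abbrev IsMetric.toPseudoMetricSpace {X : Type*} {d : X → X → ℝ} (hd : IsMetric d) :
    PseudoMetricSpace X where
  dist := d
  dist_self x := (hd.eq_zero_iff x x).2 rfl
  dist_comm := hd.symm
  dist_triangle := hd.triangle

/-- The estimates for the square function of a measurable function. -/
theorem squareFun_estimates_of_dist {X : Type*} [PseudoMetricSpace X] [MeasurableSpace X]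
    {m : Measure X} (hm : m ≠ 0) (hmeas : ∀ (x : X) r, MeasurableSet (closedBall x r))
    (hfin : ∀ (x : X) r, m (closedBall x r) ≠ ∞) {r₀ ε : ℝ} (hr₀ : 0 < r₀) (hε : 0 < ε) {D₀ : ℕ}
    (hdecay : AnnularDecay (dist : X → X → ℝ) m ε r₀)
    (hdoubling : GeomDoubling (dist : X → X → ℝ) D₀ (4 * r₀))
    {c₀ C₀ δ : ℝ} {I : ℤ → Type*} {z : ∀ k, I k → X} {Q : ∀ k, I k → Set X}
    (hQ : IsDyadicSystem (dist : X → X → ℝ) c₀ C₀ δ z Q) {N : ℤ} (hN : r₀ ≤ δ ^ (N + 1)) :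
    (∀ f : X → ℂ, Measurable f → Measurable (squareFun (dist : X → X → ℝ) m δ Q N f)) ∧
    (∀ p : ℝ, 1 < p → ∃ C : ℝ≥0, ∀ f : X → ℂ, Measurable f → MemLp f (ENNReal.ofReal p) m →
      ∫⁻ x, squareFun (dist : X → X → ℝ) m δ Q N f x ^ p ∂m ≤ C * ∫⁻ x, ‖f x‖ₑ ^ p ∂m) ∧
    (∃ C : ℝ≥0, ∀ f : X → ℂ, Measurable f → Integrable f m → ∀ γ : ℝ≥0∞, γ ≠ 0 → γ ≠ ∞ →
      m {x | γ < squareFun (dist : X → X → ℝ) m δ Q N f x} ≤ C * (γ⁻¹ * ∫⁻ y, ‖f y‖ₑ ∂m)) ∧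
    (∃ C : ℝ≥0, ∀ f : X → ℂ, Measurable f → MemLp f 2 m → ∀ a : ℝ≥0∞, (∀ᵐ y ∂m, ‖f y‖ₑ ≤ a) →
      (∀ᵐ x ∂m, squareFun (dist : X → X → ℝ) m δ Q N f x < ∞) → ∀ k α, ∃ t : ℝ,
      ∫⁻ y in Q k α, ‖(squareFun (dist : X → X → ℝ) m δ Q N f y).toReal - t‖ₑ ∂m
        ≤ C * a * m (Q k α)) := by
  obtain ⟨c, K, M, hNM, hcQ, G⟩ := hQ.exists_cubeGrid hm hmeas hfin hr₀ hε hdecay hdoubling N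
  have hsq : ∀ f : X → ℂ, squareFun (dist : X → X → ℝ) m δ Q N f = squareOn m δ c (Ioi N) f :=
    fun f => funext fun x => IsDyadicSystem.squareFun_eq_squareOn hcQ N f x
  simp only [hsq, ← hcQ]
  refine ⟨fun f hf => G.measurable_squareOn hf _,
    fun p hp => G.exists_squareOn_rpow_le hp hN, G.exists_squareOn_weak_type hN, ?_⟩
  obtain ⟨C, hC⟩ := G.exists_oscillation_le hNM
  exact ⟨C, fun f hf hf2 => hC f hf (G.memLp_two_ballIntegrable (by norm_num) hf2)⟩

/-- The metric is installed as a pseudometric structure whose topology is never related to the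
σ-algebra, so no compatibility with a topology on the group is required. -/
theorem squareFun_estimates {X : Type*} [MeasurableSpace X]
    {m : Measure X} (hm : m ≠ 0) {d : X → X → ℝ} (hd : IsMetric d)
    (hmeas : ∀ x r, MeasurableSet (dBall d x r))
    (hfin : ∀ x r, m (dBall d x r) < ∞) {r₀ ε : ℝ} (hr₀ : 0 < r₀) (hε : 0 < ε) {D₀ : ℕ}
    (hdecay : AnnularDecay d m ε r₀) (hdoubling : GeomDoubling d D₀ (4 * r₀))
    {c₀ C₀ δ : ℝ} {I : ℤ → Type*} {z : ∀ k, I k → X} {Q : ∀ k, I k → Set X}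
    (hQ : IsDyadicSystem d c₀ C₀ δ z Q) {N : ℤ} (hN : r₀ ≤ δ ^ (N + 1)) :
    (∀ f : X → ℂ, Measurable f → Measurable (squareFun d m δ Q N f)) ∧
    (∀ p : ℝ, 1 < p → ∃ C : ℝ≥0, ∀ f : X → ℂ, Measurable f → MemLp f (ENNReal.ofReal p) m →
      ∫⁻ x, squareFun d m δ Q N f x ^ p ∂m ≤ C * ∫⁻ x, ‖f x‖ₑ ^ p ∂m) ∧
    (∃ C : ℝ≥0, ∀ f : X → ℂ, Measurable f → Integrable f m → ∀ γ : ℝ≥0∞, γ ≠ 0 → γ ≠ ∞ →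
      m {x | γ < squareFun d m δ Q N f x} ≤ C * (γ⁻¹ * ∫⁻ y, ‖f y‖ₑ ∂m)) ∧
    (∃ C : ℝ≥0, ∀ f : X → ℂ, Measurable f → MemLp f 2 m → ∀ a : ℝ≥0∞, (∀ᵐ y ∂m, ‖f y‖ₑ ≤ a) →
      (∀ᵐ x ∂m, squareFun d m δ Q N f x < ∞) → ∀ k α, ∃ t : ℝ,
      ∫⁻ y in Q k α, ‖(squareFun d m δ Q N f y).toReal - t‖ₑ ∂m ≤ C * a * m (Q k α)) := by
  let _ := hd.toPseudoMetricSpace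
  exact squareFun_estimates_of_dist hm hmeas (fun x r => (hfin x r).ne) hr₀ hε hdecay hdoubling
    hQ hN

/-- The passage from integral bounds to bounds of `L^p` norms. -/
lemma eLpNorm_le_of_lintegral_rpow_le {X : Type*} [MeasurableSpace X] {m : Measure X} {p : ℝ≥0∞}
    (hp : 1 < p) (hp' : p < ∞) {S : X → ℝ≥0∞} {f : X → ℂ} {C : ℝ≥0}
    (h : ∫⁻ x, S x ^ p.toReal ∂m ≤ C * ∫⁻ x, ‖f x‖ₑ ^ p.toReal ∂m) :
    eLpNorm S p m ≤ (C ^ (1 / p.toReal) : ℝ≥0) * eLpNorm f p m := by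
  have hp0 : p ≠ 0 := (zero_lt_one.trans hp).ne'
  rw [eLpNorm_eq_lintegral_rpow_enorm_toReal hp0 hp'.ne,
    eLpNorm_eq_lintegral_rpow_enorm_toReal hp0 hp'.ne,
    ENNReal.coe_rpow_of_nonneg _ (by positivity), ← ENNReal.mul_rpow_of_nonneg _ _ (by positivity)]
  simp only [enorm_eq_self]
  exact ENNReal.rpow_le_rpow h (by positivity)

/-- The dyadic BMO norm is bounded by mean oscillations. -/
lemma dyadicBMONorm_le {X : Type*} [MeasurableSpace X] {m : Measure X} {I : ℤ → Type*}
    {Q : ∀ k, I k → Set X} {g : X → ℝ} {a : ℝ≥0∞}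
    (h : ∀ k α, ∃ t : ℝ, ∫⁻ y in Q k α, ‖g y - t‖ₑ ∂m ≤ a * m (Q k α)) :
    dyadicBMONorm m Q g ≤ a := by
  refine essSup_le_of_ae_le _ (.of_forall fun x => iSup_le fun k => iSup_le fun α =>
    iSup_le fun _ => ?_)
  obtain ⟨t, ht⟩ := h k α
  refine (iInf_le _ t).trans ?_
  rw [setLAverage_eq]
  exact ENNReal.div_le_of_le_mul ht

theorem theorem1p4
    {G : Type*} [Group G] [TopologicalSpace G] [IsTopologicalGroup G] [LocallyCompactSpace G]
    [MeasurableSpace G] [BorelSpace G]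
    (m : Measure G) [IsFiniteMeasureOnCompacts m]
    (d : G → G → ℝ) (hd : IsMetric d)
    (hmeas : ∀ h r, MeasurableSet (dBall d h r))
    (hfin : ∀ h r, m (dBall d h r) < ∞)
    (r₀ ε : ℝ) (hr₀ : 0 < r₀) (hε : 0 < ε) (hε1 : ε ≤ 1) (D₀ : ℕ)
    (hdecay : AnnularDecay d m ε r₀)
    (hdoubling : GeomDoubling d D₀ (4 * r₀))
    (c₀ C₀ δ : ℝ) {I : ℤ → Type*} (z : ∀ k, I k → G) (Q : ∀ k, I k → Set G)
    (hQ : IsDyadicSystem d c₀ C₀ δ z Q)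
    (N : ℤ) (hN : δ ^ N < r₀) (hN1 : r₀ ≤ δ ^ (N + 1)) :
    (∀ p : ℝ≥0∞, 1 < p → p < ∞ → ∃ c : ℝ≥0, 0 < c ∧
      ∀ f : G → ℂ, MemLp f p m →
        AEMeasurable (squareFun d m δ Q N f) m ∧
        eLpNorm (squareFun d m δ Q N f) p m ≤ c * eLpNorm f p m) ∧
    (∃ c : ℝ≥0, 0 < c ∧
      (∀ f : G → ℂ, MemLp f 1 m →
        AEMeasurable (squareFun d m δ Q N f) m ∧
        ∀ γ : ℝ≥0, 0 < γ →
          m {g | (γ : ℝ≥0∞) < squareFun d m δ Q N f g} ≤ (c / γ : ℝ≥0) * eLpNorm f 1 m) ∧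
      (∀ f : G → ℂ, MemLp f ∞ m → HasCompactSupport f →
        (∀ᵐ x ∂m, squareFun d m δ Q N f x < ∞) ∧
        LocallyIntegrable (fun x => (squareFun d m δ Q N f x).toReal) m ∧
        dyadicBMONorm m Q (fun x => (squareFun d m δ Q N f x).toReal)
          ≤ c * eLpNorm f ∞ m)) := by
  -- Positivity of large balls, and so the cube grid, needs a nonzero measure.
  by_cases hm : m = 0
  · subst hm
    refine ⟨fun p _ _ => ⟨1, one_pos, fun f _ => ⟨aemeasurable_zero_measure, by simp⟩⟩,
      1, one_pos, fun f _ => ⟨aemeasurable_zero_measure, by simp⟩, fun f _ _ => ⟨by simp, ?_, ?_⟩⟩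
    · exact fun x => ⟨univ, Filter.univ_mem, by simp [IntegrableOn]⟩
    · rw [dyadicBMONorm, essSup_measure_zero]
      exact bot_le
  obtain ⟨hSm, hLp, ⟨C₁, hweak⟩, C₂, hosc⟩ :=
    squareFun_estimates hm hd hmeas hfin hr₀ hε hdecay hdoubling hQ hN1
  -- The estimates are available for measurable functions; the square function does not see the
  -- change of representative.
  have hrep : ∀ {p : ℝ≥0∞} {f : G → ℂ}, MemLp f p m → ∃ g : G → ℂ, Measurable g ∧ f =ᵐ[m] g ∧
      MemLp g p m := fun {p f} hf =>
    ⟨hf.1.mk f, hf.1.stronglyMeasurable_mk.measurable, hf.1.ae_eq_mk, hf.ae_eq hf.1.ae_eq_mk⟩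
  refine ⟨fun p hp hp' => ?_, C₁ + C₂ + 1, by positivity, fun f hf => ?_, fun f hf hfc => ?_⟩
  · obtain ⟨C, hC⟩ := hLp p.toReal
      (by simpa using (ENNReal.toReal_lt_toReal ENNReal.one_ne_top hp'.ne).2 hp)
    refine ⟨C ^ (1 / p.toReal) + 1, by positivity, fun f hf => ?_⟩
    obtain ⟨g, hgm, hfg, hg⟩ := hrep hf
    rw [squareFun_congr_ae hfg, eLpNorm_congr_ae hfg]
    refine ⟨(hSm g hgm).aemeasurable, (eLpNorm_le_of_lintegral_rpow_le hp hp'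
      (hC g hgm (by rwa [ENNReal.ofReal_toReal hp'.ne]))).trans ?_⟩
    gcongr
    exact le_self_add
  · obtain ⟨g, hgm, hfg, hg⟩ := hrep hf
    rw [squareFun_congr_ae hfg, eLpNorm_congr_ae hfg]
    refine ⟨(hSm g hgm).aemeasurable, fun γ hγ => ?_⟩
    refine (hweak g hgm (memLp_one_iff_integrable.1 hg) γ (by simpa using hγ.ne')
      ENNReal.coe_ne_top).trans ?_
    rw [eLpNorm_one_eq_lintegral_enorm, ← mul_assoc, div_eq_mul_inv, ENNReal.coe_mul,
      ENNReal.coe_inv hγ.ne']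
    gcongr
    rw [add_assoc]
    exact le_self_add
  · have hf2 : MemLp f 2 m := hf.mono_exponent_of_measure_support_ne_top (s := tsupport f)
      (fun x hx => image_eq_zero_of_notMem_tsupport hx) hfc.measure_lt_top.ne le_top
    obtain ⟨g, hgm, hfg, hg⟩ := hrep hf2
    rw [squareFun_congr_ae hfg, eLpNorm_congr_ae hfg]
    obtain ⟨C, hC⟩ := hLp 2 one_lt_two
    have hS2 : ∫⁻ x, squareFun d m δ Q N g x ^ (2 : ℝ) ∂m < ∞ := by
      refine (hC g hgm (by simpa using hg)).trans_lt (ENNReal.mul_lt_top ENNReal.coe_lt_top ?_)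
      simp only [ENNReal.rpow_two]
      rw [← eLpNorm_two_sq]
      exact ENNReal.pow_lt_top hg.2
    have hae : ∀ᵐ x ∂m, squareFun d m δ Q N g x < ∞ := by
      refine (ae_lt_top ((hSm g hgm).pow_const 2) hS2.ne).mono fun x hx => ?_
      by_contra hcon
      rw [not_lt, top_le_iff] at hcon
      rw [hcon, ENNReal.top_rpow_of_pos (by norm_num)] at hx
      exact lt_irrefl _ hx
    refine ⟨hae, ?_, ?_⟩
    · have hL2 : MemLp (fun x => (squareFun d m δ Q N g x).toReal) 2 m := by
        refine ⟨(hSm g hgm).ennreal_toReal.aestronglyMeasurable, ?_⟩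
        by_contra hcon
        rw [not_lt, top_le_iff] at hcon
        have h1 := eLpNorm_two_sq (m := m) fun x => (squareFun d m δ Q N g x).toReal
        rw [hcon] at h1
        refine absurd hS2 (not_lt.2 (le_of_eq_of_le
          (b := ∫⁻ x, ‖(squareFun d m δ Q N g x).toReal‖ₑ ^ 2 ∂m) ?_ (lintegral_mono fun x => ?_)))
        · simpa using h1
        · rw [Real.enorm_of_nonneg ENNReal.toReal_nonneg, ENNReal.rpow_two]
          exact pow_le_pow_left' ENNReal.ofReal_toReal_le 2
      exact hL2.locallyIntegrable (by norm_num)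
    · refine dyadicBMONorm_le fun k α => ?_
      have hbd : ∀ᵐ y ∂m, ‖g y‖ₑ ≤ eLpNorm g ∞ m := by
        rw [eLpNorm_exponent_top]
        exact ae_le_eLpNormEssSup
      obtain ⟨t, ht⟩ := hosc g hgm hg _ hbd hae k α
      refine ⟨t, ht.trans ?_⟩
      gcongr
      exact le_add_self.trans le_self_add
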